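/- Let $\mathbb F$ be a field of characteristic $0$, $H$ a pointed cocommutative Hopf algebra over $\mathbb F$ and $V$ a finite-dimensional $H$-module with an $H$-invariant nondegenerate symmetric bilinear form $\langle\cdot,\cdot\rangle$ (i.e. $\langle hv,w\rangle=\langle v,S(h)w\rangle$). Let $\kappa:V\wedge V\to H$ be linear and let $A=(T(V)\rtimes H)/I_\kappa$, where $I_\kappa$ is the ideal generated by the elements $vw-wv-\kappa(v\wedge w)$, $v,w\in V$. Assume that $A$ has the PBW property: the natural surjection from $S(V)\rtimes H$ to the associated graded algebra of $A$, for the filtration induced by the degree in $T(V)$, is an isomorphism. Let $C$ be the Clifford algebra of $V$, with relations $vw+wv=2\langle v,w\rangle$. For a Hopf algebra $K$ acting orthogonally on $V$, let $K^{\mathrm{even}},K^{\mathrm{odd}}$ be the spans of the products of group-like and primitive elements of even, respectively odd, total degree, where a group-like $g$ has sign $(-1)^{|g|}=\det(g|_V)$ and primitive elements are even. Let $(\tilde H,\pi,\gamma)$ be a pin cover of $(H,V)$, that is: $\tilde H$ is a pointed cocommutative Hopf algebra; $\pi:\tilde H\to H$ is a surjective Hopf algebra map such that $\tilde H\cong H\oplus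 H$ as coalgebras with $\pi$ bijective on each copy of $H$; and $\gamma:\tilde H\to C$ is an algebra map that preserves the $\mathbb Z_2$-gradations (where $\tilde H$ acts on $V$ through $\pi$) and satisfies $(-1)^{|h|}\,\pi(h)\cdot v=\gamma(h_{(1)})\,v\,\gamma(S h_{(2)})$ in $C$ for all homogeneous $h\in\tilde H$ and all $v\in V$. Put $\Delta_C(h)=\pi(h_{(1)})\otimes\gamma(h_{(2)})\in H\otimes C$, which is also viewed in $A\otimes C$, and $H'=\tilde H/\ker\Delta_C$. Let $D=\sum_k v_k\otimes v^k\in A\otimes C$ for a pair of dual bases $(v_k),(v^k)$ of $V$, and assume that $A$ is a Barbasch–Sahi algebra, i.e. $D^2\in Z(A\otimes C)+\Delta_C(\tilde H^{\mathrm{even}})$. Let $(A\otimes C)^{\mathrm{odd}}_{\det}$ be the space of those $a\in A\otimes C$ that are odd for the $\mathbb Z_2$-gradation inherited from $C$ and satisfy $\Delta_C(h_{(1)})\,a\,\Delta_C(Sh_{(2)})=(-1)^{|h|}\varepsilon(h)\,a$ for all homogeneous $h\in\tilde H$. Then there is an algebra map $\zeta:Z(A)\to Z(H')$ such that for every $z\in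 Z(A)$ there is an $a\in(A\otimes C)^{\mathrm{odd}}_{\det}$ with $$z\otimes 1=\Delta_C(\zeta(z))+Da+aD,$$ and $\zeta(z)$ is the only element of $Z(H')$ for which such an $a$ exists. Moreover, let $M$ be an $A$-module with central character $\chi:Z(A)\to\mathbb F$, let $S$ be a $C$-module (for example a spin module), and let $$H^D(M)=\ker D/(\operatorname{im}D\cap\ker D)$$ for $D$ acting on $M\otimes S$. Then the action of $\tilde H$ on $M\otimes S$ through $\Delta_C$ preserves $\ker D$ and induces an $H'$-module structure on $H^D(M)$, and for every nonzero $H'$-submodule $(U,\sigma)$ of $H^D(M)$ one has $\chi=\sigma\circ\zeta$, that is, $\sigma(\zeta(z))=\chi(z)\,\mathrm{id}_U$ for all $z\in Z(A)$. -/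

import Mathlib

open scoped TensorProduct

noncomputable section

namespace BarbaschSahi

/-! ## Pointed coalgebras -/

section Coalgebras

variable (F : Type*) [Field F] {K : Type*} [AddCommGroup K] [Module F K] [Coalgebra F K]

/-- A subspace `E` of a coalgebra is a subcoalgebra if `Δ(E) ⊆ E ⊗ E`. -/
def IsSubcoalgebra (E : Submodule F K) : Prop :=
  ∀ c ∈ E, (Coalgebra.comul c : K ⊗[F] K) ∈
    LinearMap.range (TensorProduct.map E.subtype E.subtype)

/-- A simple subcoalgebra: nonzero, with no subcoalgebras besides `0` and itself. -/
def IsSimpleSubcoalgebra (E : Submodule F K) : Prop :=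
  IsSubcoalgebra F E ∧ E ≠ ⊥ ∧
    ∀ E' : Submodule F K, IsSubcoalgebra F E' → E' ≤ E → E' = ⊥ ∨ E' = E

variable (K) in
/-- A coalgebra is pointed if every simple subcoalgebra is one-dimensional. -/
def IsPointed : Prop :=
  ∀ E : Submodule F K, IsSimpleSubcoalgebra F E → Module.finrank F E = 1

/-- `x` is primitive if `Δ x = 1 ⊗ x + x ⊗ 1`. -/
def IsPrimitiveElem {K : Type*} [Ring K] [Bialgebra F K] (x : K) : Prop :=
  (Coalgebra.comul x : K ⊗[F] K) = 1 ⊗ₜ[F] x + x ⊗ₜ[F] 1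

end Coalgebras

/-! ## Hopf algebras acting on an algebra or on a vector space with a bilinear form -/

section Hopf

variable {F : Type*} [Field F] {K : Type*} [Ring K] [HopfAlgebra F K]

/-- For an algebra map `f : K → R`, the action `h · r = f(h₍₁₎) r f(S h₍₂₎)` of `K` on `R`. -/
def adAct {R : Type*} [Ring R] [Algebra F R] (f : K →ₐ[F] R) : K →ₗ[F] Module.End F R :=
  LinearMap.mul' F (Module.End F R) ∘ₗ
    TensorProduct.map (LinearMap.mul F R ∘ₗ f.toLinearMap)
      ((LinearMap.mul F R).flip ∘ₗ f.toLinearMap ∘ₗ HopfAlgebra.antipode F) ∘ₗ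
    Coalgebra.comul

variable {V : Type*} [AddCommGroup V] [Module F V]

/-- The bilinear form `B` is a nondegenerate symmetric form on the `K`-module `V` (with
representation `ρ`) that is `K`-invariant: `⟨h v, w⟩ = ⟨v, S(h) w⟩`. -/
structure IsOrthogonal (ρ : K →ₐ[F] Module.End F V) (B : LinearMap.BilinForm F V) : Prop where
  symm : B.IsSymm
  nondegenerate : B.Nondegenerate
  invariant : ∀ (h : K) (v w : V), B (ρ h v) w = B v (ρ (HopfAlgebra.antipode F h) w)

/-- Elements of `K` that are homogeneous for the `ℤ/2`-gradation of the algebra `K` in which a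
group-like element `g` has sign `det (g|V)` and primitive elements are even: products of
group-like and primitive elements, with the degrees added up. -/
inductive IsHomogeneousProduct (ρ : K →ₐ[F] Module.End F V) : ZMod 2 → K → Prop
  | groupLike_even (g : K) (hg : IsGroupLikeElem F g) (hdet : LinearMap.det (ρ g) = 1) :
      IsHomogeneousProduct ρ 0 g
  | groupLike_odd (g : K) (hg : IsGroupLikeElem F g) (hdet : LinearMap.det (ρ g) = -1) :
      IsHomogeneousProduct ρ 1 g
  | primitive (x : K) (hx : IsPrimitiveElem F x) : IsHomogeneousProduct ρ 0 x
  | mul (i j : ZMod 2) (a b : K) (ha : IsHomogeneousProduct ρ i a)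
      (hb : IsHomogeneousProduct ρ j b) : IsHomogeneousProduct ρ (i + j) (a * b)

/-- The homogeneous subspace of degree `i` of the `ℤ/2`-gradation of `K` determined by the
orthogonal `K`-module `V`. -/
def parity (ρ : K →ₐ[F] Module.End F V) (i : ZMod 2) : Submodule F K :=
  Submodule.span F {h | IsHomogeneousProduct ρ i h}

variable (F) in
/-- The sign `(-1)^i` in `F`, for `i` in `ℤ/2`. -/
def sgn (i : ZMod 2) : F := (-1) ^ i.val

end Hopf

/-! ## The algebras `T(V) ⋊ H` and `A = (T(V) ⋊ H) / I_κ` -/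

section Hecke

variable {F : Type*} [Field F] {H : Type*} [Ring H] [HopfAlgebra F H]
  {V : Type*} [AddCommGroup V] [Module F V]

/-- Relations of `T(V) ⋊ H` between the generators `V` and `H`: those of the algebra `H`, and
`h v = (h₍₁₎ · v) h₍₂₎`. -/
inductive SmashRel (ρ : H →ₐ[F] Module.End F V) :
    TensorAlgebra F (V × H) → TensorAlgebra F (V × H) → Prop
  | one : SmashRel ρ (TensorAlgebra.ι F (0, 1)) 1
  | mul (h k : H) : SmashRel ρ (TensorAlgebra.ι F (0, h * k))
      (TensorAlgebra.ι F (0, h) * TensorAlgebra.ι F (0, k))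
  | cross (h : H) (v : V) : SmashRel ρ
      (TensorAlgebra.ι F (0, h) * TensorAlgebra.ι F (v, 0))
      (LinearMap.mul' F (TensorAlgebra F (V × H))
        (TensorProduct.map
          (TensorAlgebra.ι F ∘ₗ LinearMap.inl F V H ∘ₗ ρ.toLinearMap.flip v)
          (TensorAlgebra.ι F ∘ₗ LinearMap.inr F V H)
          (Coalgebra.comul h)))

/-- The smash product `T(V) ⋊ H`: the algebra generated by the tensor algebra of `V` and by `H`
with the relation `h v = (h₍₁₎ · v) h₍₂₎`. -/
def TensorSmash (ρ : H →ₐ[F] Module.End F V) : Type _ := RingQuot (SmashRel ρ)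

instance (ρ : H →ₐ[F] Module.End F V) : Ring (TensorSmash ρ) :=
  inferInstanceAs (Ring (RingQuot (SmashRel ρ)))

instance (ρ : H →ₐ[F] Module.End F V) : Algebra F (TensorSmash ρ) :=
  inferInstanceAs (Algebra F (RingQuot (SmashRel ρ)))

/-- The projection from the free algebra on `V ⊕ H` onto `T(V) ⋊ H`. -/
def smashMk (ρ : H →ₐ[F] Module.End F V) : TensorAlgebra F (V × H) →ₐ[F] TensorSmash ρ :=
  RingQuot.mkAlgHom F (SmashRel ρ)

theorem smashMk_rel {ρ : H →ₐ[F] Module.End F V} {x y : TensorAlgebra F (V × H)}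
    (h : SmashRel ρ x y) : smashMk ρ x = smashMk ρ y :=
  RingQuot.mkAlgHom_rel F h

/-- The generators `v ∈ V` of `T(V) ⋊ H`. -/
def smashV (ρ : H →ₐ[F] Module.End F V) : V →ₗ[F] TensorSmash ρ :=
  (smashMk ρ).toLinearMap ∘ₗ TensorAlgebra.ι F ∘ₗ LinearMap.inl F V H

/-- The generators `h ∈ H` of `T(V) ⋊ H`. -/
def smashH (ρ : H →ₐ[F] Module.End F V) : H →ₗ[F] TensorSmash ρ :=
  (smashMk ρ).toLinearMap ∘ₗ TensorAlgebra.ι F ∘ₗ LinearMap.inr F V H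

/-- The relations `v w - w v = κ(v ∧ w)` that generate the ideal `I_κ`. -/
inductive HeckeRel (ρ : H →ₐ[F] Module.End F V) (κ : V [⋀^Fin 2]→ₗ[F] H) :
    TensorSmash ρ → TensorSmash ρ → Prop
  | comm (v w : V) : HeckeRel ρ κ
      (smashV ρ v * smashV ρ w - smashV ρ w * smashV ρ v) (smashH ρ (κ ![v, w]))

/-- The algebra `A = A_κ = (T(V) ⋊ H) / I_κ`. -/
def HeckeAlgebra (ρ : H →ₐ[F] Module.End F V) (κ : V [⋀^Fin 2]→ₗ[F] H) : Type _ :=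
  RingQuot (HeckeRel ρ κ)

instance (ρ : H →ₐ[F] Module.End F V) (κ : V [⋀^Fin 2]→ₗ[F] H) : Ring (HeckeAlgebra ρ κ) :=
  inferInstanceAs (Ring (RingQuot (HeckeRel ρ κ)))

instance (ρ : H →ₐ[F] Module.End F V) (κ : V [⋀^Fin 2]→ₗ[F] H) :
    Algebra F (HeckeAlgebra ρ κ) :=
  inferInstanceAs (Algebra F (RingQuot (HeckeRel ρ κ)))

variable (ρ : H →ₐ[F] Module.End F V) (κ : V [⋀^Fin 2]→ₗ[F] H)

/-- The projection from `T(V) ⋊ H` onto `A`. -/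
def heckeMk : TensorSmash ρ →ₐ[F] HeckeAlgebra ρ κ :=
  RingQuot.mkAlgHom F (HeckeRel ρ κ)

/-- The canonical map `V → A`. -/
def heckeV : V →ₗ[F] HeckeAlgebra ρ κ :=
  (heckeMk ρ κ).toLinearMap ∘ₗ smashV ρ

/-- The canonical algebra map `H → A`. -/
def heckeH : H →ₐ[F] HeckeAlgebra ρ κ :=
  (heckeMk ρ κ).comp
    (AlgHom.ofLinearMap (smashH ρ)
      ((smashMk_rel SmashRel.one).trans (map_one _))
      (fun h k => (smashMk_rel (SmashRel.mul h k)).trans (map_mul _ _ _)))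

/-- The subspace `F_{n-1}` of `A` of elements of filtration degree less than `n`, for the
filtration by degree in `T(V)`: the span of all `v₁ ⋯ v_k h` with `k < n`. -/
def filtLT (n : ℕ) : Submodule F (HeckeAlgebra ρ κ) :=
  ⨆ k ∈ Set.Iio n, LinearMap.range (heckeV ρ κ) ^ k * LinearMap.range (heckeH ρ κ).toLinearMap

/-- The homogeneous component `F_n / F_{n-1}` of the associated graded algebra of `A`. -/
abbrev gradedPiece (n : ℕ) : Type _ :=
  (filtLT ρ κ (n + 1)) ⧸ (filtLT ρ κ n).submoduleOf (filtLT ρ κ (n + 1))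

variable (F V) in
/-- The `n`-th symmetric power `Sⁿ(V)` as a subspace of the symmetric algebra `S(V)`. -/
abbrev symPiece (n : ℕ) : Submodule F (SymmetricAlgebra F V) :=
  LinearMap.range (SymmetricAlgebra.ι F V) ^ n

theorem prod_ofFn_mem_pow {R : Type*} [Ring R] [Algebra F R] (f : V →ₗ[F] R) (n : ℕ)
    (v : Fin n → V) : (List.ofFn fun i => f (v i)).prod ∈ LinearMap.range f ^ n := by
  induction n with
  | zero =>
    rw [List.ofFn_zero, List.prod_nil, pow_zero]
    exact Submodule.one_le.mp le_rfl
  | succ n ih =>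
    rw [List.ofFn_succ, List.prod_cons, pow_succ']
    exact Submodule.mul_mem_mul ⟨_, rfl⟩ (ih _)

theorem word_mem_filtLT (n : ℕ) (v : Fin n → V) (h : H) :
    (List.ofFn fun i => heckeV ρ κ (v i)).prod * heckeH ρ κ h ∈ filtLT ρ κ (n + 1) :=
  Submodule.mem_iSup_of_mem n <| Submodule.mem_iSup_of_mem (Set.mem_Iio.2 n.lt_succ_self) <|
    Submodule.mul_mem_mul (prod_ofFn_mem_pow _ _ _) ⟨h, rfl⟩

/-- The PBW property: the natural surjection from `S(V) ⋊ H`, whose underlying space is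
`S(V) ⊗ H`, to the associated graded algebra of `A` is bijective; that is, in every degree `n`
the assignment `v₁ ⋯ v_n ⊗ h ↦ v₁ ⋯ v_n h` is an isomorphism `Sⁿ(V) ⊗ H ≅ F_n / F_{n-1}`. -/
def HasPBW : Prop :=
  ∀ n : ℕ, ∃ φ : (symPiece F V n ⊗[F] H) ≃ₗ[F] gradedPiece ρ κ n,
    ∀ (v : Fin n → V) (h : H),
      φ (⟨(List.ofFn fun i => SymmetricAlgebra.ι F V (v i)).prod,
          prod_ofFn_mem_pow _ _ _⟩ ⊗ₜ[F] h) =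
        Submodule.Quotient.mk
          ⟨(List.ofFn fun i => heckeV ρ κ (v i)).prod * heckeH ρ κ h, word_mem_filtLT ρ κ n v h⟩

/-- `A = A_κ` is a Hopf-Hecke algebra (with respect to the form `B` on `V`): `V` is an
orthogonal `H`-module and `A` has the PBW property. -/
structure IsHopfHecke (B : LinearMap.BilinForm F V) : Prop where
  orthogonal : IsOrthogonal ρ B
  pbw : HasPBW ρ κ

end Hecke

/-! ## Clifford algebra and pin covers -/

section Pin

variable {F : Type*} [Field F] {H : Type*} [Ring H] [HopfAlgebra F H]
  {V : Type*} [AddCommGroup V] [Module F V]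

/-- The Clifford algebra `C(V)` with relations `v w + w v = 2 ⟨v, w⟩`, i.e. `v² = ⟨v, v⟩`. -/
abbrev Cliff (B : LinearMap.BilinForm F V) : Type _ :=
  CliffordAlgebra (LinearMap.BilinMap.toQuadraticMap B)

/-- The canonical map `V → C(V)`. -/
abbrev cliffV (B : LinearMap.BilinForm F V) : V →ₗ[F] Cliff B :=
  CliffordAlgebra.ι (LinearMap.BilinMap.toQuadraticMap B)

/-- The homogeneous subspaces of the `ℤ/2`-gradation of `C(V)`. -/
abbrev cliffParity (B : LinearMap.BilinForm F V) (i : ZMod 2) : Submodule F (Cliff B) :=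
  CliffordAlgebra.evenOdd (LinearMap.BilinMap.toQuadraticMap B) i

/-- `(Ht, π)` is a double cover of `H`: `π` is a surjective map of Hopf algebras, and
`Ht ≅ H ⊕ H` as coalgebras in such a way that `π` is bijective on each of the two copies. -/
structure IsDoubleCover {Ht : Type*} [Ring Ht] [HopfAlgebra F Ht] (π : Ht →ₐc[F] H) : Prop where
  surjective : Function.Surjective π
  split : ∃ e : (H × H) ≃ₗc[F] Ht,
    Function.Bijective (fun h : H => π (e (h, 0))) ∧
    Function.Bijective (fun h : H => π (e (0, h)))

/-- The `Ht`-module structure on `V` through `π`. -/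
abbrev pullRep {Ht : Type*} [Ring Ht] [HopfAlgebra F Ht] (ρ : H →ₐ[F] Module.End F V)
    (π : Ht →ₐc[F] H) : Ht →ₐ[F] Module.End F V :=
  ρ.comp (π : Ht →ₐ[F] H)

/-- `(Ht, π, γ)` is a pin cover of the Hopf algebra `H` with respect to the orthogonal `H`-module
`V`: the Hopf algebra `Ht` is pointed and cocommutative, `(Ht, π)` is a double cover of `H`, the
algebra map `γ : Ht → C(V)` preserves the `ℤ/2`-gradations, and
`(-1)^|h| π(h) · v = γ(h₍₁₎) v γ(S h₍₂₎)` in `C(V)` for all homogeneous `h` and all `v ∈ V`. -/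
structure IsPinCover (ρ : H →ₐ[F] Module.End F V) (B : LinearMap.BilinForm F V)
    {Ht : Type*} [Ring Ht] [HopfAlgebra F Ht] (π : Ht →ₐc[F] H) (γ : Ht →ₐ[F] Cliff B) :
    Prop where
  cocomm : Coalgebra.IsCocomm F Ht
  pointed : IsPointed F Ht
  doubleCover : IsDoubleCover π
  map_parity : ∀ i : ZMod 2, ∀ h ∈ parity (pullRep ρ π) i, γ h ∈ cliffParity B i
  compat : ∀ i : ZMod 2, ∀ h ∈ parity (pullRep ρ π) i, ∀ v : V,
    sgn F i • cliffV B (ρ (π h) v) = adAct γ h (cliffV B v)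

variable {B : LinearMap.BilinForm F V} {Ht : Type*} [Ring Ht] [HopfAlgebra F Ht]

/-- The diagonal map `Δ_C : Ht → H ⊗ C(V)`, `h ↦ π(h₍₁₎) ⊗ γ(h₍₂₎)`. -/
def diag (π : Ht →ₐc[F] H) (γ : Ht →ₐ[F] Cliff B) : Ht →ₐ[F] H ⊗[F] Cliff B :=
  (Algebra.TensorProduct.map (π : Ht →ₐ[F] H) γ).comp (Bialgebra.comulAlgHom F Ht)

/-- The quotient algebra `H' = Ht / ker Δ_C`. -/
abbrev QuotHopf (π : Ht →ₐc[F] H) (γ : Ht →ₐ[F] Cliff B) : Type _ :=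
  Ht ⧸ RingHom.ker (diag π γ)

/-- The projection `Ht → H'`. -/
abbrev toQuot (π : Ht →ₐc[F] H) (γ : Ht →ₐ[F] Cliff B) : Ht →ₐ[F] QuotHopf π γ :=
  Ideal.Quotient.mkₐ F (RingHom.ker (diag π γ))

end Pin

/-! ## The Dirac element and Dirac cohomology -/

section Dirac

variable {F : Type*} [Field F] {H : Type*} [Ring H] [HopfAlgebra F H]
  {V : Type*} [AddCommGroup V] [Module F V]
  (ρ : H →ₐ[F] Module.End F V) (κ : V [⋀^Fin 2]→ₗ[F] H) (B : LinearMap.BilinForm F V)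

/-- The algebra `A ⊗ C`. -/
abbrev AC : Type _ := HeckeAlgebra ρ κ ⊗[F] Cliff B

/-- The Dirac element `D = ∑ v_k ⊗ v^k` in `A ⊗ C`, for a basis `b = (v_k)` of `V` and the dual
basis `(v^k)` with respect to `B`. -/
def dirac {ι : Type*} [Fintype ι] [DecidableEq ι] (hB : B.Nondegenerate)
    (b : Module.Basis ι F V) : AC ρ κ B :=
  ∑ k, heckeV ρ κ (b k) ⊗ₜ[F] cliffV B (B.dualBasis hB b k)

variable {B} {Ht : Type*} [Ring Ht] [HopfAlgebra F Ht]

/-- The diagonal map `Δ_C`, viewed as a map `Ht → H ⊗ C → A ⊗ C`. -/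
def diagAC (π : Ht →ₐc[F] H) (γ : Ht →ₐ[F] Cliff B) : Ht →ₐ[F] AC ρ κ B :=
  (Algebra.TensorProduct.map (heckeH ρ κ) (AlgHom.id F (Cliff B))).comp (diag π γ)

/-- The map `H' → A ⊗ C` induced by the diagonal map `Δ_C`. -/
def quotDiagAC (π : Ht →ₐc[F] H) (γ : Ht →ₐ[F] Cliff B) : QuotHopf π γ →ₐ[F] AC ρ κ B :=
  (Algebra.TensorProduct.map (heckeH ρ κ) (AlgHom.id F (Cliff B))).comp
    (Ideal.kerLiftAlg (diag π γ))

/-- The Parthasarathy condition on an element `D` of `A ⊗ C`: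
`D² ∈ Z(A ⊗ C) + Δ_C(Ht^even)`. -/
def Parthasarathy (π : Ht →ₐc[F] H) (γ : Ht →ₐ[F] Cliff B) (D : AC ρ κ B) : Prop :=
  D ^ 2 ∈ Subalgebra.toSubmodule (Subalgebra.center F (AC ρ κ B)) ⊔
    (parity (pullRep ρ π) 0).map (diagAC ρ κ π γ).toLinearMap

/-- The subspace `(A ⊗ C)_det^odd`: elements `x` that are odd for the `ℤ/2`-gradation inherited
from `C`, and on which every homogeneous `h` in `Ht` acts, through
`h · x = Δ_C(h₍₁₎) x Δ_C(S h₍₂₎)`, by `(-1)^|h| ε(h)`. -/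
def IsDetOdd (π : Ht →ₐc[F] H) (γ : Ht →ₐ[F] Cliff B) (x : AC ρ κ B) : Prop :=
  x ∈ LinearMap.range ((cliffParity B 1).subtype.lTensor (HeckeAlgebra ρ κ)) ∧
    ∀ i : ZMod 2, ∀ h ∈ parity (pullRep ρ π) i,
      adAct (diagAC ρ κ π γ) h x = (sgn F i * Coalgebra.counit h) • x

variable (M S : Type*) [AddCommGroup M] [Module F M] [Module (HeckeAlgebra ρ κ) M]
  [IsScalarTower F (HeckeAlgebra ρ κ) M]
  [AddCommGroup S] [Module F S] [Module (Cliff B) S] [IsScalarTower F (Cliff B) S]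

/-- The action of `A ⊗ C` on `M ⊗ S`, `(a ⊗ c)(m ⊗ s) = a m ⊗ c s`. -/
def actMS : AC ρ κ B →ₐ[F] Module.End F (M ⊗[F] S) :=
  Module.endTensorEndAlgHom.comp
    (Algebra.TensorProduct.map (Algebra.lsmul F F M) (Algebra.lsmul F F S))

variable {ρ κ} in
/-- The Dirac cohomology `ker D / (im D ∩ ker D)`, for `D` acting on `M ⊗ S`. -/
abbrev DiracCohomology (D : AC ρ κ B) : Type _ :=
  LinearMap.ker (actMS ρ κ M S D) ⧸
    (LinearMap.range (actMS ρ κ M S D) ⊓ LinearMap.ker (actMS ρ κ M S D)).submoduleOf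
      (LinearMap.ker (actMS ρ κ M S D))

variable {ρ κ} in
/-- The class in `H^D(M)` of an element of `ker D`. -/
abbrev diracClass (D : AC ρ κ B) :
    LinearMap.ker (actMS ρ κ M S D) →ₗ[F] DiracCohomology M S D :=
  Submodule.mkQ _

variable {ρ κ M S} in
/-- `τ` is the action of `H'` on the Dirac cohomology that is induced by the action of `Ht` on
`M ⊗ S` through `Δ_C`: each `Δ_C(h)` preserves `ker D`, and the class of `h` in `H'` maps the
class of `x` to the class of `Δ_C(h) x`. -/
def IsInducedAction (π : Ht →ₐc[F] H) (γ : Ht →ₐ[F] Cliff B) (D : AC ρ κ B)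
    (τ : QuotHopf π γ →ₐ[F] Module.End F (DiracCohomology M S D)) : Prop :=
  ∀ (h : Ht) (x : LinearMap.ker (actMS ρ κ M S D)),
    ∃ y : LinearMap.ker (actMS ρ κ M S D),
      (y : M ⊗[F] S) = actMS ρ κ M S (diagAC ρ κ π γ h) (x : M ⊗[F] S) ∧
      τ (toQuot π γ h) (diracClass M S D x) = diracClass M S D y

end Dirac

end BarbaschSahi

end

open scoped TensorProduct

noncomputable section

namespace BarbaschSahi

/-! ## Logarithms of unipotent elements -/

section Unipotent

open Polynomial

/-! Write `θ` for the parity involution of `A ⊗ C`, `Q` for the image of `Δ_C`, and `d a = D a -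
θ(a) D`. The pin condition gives `D q = θ(q) D` for `q` in `Q`. Hence `d` kills `Q` and acts on the
elements that commute with `Q` up to sign (`superCentralizer`), whose odd part is `(A ⊗ C)_det^odd`.
There `d² = 0`: `d²` is the commutator with `D²`, which is a central element plus an even element of
`Q`. For `z` in the center of `A`, the element `z ⊗ 1` is an even cocycle. The theorem therefore
reduces to a computation of cohomology: every cocycle is `q + d b` with `q` in `Q`, and a coboundary
lying in `Q` is zero (`IsFilteredHomotopy.exists_eq_add`, `IsFilteredHomotopy.d_eq_zero`).

Under a linear isomorphism `S(V) ⊗ C ⊗ H ≅ A ⊗ C` (`acEquiv`), the leading term of `d` for the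
degree in `A` is the Koszul differential `∑ X_k ⊗ contraction` (`superComm_acEquiv_sub_mem`). With
`s = ∑ ∂_k ⊗ insertion`, the operator `d s + s d` is multiplication by `4 (n + k)` in polynomial
degree `n` and Clifford degree `k`, up to lower terms (`koszul_laplace`, `laplace_mem`). In
characteristic zero this is invertible unless `n = k = 0`, and that part is exactly `Q`. Successive
approximation then removes the higher terms of a cocycle.

The approximation must stay inside the invariants, so `s` has to be compatible with the action of
`Ht`. This dictates the isomorphism: `S(V)` is embedded by symmetrization instead of ordered
monomials, and `H` is embedded diagonally, through a coalgebra section of the pin cover and a twist,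
instead of as `H ⊗ 1`. Compatibility is checked on group-like elements (`acHomotopy_groupLike_mul`)
and on primitive elements (`acHomotopy_primitive_mul`). These generate `Ht`, by the theorem on
pointed cocommutative Hopf algebras in characteristic zero (`groupPrimitiveSubalgebra_eq_top`),
which is proved with logarithms of unipotent coalgebra maps.

The PBW property makes `H' → A ⊗ C` injective, so `q` determines an element of `H'`; it is central
because `q` commutes with `Q`. The relation between `z` and `ζ(z)` respects products, since `d` is
linear over even cocycles. On `ker D` the element `D a + a D` acts as `D a`, with values in `im D`,
so `z` and `ζ(z)` act equally on cohomology. -/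

theorem polynomial_eq_zero_of_eval_natCast (F : Type*) [Field F] [CharZero F]
    {R : Type*} [Ring R] [Algebra F R] (p : R[X]) (h : ∀ k : ℕ, p.eval (k : R) = 0) :
    p = 0 := by
  ext i
  rw [coeff_zero, ← Module.forall_dual_apply_eq_zero_iff F]
  intro f
  -- `R` may have zero divisors, so roots are counted only after a linear functional has been
  -- applied to the coefficients.
  set q : F[X] := ∑ i ∈ Finset.range (p.natDegree + 1), monomial i (f (p.coeff i)) with hq
  have hq0 : q = 0 := by
    refine eq_zero_of_infinite_isRoot q (Set.Infinite.mono ?_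
      (Set.infinite_range_of_injective (Nat.cast_injective (R := F))))
    rintro _ ⟨k, rfl⟩
    have := congrArg f (h k)
    rw [map_zero, eval_eq_sum_range, map_sum] at this
    rw [Set.mem_ofPred_eq, IsRoot.def, hq, eval_finsetSum, ← this]
    refine Finset.sum_congr rfl fun i _ => ?_
    rw [eval_monomial, ← Nat.cast_pow, ← Nat.cast_pow, ← nsmul_eq_mul', ← nsmul_eq_mul', map_nsmul]
  have hc := congrArg (fun q => coeff q i) hq0
  simp only [hq, finsetSum_coeff, coeff_monomial, Finset.sum_ite_eq', Finset.mem_range,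
    coeff_zero] at hc
  by_cases hi : i < p.natDegree + 1
  · simpa [hi] using hc
  · rw [coeff_eq_zero_of_natDegree_lt (by omega), map_zero]

variable (F : Type*) [Field F]

/-- The polynomial whose value at `k` is the binomial coefficient `k.choose j`. -/
def binomPoly (j : ℕ) : F[X] := C ((j.factorial : F)⁻¹) * descPochhammer F j

theorem binomPoly_one_coeff_one : (binomPoly F 1).coeff 1 = 1 := by
  simp [binomPoly]

theorem binomPoly_zero : binomPoly F 0 = 1 := by
  simp [binomPoly]

variable [CharZero F]

theorem binomPoly_eval (j k : ℕ) : (binomPoly F j).eval (k : F) = (k.choose j : F) := by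
  have h : (j.factorial : F) ≠ 0 := Nat.cast_ne_zero.2 j.factorial_ne_zero
  rw [binomPoly, eval_mul, eval_C, descPochhammer_eval_eq_descFactorial,
    Nat.descFactorial_eq_factorial_mul_choose, Nat.cast_mul, inv_mul_cancel_left₀ h]

theorem binomPoly_coeff_zero (j : ℕ) : (binomPoly F j).coeff 0 = if j = 0 then 1 else 0 := by
  rw [coeff_zero_eq_eval_zero]
  have := binomPoly_eval F j 0
  rw [Nat.cast_zero] at this
  rw [this]
  rcases j with _ | j <;> simp

variable {R : Type*} [Ring R] [Algebra F R]

/-- A polynomial whose value at `k` is `(1 + n) ^ k`, if `n ^ N = 0`. -/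
def unipPoly (N : ℕ) (n : R) : R[X] :=
  ∑ j ∈ Finset.range N, C (n ^ j) * (binomPoly F j).map (algebraMap F R)

/-- The logarithm of `1 + n`, if `n ^ N = 0`. -/
def nilLog (N : ℕ) (n : R) : R := (unipPoly F N n).coeff 1

omit [CharZero F] in
theorem nilLog_eq (N : ℕ) (n : R) :
    nilLog F N n = ∑ j ∈ Finset.range N, (binomPoly F j).coeff 1 • n ^ j := by
  rw [nilLog, unipPoly, finsetSum_coeff]
  refine Finset.sum_congr rfl fun j _ => ?_
  rw [coeff_C_mul, coeff_map, ← Algebra.commutes, Algebra.smul_def]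

theorem unipPoly_coeff_zero (N : ℕ) (n : R) : (unipPoly F (N + 1) n).coeff 0 = 1 := by
  rw [unipPoly, finsetSum_coeff, Finset.sum_eq_single 0]
  · simp [binomPoly_coeff_zero]
  · intro j _ hj
    simp [binomPoly_coeff_zero, hj]
  · simp

theorem unipPoly_eval {N : ℕ} {n : R} (hn : n ^ N = 0) (k : ℕ) :
    (unipPoly F N n).eval (k : R) = (1 + n) ^ k := by
  rw [add_comm, (Commute.one_right n).add_pow, unipPoly, eval_finsetSum]
  have key : ∀ j, (C (n ^ j) * (binomPoly F j).map (algebraMap F R)).eval (k : R)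
      = n ^ j * (k.choose j : R) := by
    intro j
    rw [eval_C_mul, ← map_natCast (algebraMap F R) k, eval_map_algebraMap,
      aeval_algebraMap_apply, coe_aeval_eq_eval, binomPoly_eval, map_natCast]
  simp only [key, one_pow, mul_one]
  -- The binomial expansion runs over `j ≤ k` and the polynomial over `j < N`. Surplus terms vanish
  -- on either side: `n ^ j = 0` for `j ≥ N`, and the binomial coefficient is zero for `j > k`.
  rcases le_total N (k + 1) with hN | hN
  · refine Finset.sum_subset (Finset.range_mono hN) fun j _ hj => ?_
    rw [pow_eq_zero_of_le (by simpa using hj) hn, zero_mul]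
  · refine (Finset.sum_subset (Finset.range_mono hN) fun j _ hj => ?_).symm
    rw [Nat.choose_eq_zero_of_lt (by simpa using hj), Nat.cast_zero, mul_zero]

/-- Commuting factors have multiplicative powers, so the interpolating polynomials multiply, as they
agree at all natural numbers. Both factors have constant term 1, so the linear coefficient of the
product is the sum. Evaluation is multiplicative at these points because natural numbers are central
in `R`. -/
theorem nilLog_mul {N : ℕ} {n m w : R} (hn : n ^ (N + 1) = 0) (hm : m ^ (N + 1) = 0)
    (hw : w ^ (N + 1) = 0) (hc : Commute (1 + n) (1 + m)) (h : 1 + w = (1 + n) * (1 + m)) :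
    nilLog F (N + 1) w = nilLog F (N + 1) n + nilLog F (N + 1) m := by
  have hp : unipPoly F (N + 1) w = unipPoly F (N + 1) n * unipPoly F (N + 1) m := by
    rw [← sub_eq_zero]
    refine polynomial_eq_zero_of_eval_natCast F _ fun k => ?_
    rw [eval_sub, unipPoly_eval F hw, h, hc.mul_pow, eval, eval₂_mul_noncomm, ← eval, ← eval,
      unipPoly_eval F hn, unipPoly_eval F hm, sub_self]
    exact fun j => (Nat.cast_commute k _).symm
  rw [nilLog, hp, coeff_mul]
  simp [Finset.Nat.antidiagonal_succ, unipPoly_coeff_zero, nilLog, add_comm]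

omit [CharZero F] in
-- The logarithm has the form `n (1 + n r)`, so its powers can replace the powers of `n` one order
-- at a time, and the process ends because `n` is nilpotent.
theorem mem_adjoin_nilLog {N : ℕ} {n : R} (hn : n ^ N = 0) :
    n ∈ Algebra.adjoin F {nilLog F N n} := by
  rcases N with _ | _ | N
  · have : Subsingleton R := subsingleton_of_zero_eq_one (by simpa using hn.symm)
    rw [Subsingleton.elim n 0]
    exact zero_mem _
  · have : n = 0 := by simpa using hn
    rw [this]
    exact zero_mem _
  set b := nilLog F (N + 1 + 1) n with hb
  set r : F[X] := ∑ j ∈ Finset.range N, C ((binomPoly F (j + 2)).coeff 1) * X ^ j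
  have hbr : b = aeval n (X * (1 + X * r)) := by
    rw [hb, nilLog_eq, Finset.sum_range_succ', Finset.sum_range_succ']
    simp only [r, map_mul, aeval_X, map_add, map_sum, aeval_C, map_pow, mul_add, mul_one,
      Finset.mul_sum, binomPoly_zero, zero_add, binomPoly_one_coeff_one, pow_one, one_smul,
      ← Algebra.smul_def, mul_smul_comm]
    rw [coeff_one, if_neg (by norm_num), zero_smul, add_zero, add_comm]
    congr 1
    refine Finset.sum_congr rfl fun j _ => ?_
    rw [← pow_succ', ← pow_succ']
  have hbm : b ∈ Algebra.adjoin F {b} := Algebra.subset_adjoin rfl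
  -- Descending induction on the order `j` of vanishing: `d` bounds the number of orders left before
  -- `X ^ j` evaluates to zero.
  have key : ∀ d j, N + 1 + 1 ≤ j + d → ∀ q : F[X], aeval n (X ^ j * q) ∈ Algebra.adjoin F {b} := by
    intro d
    induction d with
    | zero =>
      intro j hj q
      rw [map_mul, map_pow, aeval_X, pow_eq_zero_of_le (by simpa using hj) hn, zero_mul]
      exact zero_mem _
    | succ d ih =>
      intro j hj q
      obtain ⟨s, hs⟩ : ∃ s : F[X], X ^ j * q = C (q.coeff 0) * (X * (1 + X * r)) ^ j
          + X ^ (j + 1) * s := by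
        obtain ⟨q', hq'⟩ : X ∣ q - C (q.coeff 0) := by simp [X_dvd_iff]
        obtain ⟨r', hr'⟩ : X ∣ (1 + X * r) ^ j - 1 := by simp [X_dvd_iff, coeff_zero_eq_eval_zero]
        refine ⟨q' - C (q.coeff 0) * r', ?_⟩
        rw [mul_pow, eq_add_of_sub_eq hr']
        linear_combination X ^ j * hq'
      rw [hs, map_add, map_mul, map_pow, ← hbr, aeval_C]
      exact add_mem (mul_mem (algebraMap_mem _ _) (pow_mem hbm _)) (ih (j + 1) (by omega) s)
  simpa using key (N + 1) 1 (by omega) 1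

end Unipotent

/-! ## Coalgebra maps that are unipotent for the convolution product -/

section Convolution

open Coalgebra WithConv

variable {F : Type*} [Field F] {E : Type*} [AddCommGroup E] [Module F E] [Coalgebra F E]
  {A B : Type*} [Ring A] [Algebra F A] [Ring B] [Algebra F B]

/-- Composition with an algebra map, as a map of convolution algebras. -/
def convMap (f : A →ₐ[F] B) : WithConv (E →ₗ[F] A) →ₐ[F] WithConv (E →ₗ[F] B) :=
  AlgHom.ofLinearMap
    { toFun := fun φ => toConv (f.toLinearMap ∘ₗ φ.ofConv)
      map_add' := fun φ ψ => by ext; simp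
      map_smul' := fun c φ => by ext; simp }
    (by ext; simp)
    (fun φ ψ => by
      ext y
      exact congrArg (fun g => g y) (LinearMap.algHom_comp_convMul_distrib f φ ψ))

theorem convMap_apply (f : A →ₐ[F] B) (φ : WithConv (E →ₗ[F] A)) (y : E) :
    convMap f φ y = f (φ y) := rfl

variable (E) in
/-- The maps with values in a subalgebra form a subalgebra of the convolution algebra. -/
def convSubalgebra (K : Subalgebra F A) : Subalgebra F (WithConv (E →ₗ[F] A)) where
  carrier := {φ | ∀ y, φ y ∈ K}
  mul_mem' := fun {φ ψ} hφ hψ y => by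
    rw [(ℛ F y).convMul_apply]
    exact sum_mem fun i _ => mul_mem (hφ _) (hψ _)
  add_mem' := fun hφ hψ y => add_mem (hφ y) (hψ y)
  algebraMap_mem' := fun c y => by
    rw [LinearMap.convAlgebraMap_apply]
    exact K.smul_mem (K.algebraMap_mem _) c

variable {H : Type*} [Ring H] [HopfAlgebra F H]

/-- Being a coalgebra map means that `Δ ∘ u` is the convolution product of `u ⊗ 1` and `1 ⊗ u`,
which commute by cocommutativity. The logarithm turns this product into a sum, so `log u` has
primitive values, and `u` is a polynomial in `log u`. -/
theorem mem_adjoin_primitive_of_unipotent [CharZero F] [IsCocomm F E] (u : E →ₗc[F] H) {N : ℕ}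
    (hN : (toConv u.toLinearMap - 1) ^ (N + 1) = 0) (y : E) :
    u y ∈ Algebra.adjoin F {x : H | IsPrimitiveElem F x} := by
  set n : WithConv (E →ₗ[F] H) := toConv u.toLinearMap - 1 with hn
  set e := nilLog F (N + 1) n with he
  have hn1 : 1 + n = toConv u.toLinearMap := by rw [hn]; abel
  set δ := convMap (E := E) (Bialgebra.comulAlgHom F H) with hδ
  set i₁ := convMap (E := E) (Algebra.TensorProduct.includeLeft : H →ₐ[F] H ⊗[F] H) with hi₁
  set i₂ := convMap (E := E) (Algebra.TensorProduct.includeRight : H →ₐ[F] H ⊗[F] H) with hi₂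
  have hlog : ∀ f : WithConv (E →ₗ[F] H) →ₐ[F] WithConv (E →ₗ[F] H ⊗[F] H),
      f e = nilLog F (N + 1) (f n) := by
    intro f
    simp only [he, nilLog_eq, map_sum, map_smul, map_pow]
  have hpow : ∀ f : WithConv (E →ₗ[F] H) →ₐ[F] WithConv (E →ₗ[F] H ⊗[F] H),
      f n ^ (N + 1) = 0 := by
    intro f
    rw [← map_pow, hN, map_zero]
  have hone : ∀ f : WithConv (E →ₗ[F] H) →ₐ[F] WithConv (E →ₗ[F] H ⊗[F] H),
      1 + f n = f (1 + n) := by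
    intro f
    rw [map_add, map_one]
  have hcomm : ∀ φ ψ, Commute (i₁ φ) (i₂ ψ) := by
    intro φ ψ
    ext y
    have h1 : (i₁ φ * i₂ ψ) y = TensorProduct.map φ.ofConv ψ.ofConv (comul y) := by
      rw [(ℛ F y).convMul_apply]
      conv_rhs => rw [← (ℛ F y).eq]
      simp [hi₁, hi₂, convMap_apply]
    have h2 : (i₂ ψ * i₁ φ) y = TensorProduct.map φ.ofConv ψ.ofConv
        (TensorProduct.comm F E E (comul y)) := by
      rw [(ℛ F y).convMul_apply]
      conv_rhs => rw [← (ℛ F y).eq]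
      simp [hi₁, hi₂, convMap_apply]
    change (i₁ φ * i₂ ψ) y = (i₂ ψ * i₁ φ) y
    rw [h1, h2, comm_comul]
  have hmul : 1 + δ n = (1 + i₁ n) * (1 + i₂ n) := by
    rw [hone, hone, hone, hn1]
    ext y
    rw [(ℛ F y).convMul_apply]
    have h : comul (u y) = TensorProduct.map u.toLinearMap u.toLinearMap (comul y) :=
      (CoalgHomClass.map_comp_comul_apply u y).symm
    change comul (u y) = _
    rw [h]
    conv_lhs => rw [← (ℛ F y).eq]
    simp [hi₁, hi₂, convMap_apply]
  have hadd : δ e = i₁ e + i₂ e := by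
    rw [hlog, hlog, hlog]
    refine nilLog_mul F (hpow _) (hpow _) (hpow _) ?_ hmul
    rw [hone, hone]
    exact hcomm _ _
  have hprim : ∀ y, IsPrimitiveElem F (e y) := by
    intro y
    have : comul (e y) = (e y) ⊗ₜ[F] 1 + 1 ⊗ₜ[F] (e y) := congrArg (fun φ => φ y) hadd
    rw [IsPrimitiveElem, this, add_comm]
  have hmem : n ∈ convSubalgebra E (Algebra.adjoin F {x : H | IsPrimitiveElem F x}) := by
    refine (Algebra.adjoin_le ?_ : Algebra.adjoin F {e} ≤ _) (mem_adjoin_nilLog F hN)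
    rintro _ rfl
    exact fun y => Algebra.subset_adjoin (hprim y)
  have := add_mem (one_mem _) hmem
  rw [hn1] at this
  exact this y

end Convolution

/-! ## Subcoalgebras -/

section Subcoalgebra

open Coalgebra WithConv

variable {F : Type*} [Field F]

theorem tensor_eq_zero_of_forall_dual {U W : Type*} [AddCommGroup U] [Module F U]
    [AddCommGroup W] [Module F W] (z : U ⊗[F] W)
    (h : ∀ f : Module.Dual F U, TensorProduct.lid F W (f.rTensor W z) = 0) : z = 0 := by
  classical
  set b := Module.Basis.ofVectorSpace F U
  apply (TensorProduct.equivFinsuppOfBasisLeft b).injective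
  ext i
  rw [map_zero, TensorProduct.equivFinsuppOfBasisLeft_apply]
  exact h (b.coord i)

variable {K : Type*} [AddCommGroup K] [Module F K] [Coalgebra F K]

/-- The operator `x ↦ f(x₍₁₎) x₍₂₎` on a coalgebra. -/
def dualAct (f : Module.Dual F K) : K →ₗ[F] K :=
  (TensorProduct.lid F K).toLinearMap ∘ₗ f.rTensor K ∘ₗ comul

theorem dualAct_apply (f : Module.Dual F K) (x : K) :
    dualAct f x = TensorProduct.lid F K (f.rTensor K (comul x)) := rfl

theorem dualAct_counit (x : K) : dualAct (counit (R := F)) x = x := by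
  rw [dualAct_apply, rTensor_counit_comul, TensorProduct.lid_tmul, one_smul]

theorem counit_dualAct (f : Module.Dual F K) (x : K) : counit (R := F) (dualAct f x) = f x := by
  have h : counit (R := F) ∘ₗ (TensorProduct.lid F K).toLinearMap ∘ₗ f.rTensor K =
      f ∘ₗ (TensorProduct.rid F K).toLinearMap ∘ₗ counit.lTensor K := by
    ext a b
    simp [mul_comm]
  have := LinearMap.congr_fun h (comul x)
  simpa [dualAct_apply] using this

theorem dualAct_dualAct (f h : Module.Dual F K) (x : K) :
    dualAct f (dualAct h x) = dualAct (toConv h * toConv f).ofConv x := by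
  set Φ : K ⊗[F] (K ⊗[F] K) →ₗ[F] K := (TensorProduct.lid F K).toLinearMap ∘ₗ
    TensorProduct.map h ((TensorProduct.lid F K).toLinearMap ∘ₗ f.rTensor K) with hΦ
  have h1 : Φ ∘ₗ comul.lTensor K =
      dualAct f ∘ₗ (TensorProduct.lid F K).toLinearMap ∘ₗ h.rTensor K := by
    ext a b
    simp [hΦ, dualAct]
  have h2 : Φ ∘ₗ (TensorProduct.assoc F K K K).toLinearMap = (TensorProduct.lid F K).toLinearMap ∘ₗ
      (LinearMap.mul' F F ∘ₗ TensorProduct.map h f).rTensor K := by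
    ext a b c
    simp [hΦ, mul_smul, smul_comm (f b)]
  have h3 := congrArg Φ (coassoc_apply (R := F) x)
  have h4 := LinearMap.congr_fun h1 (comul x)
  have h5 := LinearMap.congr_fun h2 (comul.rTensor K (comul x))
  simp only [LinearMap.comp_apply, LinearEquiv.coe_coe] at h4 h5
  rw [dualAct_apply h, ← h4, ← h3, h5, dualAct_apply, ← LinearMap.comp_apply, ← LinearMap.rTensor_comp]
  rfl

theorem dualAct_comm [IsCocomm F K] (f h : Module.Dual F K) (x : K) :
    dualAct f (dualAct h x) = dualAct h (dualAct f x) := by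
  rw [dualAct_dualAct, dualAct_dualAct, mul_comm]

theorem dualAct_pow [IsCocomm F K] (f : Module.Dual F K) (n : ℕ) :
    dualAct f ^ n = dualAct (toConv f ^ n).ofConv := by
  induction n with
  | zero =>
    ext x
    exact (dualAct_counit x).symm
  | succ n ih =>
    ext x
    rw [pow_succ, Module.End.mul_apply, ih, dualAct_dualAct, ← pow_succ']

/-- Stability under all functionals on the left leg puts `Δ c` in `K ⊗ E`, and cocommutativity puts
it in `E ⊗ K` as well. A projection onto `E` is then the identity on both legs. -/
theorem isSubcoalgebra_of_dualAct_mem [IsCocomm F K] {E : Submodule F K}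
    (hE : ∀ f : Module.Dual F K, ∀ x ∈ E, dualAct f x ∈ E) : IsSubcoalgebra F E := by
  intro c hc
  obtain ⟨q, hq⟩ := E.subtype.exists_leftInverse_of_injective E.ker_subtype
  set p : K →ₗ[F] K := E.subtype ∘ₗ q with hp
  have hpE : ∀ x ∈ E, p x = x := fun x hx =>
    congrArg Subtype.val (LinearMap.congr_fun hq ⟨x, hx⟩)
  have h1 : p.lTensor K (comul c) = comul c := by
    rw [← sub_eq_zero]
    refine tensor_eq_zero_of_forall_dual _ fun f => ?_
    have h : (TensorProduct.lid F K).toLinearMap ∘ₗ f.rTensor K ∘ₗ p.lTensor K =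
        p ∘ₗ (TensorProduct.lid F K).toLinearMap ∘ₗ f.rTensor K := by
      ext a b
      simp
    have := LinearMap.congr_fun h (comul c)
    simp only [LinearMap.comp_apply, LinearEquiv.coe_coe] at this
    rw [map_sub, map_sub, this, ← dualAct_apply, hpE _ (hE f c hc), sub_self]
  have h2 : p.rTensor K (comul c) = comul c := by
    have h : p.rTensor K ∘ₗ (TensorProduct.comm F K K).toLinearMap =
        (TensorProduct.comm F K K).toLinearMap ∘ₗ p.lTensor K := by
      ext a b
      simp
    have := LinearMap.congr_fun h (comul c)
    simp only [LinearMap.comp_apply, LinearEquiv.coe_coe] at this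
    rwa [h1, comm_comul] at this
  refine ⟨TensorProduct.map q q (comul c), ?_⟩
  have h3 : TensorProduct.map p p (comul c) = comul c := by
    rw [← LinearMap.rTensor_comp_lTensor, LinearMap.comp_apply, h1, h2]
  rwa [hp, TensorProduct.map_comp] at h3

/-- The orbit of `x` under the dual algebra is a subcoalgebra, and it lies in the span of the
finitely many right legs of one expression for `Δ x`. -/
theorem exists_finiteDimensional_subcoalgebra [IsCocomm F K] (x : K) :
    ∃ E : Submodule F K, IsSubcoalgebra F E ∧ FiniteDimensional F E ∧ x ∈ E := by
  classical
  set ψ : Module.Dual F K →ₗ[F] K :=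
    { toFun := fun f => dualAct f x
      map_add' := fun f h => by simp [dualAct_apply, LinearMap.rTensor_add]
      map_smul' := fun c f => by simp [dualAct_apply, LinearMap.rTensor_smul] } with hψ
  refine ⟨LinearMap.range ψ, isSubcoalgebra_of_dualAct_mem ?_, ?_, counit, dualAct_counit x⟩
  · rintro f _ ⟨h, rfl⟩
    exact ⟨_, (dualAct_dualAct f h x).symm⟩
  · have hle : LinearMap.range ψ ≤
        Submodule.span F (((ℛ F x).index.image (ℛ F x).right : Finset K) : Set K) := by
      rintro _ ⟨f, rfl⟩
      change TensorProduct.lid F K (f.rTensor K (comul x)) ∈ _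
      rw [← (ℛ F x).eq, map_sum, map_sum]
      refine sum_mem fun i hi => ?_
      rw [LinearMap.rTensor_tmul, TensorProduct.lid_tmul]
      exact Submodule.smul_mem _ _ (Submodule.subset_span (Finset.mem_coe.2
        (Finset.mem_image_of_mem _ hi)))
    have : FiniteDimensional F (Submodule.span F
      (((ℛ F x).index.image (ℛ F x).right : Finset K) : Set K)) :=
      FiniteDimensional.span_finset F _
    exact Submodule.finiteDimensional_of_le hle

theorem exists_isSimpleSubcoalgebra (n : ℕ) (E : Submodule F K) (hE : IsSubcoalgebra F E)
    [FiniteDimensional F E] (hn : Module.finrank F E = n) (h0 : E ≠ ⊥) :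
    ∃ E₀ ≤ E, IsSimpleSubcoalgebra F E₀ := by
  induction n using Nat.strong_induction_on generalizing E with
  | _ n ih =>
    by_cases h : ∀ E' : Submodule F K, IsSubcoalgebra F E' → E' ≤ E → E' = ⊥ ∨ E' = E
    · exact ⟨E, le_rfl, hE, h0, h⟩
    · push Not at h
      obtain ⟨E', hE', hle, hbot, hne⟩ := h
      have := Submodule.finiteDimensional_of_le hle
      obtain ⟨E₀, h1, h2⟩ := ih _ (hn ▸ Submodule.finrank_lt_finrank_of_lt (hle.lt_of_ne hne))
        E' hE' rfl hbot
      exact ⟨E₀, h1.trans hle, h2⟩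

/-- A simple subcoalgebra inside `E` is a line spanned by some `x` with `Δ x = c (x ⊗ x)`. The
counit axiom forces `c ε(x) = 1`, so `c x` is group-like. -/
theorem exists_isGroupLikeElem (hK : IsPointed F K) (E : Submodule F K) (hE : IsSubcoalgebra F E)
    [FiniteDimensional F E] (h0 : E ≠ ⊥) : ∃ g ∈ E, IsGroupLikeElem F g := by
  obtain ⟨E₀, hle, hs⟩ := exists_isSimpleSubcoalgebra _ E hE rfl h0
  obtain ⟨⟨x, hx⟩, hx0, hspan⟩ := finrank_eq_one_iff'.1 (hK E₀ hs)
  have hx0 : x ≠ 0 := fun h => hx0 (by simpa using h)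
  have hspan : ∀ y ∈ E₀, ∃ c : F, c • x = y := fun y hy => by
    obtain ⟨c, hc⟩ := hspan ⟨y, hy⟩
    exact ⟨c, by simpa using congrArg Subtype.val hc⟩
  obtain ⟨c, hc⟩ : ∃ c : F, comul x = c • (x ⊗ₜ[F] x) := by
    obtain ⟨w, hw⟩ := hs.1 x hx
    rw [← hw]
    clear hw
    induction w with
    | zero => exact ⟨0, by simp⟩
    | tmul a b =>
      obtain ⟨s, hs⟩ := hspan a a.2
      obtain ⟨t, ht⟩ := hspan b b.2
      refine ⟨s * t, ?_⟩
      rw [TensorProduct.map_tmul, Submodule.subtype_apply, Submodule.subtype_apply, ← hs, ← ht,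
        TensorProduct.smul_tmul_smul]
    | add a b ha hb =>
      obtain ⟨s, hs⟩ := ha
      obtain ⟨t, ht⟩ := hb
      exact ⟨s + t, by rw [map_add, hs, ht, add_smul]⟩
  have hcε : c * counit (R := F) x = 1 := by
    have h := dualAct_counit (F := F) x
    rw [dualAct_apply, hc] at h
    simp only [map_smul, LinearMap.rTensor_tmul, TensorProduct.lid_tmul, smul_smul] at h
    exact smul_left_injective F hx0 (h.trans (one_smul F x).symm)
  refine ⟨c • x, hle (E₀.smul_mem c hx), ?_, ?_⟩
  · rw [map_smul, smul_eq_mul, hcε]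
  · rw [map_smul, hc, TensorProduct.smul_tmul_smul, smul_smul]

/-- The coalgebra structure of a subcoalgebra. -/
@[reducible] def IsSubcoalgebra.coalgebra {E : Submodule F K} (hE : IsSubcoalgebra F E) :
    Coalgebra F E :=
  have hj : Function.Injective (TensorProduct.map E.subtype E.subtype) :=
    TensorProduct.map_injective_of_flat_flat _ _ E.injective_subtype E.injective_subtype
  let Δ : E →ₗ[F] E ⊗[F] E := (LinearEquiv.ofInjective _ hj).symm.toLinearMap ∘ₗ
    (comul ∘ₗ E.subtype).codRestrict (LinearMap.range (TensorProduct.map E.subtype E.subtype))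
      (fun c => hE c c.2)
  have hΔ : TensorProduct.map E.subtype E.subtype ∘ₗ Δ = comul ∘ₗ E.subtype := by
    ext c
    exact congrArg Subtype.val (LinearEquiv.apply_symm_apply (LinearEquiv.ofInjective _ hj) _)
  { comul := Δ
    counit := counit ∘ₗ E.subtype
    coassoc := by
      have hj' : Function.Injective (TensorProduct.map E.subtype
          (TensorProduct.map E.subtype E.subtype)) :=
        TensorProduct.map_injective_of_flat_flat _ _ E.injective_subtype hj
      apply (LinearMap.cancel_left hj').1
      ext c
      have h1 : TensorProduct.map E.subtype (TensorProduct.map E.subtype E.subtype) ∘ₗ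
          (TensorProduct.assoc F E E E).toLinearMap = (TensorProduct.assoc F K K K).toLinearMap ∘ₗ
          TensorProduct.map (TensorProduct.map E.subtype E.subtype) E.subtype := by
        ext
        simp
      have h2 : TensorProduct.map (TensorProduct.map E.subtype E.subtype) E.subtype ∘ₗ
          Δ.rTensor E = comul.rTensor K ∘ₗ TensorProduct.map E.subtype E.subtype := by
        rw [LinearMap.map_comp_rTensor, hΔ, LinearMap.rTensor_comp_map]
      have h3 : TensorProduct.map E.subtype (TensorProduct.map E.subtype E.subtype) ∘ₗ
          Δ.lTensor E = comul.lTensor K ∘ₗ TensorProduct.map E.subtype E.subtype := by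
        rw [LinearMap.map_comp_lTensor, hΔ, LinearMap.lTensor_comp_map]
      have e1 := LinearMap.congr_fun h1 (Δ.rTensor E (Δ c))
      have e2 := LinearMap.congr_fun h2 (Δ c)
      have e3 := LinearMap.congr_fun h3 (Δ c)
      have e4 := LinearMap.congr_fun hΔ c
      simp only [LinearMap.comp_apply, LinearEquiv.coe_coe] at e1 e2 e3 e4 ⊢
      rw [e1, e2, e3, e4, coassoc_apply]
    rTensor_counit_comp_comul := by
      apply (LinearMap.cancel_left (f := E.subtype.lTensor F)
        (Module.Flat.lTensor_preserves_injective_linearMap _ E.injective_subtype)).1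
      rw [← LinearMap.comp_assoc, LinearMap.lTensor_comp_rTensor]
      have : TensorProduct.map (counit ∘ₗ E.subtype) E.subtype =
        counit.rTensor K ∘ₗ TensorProduct.map E.subtype E.subtype := by
        rw [LinearMap.rTensor_comp_map]
      rw [this, LinearMap.comp_assoc, hΔ, ← LinearMap.comp_assoc, rTensor_counit_comp_comul]
      ext c
      simp
    lTensor_counit_comp_comul := by
      apply (LinearMap.cancel_left (f := E.subtype.rTensor F)
        (Module.Flat.rTensor_preserves_injective_linearMap _ E.injective_subtype)).1
      rw [← LinearMap.comp_assoc, LinearMap.rTensor_comp_lTensor]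
      have : TensorProduct.map E.subtype (counit ∘ₗ E.subtype) =
        counit.lTensor K ∘ₗ TensorProduct.map E.subtype E.subtype := by
        rw [LinearMap.lTensor_comp_map]
      rw [this, LinearMap.comp_assoc, hΔ, ← LinearMap.comp_assoc, lTensor_counit_comp_comul]
      ext c
      simp }

theorem IsSubcoalgebra.map_comul {E : Submodule F K} (hE : IsSubcoalgebra F E) (c : E) :
    TensorProduct.map E.subtype E.subtype (hE.coalgebra.comul c) = comul (c : K) :=
  congrArg Subtype.val (LinearEquiv.apply_symm_apply (LinearEquiv.ofInjective _
    (TensorProduct.map_injective_of_flat_flat _ _ E.injective_subtype E.injective_subtype)) _)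

theorem IsSubcoalgebra.isCocomm [IsCocomm F K] {E : Submodule F K} (hE : IsSubcoalgebra F E) :
    letI := hE.coalgebra; IsCocomm F E := by
  let := hE.coalgebra
  refine ⟨?_⟩
  have hj : Function.Injective (TensorProduct.map E.subtype E.subtype) :=
    TensorProduct.map_injective_of_flat_flat _ _ E.injective_subtype E.injective_subtype
  apply (LinearMap.cancel_left hj).1
  ext c
  have h : TensorProduct.map E.subtype E.subtype ∘ₗ (TensorProduct.comm F E E).toLinearMap =
      (TensorProduct.comm F K K).toLinearMap ∘ₗ TensorProduct.map E.subtype E.subtype := by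
    ext a b
    simp
  have := LinearMap.congr_fun h (comul c)
  simp only [LinearMap.comp_apply, LinearEquiv.coe_coe] at this ⊢
  rw [this, hE.map_comul, comm_comul]

end Subcoalgebra

/-! ## Pointed cocommutative Hopf algebras are generated by group-like and primitive elements -/

section Generation

open Coalgebra WithConv

variable {F : Type*} [Field F]

section Nilpotent

variable {E : Type*} [AddCommGroup E] [Module F E] [Coalgebra F E]
  {A : Type*} [Ring A] [Algebra F A]

theorem convMul_smulRight (f h : WithConv (Module.Dual F E)) (a b : A) :
    (toConv (f.ofConv.smulRight a) * toConv (h.ofConv.smulRight b) : WithConv (E →ₗ[F] A)) =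
      toConv ((f * h).ofConv.smulRight (a * b)) := by
  ext y
  have h1 : LinearMap.mul' F A ∘ₗ TensorProduct.map (f.ofConv.smulRight a) (h.ofConv.smulRight b) =
      (LinearMap.mul' F F ∘ₗ TensorProduct.map f.ofConv h.ofConv).smulRight (a * b) := by
    ext s t
    simp [smul_smul, mul_comm]
  exact LinearMap.congr_fun h1 (comul y)

variable [IsCocomm F E]

theorem isNilpotent_of_dualAct_pow {f : Module.Dual F E} {n : ℕ} (h : dualAct f ^ n = 0) :
    toConv f ^ n = 0 := by
  ext y
  have := congrArg (fun T => counit (R := F) (T y)) h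
  rw [dualAct_pow] at this
  simpa [counit_dualAct] using this

/-- The ideal of the dual algebra of a coalgebra that consists of the functionals that vanish
on a group-like element. -/
def vanishingIdeal {g : E} (hg : IsGroupLikeElem F g) : Ideal (WithConv (Module.Dual F E)) where
  carrier := {f | f g = 0}
  add_mem' := fun {f h} hf hh => by
    change f g + h g = 0
    rw [show f g = 0 from hf, show h g = 0 from hh, add_zero]
  zero_mem' := rfl
  smul_mem' := fun c f hf => by
    change (c * f) g = 0
    rw [LinearMap.convMul_apply, hg.comul_eq_tmul_self]
    simp [show f.ofConv g = 0 from hf]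

/-- The dual algebra is commutative and finite-dimensional, hence noetherian, and a nil ideal in it
is nilpotent. -/
theorem vanishingIdeal_pow_eq_bot [FiniteDimensional F E] {g : E} (hg : IsGroupLikeElem F g)
    (h : ∀ f : Module.Dual F E, f g = 0 → IsNilpotent (toConv f)) :
    ∃ N, vanishingIdeal hg ^ N = ⊥ := by
  have : FiniteDimensional F (WithConv (Module.Dual F E)) :=
    Module.Finite.equiv (WithConv.linearEquiv F (Module.Dual F E)).symm
  have : IsNoetherianRing (WithConv (Module.Dual F E)) :=
    isNoetherian_of_tower F inferInstance
  exact (Ideal.FG.isNilpotent_iff_le_nilradical (IsNoetherian.noetherian _)).2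
    fun f hf => h f.ofConv hf

/-- A map that vanishes at `g` is a sum of terms `f(·) a` with `f` vanishing at `g`. Convolution
multiplies the functionals and the coefficients separately, so a high power has its functionals in a
zero power of the vanishing ideal. -/
theorem isNilpotent_of_apply_groupLike [FiniteDimensional F E] {g : E} (hg : IsGroupLikeElem F g)
    (h : ∀ f : Module.Dual F E, f g = 0 → IsNilpotent (toConv f)) (φ : WithConv (E →ₗ[F] A))
    (hφ : φ g = 0) : IsNilpotent φ := by
  obtain ⟨N, hN⟩ := vanishingIdeal_pow_eq_bot hg h
  refine ⟨N, ?_⟩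
  set S : ℕ → Submodule F (WithConv (E →ₗ[F] A)) := fun n => Submodule.span F
    {ψ | ∃ f ∈ vanishingIdeal hg ^ n, ∃ a : A, ψ = toConv (f.ofConv.smulRight a)} with hS
  have hφS : φ ∈ S 1 := by
    set b := Module.finBasis F E
    -- Each coordinate is corrected by a multiple of the counit so as to vanish at `g`, where the
    -- counit is 1. The corrections add up to a multiple of `φ g = 0`.
    have : φ = ∑ i, toConv ((b.coord i - b.coord i g • counit).smulRight (φ (b i))) := by
      have h1 : ∑ i, b.coord i g • φ (b i) = 0 := by
        rw [← hφ]
        conv_rhs => rw [← b.sum_repr g, map_sum]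
        simp
      apply WithConv.ofConv_injective
      ext y
      have h2 : φ y = ∑ i, b.coord i y • φ (b i) := by
        conv_lhs => rw [← b.sum_repr y, map_sum]
        simp
      have h3 : (∑ i, toConv ((b.coord i - b.coord i g • counit).smulRight (φ (b i))) :
          WithConv (E →ₗ[F] A)).ofConv =
          ∑ i, ((b.coord i - b.coord i g • counit).smulRight (φ (b i))) :=
        map_sum (WithConv.linearEquiv F (E →ₗ[F] A)) _ _
      rw [h3, h2, LinearMap.sum_apply]
      simp only [LinearMap.smulRight_apply, LinearMap.sub_apply, LinearMap.smul_apply, sub_smul,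
        Finset.sum_sub_distrib, smul_eq_mul, mul_comm _ (counit y), mul_smul, ← Finset.smul_sum, h1,
        smul_zero, sub_zero]
    rw [this]
    refine sum_mem fun i _ => Submodule.subset_span
      ⟨toConv (b.coord i - b.coord i g • counit), ?_, _, rfl⟩
    rw [Submodule.pow_one]
    change (b.coord i - b.coord i g • counit : Module.Dual F E) g = 0
    simp [hg.counit_eq_one]
  have hmul : ∀ n, ∀ ψ ∈ S n, φ * ψ ∈ S (n + 1) := by
    intro n ψ hψ
    have : S 1 * S n ≤ S (n + 1) := by
      rw [hS, Submodule.span_mul_span]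
      refine Submodule.span_le.2 ?_
      rintro _ ⟨_, ⟨f, hf, a, rfl⟩, _, ⟨k, hk, b, rfl⟩, rfl⟩
      refine Submodule.subset_span ⟨f * k, ?_, a * b, convMul_smulRight f k a b⟩
      rw [Submodule.pow_succ, mul_comm f k]
      rw [Submodule.pow_one] at hf
      exact Ideal.mul_mem_mul hk hf
    exact this (Submodule.mul_mem_mul hφS hψ)
  have hpow : ∀ n, φ ^ (n + 1) ∈ S (n + 1) := by
    intro n
    induction n with
    | zero => simpa using hφS
    | succ n ih =>
      rw [pow_succ']
      exact hmul _ _ ih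
  -- `N = 0` cannot occur: the vanishing ideal to the power zero contains the counit, which is not
  -- zero at `g`.
  rcases N with _ | N
  · have h1 : (1 : WithConv (Module.Dual F E)) ∈ (⊥ : Ideal _) := by
      rw [← hN, pow_zero, Ideal.one_eq_top]
      trivial
    have h2 := congrArg (fun f => f.ofConv g) (Ideal.mem_bot.1 h1)
    simp [hg.counit_eq_one] at h2
  · have h1 : S (N + 1) = ⊥ := by
      rw [hS, eq_bot_iff]
      refine Submodule.span_le.2 ?_
      rintro _ ⟨f, hf, a, rfl⟩
      rw [hN, Ideal.mem_bot] at hf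
      rw [hf]
      ext
      simp
    have h2 := hpow N
    rwa [h1, Submodule.mem_bot] at h2

end Nilpotent

variable (F) in
/-- The subalgebra generated by the group-like and the primitive elements. -/
def groupPrimitiveSubalgebra (H : Type*) [Ring H] [HopfAlgebra F H] : Subalgebra F H :=
  Algebra.adjoin F ({g | IsGroupLikeElem F g} ∪ {x | IsPrimitiveElem F x})

variable {H : Type*} [Ring H] [HopfAlgebra F H]

/-- Multiplication by a group-like element is a map of coalgebras. -/
def groupLikeMul {g : H} (hg : IsGroupLikeElem F g) : H →ₗc[F] H :=
  { LinearMap.mulLeft F g with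
    counit_comp := by
      ext x
      simp [hg.counit_eq_one]
    map_comp_comul := by
      ext x
      have h : TensorProduct.map (LinearMap.mulLeft F g) (LinearMap.mulLeft F g) =
          LinearMap.mulLeft F (g ⊗ₜ[F] g) := by
        ext
        simp
      change TensorProduct.map (LinearMap.mulLeft F g) (LinearMap.mulLeft F g) (comul x) =
        comul (g * x)
      rw [h, Bialgebra.comul_mul, hg.comul_eq_tmul_self]
      rfl }

variable [CharZero F] [IsCocomm F H]

/-- Induction on the dimension of `E`, with a group-like `g` in `E`. If all functionals vanishing at
`g` are nilpotent, then translating the inclusion by `g⁻¹` gives a unipotent coalgebra map, whose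
values are generated by primitive elements. Otherwise a non-nilpotent functional splits `E` into two
smaller subcoalgebras. -/
theorem le_groupPrimitiveSubalgebra (hH : IsPointed F H) (n : ℕ) (E : Submodule F H)
    (hE : IsSubcoalgebra F E) [FiniteDimensional F E] (hn : Module.finrank F E = n) :
    E ≤ Subalgebra.toSubmodule (groupPrimitiveSubalgebra F H) := by
  induction n using Nat.strong_induction_on generalizing E with
  | _ n ih =>
  by_cases h0 : E = ⊥
  · rw [h0]
    exact bot_le
  let := hE.coalgebra
  have := hE.isCocomm
  let incl : E →ₗc[F] H :=
    { E.subtype with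
      counit_comp := rfl
      map_comp_comul := LinearMap.ext hE.map_comul }
  obtain ⟨g, hgE, hg⟩ := exists_isGroupLikeElem hH E hE h0
  have hj : Function.Injective (TensorProduct.map E.subtype E.subtype) :=
    TensorProduct.map_injective_of_flat_flat _ _ E.injective_subtype E.injective_subtype
  have hg' : IsGroupLikeElem F (⟨g, hgE⟩ : E) := by
    refine ⟨hg.counit_eq_one, hj ?_⟩
    rw [hE.map_comul, TensorProduct.map_tmul]
    exact hg.comul_eq_tmul_self
  by_cases hnil : ∀ f : Module.Dual F E, f ⟨g, hgE⟩ = 0 → IsNilpotent (toConv f)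
  · set u : E →ₗc[F] H := (groupLikeMul hg.antipode).comp incl
    have hu : ∀ y : E, u y = HopfAlgebra.antipode F g * y := fun y => rfl
    have hunil : IsNilpotent (toConv u.toLinearMap - 1 : WithConv (E →ₗ[F] H)) := by
      refine isNilpotent_of_apply_groupLike hg' hnil _ ?_
      change u ⟨g, hgE⟩ - algebraMap F H (counit (⟨g, hgE⟩ : E)) = 0
      rw [hg'.counit_eq_one, map_one, hu, hg.antipode_mul_cancel, sub_self]
    obtain ⟨N, hN⟩ := hunil
    intro x hx
    have h1 := mem_adjoin_primitive_of_unipotent u (N := N) (by rw [pow_succ, hN, zero_mul]) ⟨x, hx⟩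
    have h2 : x = g * u ⟨x, hx⟩ := by
      rw [hu, ← mul_assoc, hg.mul_antipode_cancel, one_mul]
    rw [h2]
    exact Subalgebra.mul_mem _ (Algebra.subset_adjoin (Or.inl hg))
      (Algebra.adjoin_mono Set.subset_union_right h1)
  · push Not at hnil
    obtain ⟨f, hfg, hf⟩ := hnil
    -- Fitting decomposition of the operator of `f`. The kernel is proper since `f` is not
    -- nilpotent. The image is proper since the operator kills `g`, which needs `k > 0`. Both are
    -- subcoalgebras because the dual algebra is commutative.
    obtain ⟨k, hk0, hk⟩ := ((Filter.eventually_gt_atTop 0).and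
      (LinearMap.eventually_isCompl_ker_pow_range_pow (dualAct f))).exists
    have hsub : ∀ E' : Submodule F E, E' ≠ ⊤ →
        (∀ h : Module.Dual F E, ∀ y ∈ E', dualAct h y ∈ E') →
        E'.map E.subtype ≤ Subalgebra.toSubmodule (groupPrimitiveSubalgebra F H) := by
      intro E' hE' hst
      refine ih (Module.finrank F (E'.map E.subtype)) ?_ _ ?_ rfl
      · rw [← hn, ← (Submodule.equivMapOfInjective E.subtype E.injective_subtype E').finrank_eq]
        exact Submodule.finrank_lt hE'
      · refine isSubcoalgebra_of_dualAct_mem ?_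
        rintro h _ ⟨y, hy, rfl⟩
        refine ⟨_, hst (h ∘ₗ E.subtype) y hy, ?_⟩
        have h1 : (TensorProduct.lid F H).toLinearMap ∘ₗ h.rTensor H ∘ₗ
            TensorProduct.map E.subtype E.subtype =
              E.subtype ∘ₗ (TensorProduct.lid F E).toLinearMap ∘ₗ (h ∘ₗ E.subtype).rTensor E := by
          ext a b
          simp
        have h2 := LinearMap.congr_fun h1 (comul y)
        simp only [LinearMap.comp_apply, LinearEquiv.coe_coe] at h2
        rw [hE.map_comul] at h2
        exact h2.symm
    have hcomm : ∀ h : Module.Dual F E, Commute (dualAct h) (dualAct f ^ k) := fun h =>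
      Commute.pow_right (LinearMap.ext fun y => dualAct_comm h f y) k
    have h1 := hsub (LinearMap.ker (dualAct f ^ k)) ?_ ?_
    have h2 := hsub (LinearMap.range (dualAct f ^ k)) ?_ ?_
    · calc E = (⊤ : Submodule F E).map E.subtype := by rw [Submodule.map_top, E.range_subtype]
        _ ≤ _ := by
          rw [← hk.sup_eq_top, Submodule.map_sup]
          exact sup_le h1 h2
    · intro htop
      have hinj := LinearMap.ker_eq_bot.1
        ((LinearMap.ker_eq_bot_iff_range_eq_top (f := dualAct f ^ k)).2 htop)
      have hzero : (dualAct f ^ k) ⟨g, hgE⟩ = 0 := by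
        obtain ⟨l, rfl⟩ := Nat.exists_eq_succ_of_ne_zero hk0.ne'
        rw [pow_succ, Module.End.mul_apply, dualAct_apply, hg'.comul_eq_tmul_self]
        simp [hfg]
      exact hg.ne_zero (congrArg Subtype.val (hinj (hzero.trans (map_zero _).symm)))
    · rintro h _ ⟨y, rfl⟩
      exact ⟨dualAct h y, (LinearMap.congr_fun (hcomm h) y).symm⟩
    · intro htop
      exact hf ⟨k, isNilpotent_of_dualAct_pow (LinearMap.ker_eq_top.1 htop)⟩
    · intro h y hy
      rw [LinearMap.mem_ker] at hy ⊢
      have := LinearMap.congr_fun (hcomm h) y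
      rw [Module.End.mul_apply, Module.End.mul_apply, hy, map_zero] at this
      exact this.symm

/-- A pointed cocommutative Hopf algebra over a field of characteristic zero is generated by its
group-like and its primitive elements. -/
theorem groupPrimitiveSubalgebra_eq_top (hH : IsPointed F H) :
    groupPrimitiveSubalgebra F H = ⊤ := by
  rw [eq_top_iff]
  intro x _
  obtain ⟨E, hE, hfin, hx⟩ := exists_finiteDimensional_subcoalgebra (F := F) x
  exact le_groupPrimitiveSubalgebra hH _ E hE rfl hx

end Generation

/-! ## Filtrations and symmetrization in an algebra with almost commuting generators -/

section Filtration

variable {F : Type*} [Field F] {A : Type*} [Ring A] [Algebra F A]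

/-- The span of all products of fewer than `n` elements of `𝓥` and one element of `𝓗`. -/
def fil (𝓥 𝓗 : Submodule F A) (n : ℕ) : Submodule F A := ⨆ k ∈ Set.Iio n, 𝓥 ^ k * 𝓗

/-- `𝓗` is a unital subalgebra that can be moved to the right of `𝓥`, and the elements of `𝓥`
commute with each other up to elements of `𝓗`. -/
structure AlmostCommuting (𝓥 𝓗 : Submodule F A) : Prop where
  one_mem : (1 : A) ∈ 𝓗
  mul_le : 𝓗 * 𝓗 ≤ 𝓗
  cross_le : 𝓗 * 𝓥 ≤ 𝓥 * 𝓗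
  comm_mem : ∀ v ∈ 𝓥, ∀ w ∈ 𝓥, v * w - w * v ∈ 𝓗

variable {𝓥 𝓗 : Submodule F A}

theorem le_fil {k n : ℕ} (h : k < n) : 𝓥 ^ k * 𝓗 ≤ fil 𝓥 𝓗 n :=
  le_iSup₂_of_le k (Set.mem_Iio.2 h) le_rfl

theorem fil_le {n : ℕ} {S : Submodule F A} (h : ∀ k < n, 𝓥 ^ k * 𝓗 ≤ S) : fil 𝓥 𝓗 n ≤ S :=
  iSup₂_le fun k hk => h k hk

theorem fil_zero : fil 𝓥 𝓗 0 = ⊥ :=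
  le_bot_iff.1 (fil_le fun k hk => absurd hk k.not_lt_zero)

theorem fil_mono {m n : ℕ} (h : m ≤ n) : fil 𝓥 𝓗 m ≤ fil 𝓥 𝓗 n :=
  fil_le fun _ hk => le_fil (hk.trans_le h)

theorem fil_succ (n : ℕ) : fil 𝓥 𝓗 (n + 1) = fil 𝓥 𝓗 n ⊔ 𝓥 ^ n * 𝓗 := by
  refine le_antisymm (fil_le fun k hk => ?_) (sup_le (fil_mono n.le_succ) (le_fil n.lt_succ_self))
  rcases Nat.lt_succ_iff_lt_or_eq.1 hk with h | rfl
  · exact (le_fil h).trans le_sup_left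
  · exact le_sup_right

theorem mul_mem_fil_succ {n : ℕ} {v a : A} (hv : v ∈ 𝓥) (ha : a ∈ fil 𝓥 𝓗 n) :
    v * a ∈ fil 𝓥 𝓗 (n + 1) := by
  have : fil 𝓥 𝓗 n ≤ (fil 𝓥 𝓗 (n + 1)).comap (LinearMap.mulLeft F v) := by
    refine fil_le fun k hk => ?_
    intro x hx
    refine le_fil (Nat.succ_lt_succ hk) ?_
    rw [pow_succ', mul_assoc]
    exact Submodule.mul_mem_mul hv hx
  exact this ha

namespace AlmostCommuting

variable (hc : AlmostCommuting 𝓥 𝓗)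
include hc

theorem fil_mul_mem {n : ℕ} {a h : A} (ha : a ∈ fil 𝓥 𝓗 n) (hh : h ∈ 𝓗) : a * h ∈ fil 𝓥 𝓗 n := by
  have : fil 𝓥 𝓗 n ≤ (fil 𝓥 𝓗 n).comap (LinearMap.mulRight F h) := by
    refine fil_le fun k hk => ?_
    intro x hx
    refine le_fil hk ?_
    have h1 : x * h ∈ 𝓥 ^ k * 𝓗 * 𝓗 := Submodule.mul_mem_mul hx hh
    rw [mul_assoc] at h1
    exact mul_le_mul' le_rfl hc.mul_le h1
  exact this ha

theorem mul_pow_le (n : ℕ) : 𝓗 * 𝓥 ^ n ≤ 𝓥 ^ n * 𝓗 := by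
  induction n with
  | zero => simp
  | succ n ih =>
    calc 𝓗 * 𝓥 ^ (n + 1) = 𝓗 * 𝓥 ^ n * 𝓥 := by rw [pow_succ, mul_assoc]
      _ ≤ 𝓥 ^ n * 𝓗 * 𝓥 := mul_le_mul' ih le_rfl
      _ = 𝓥 ^ n * (𝓗 * 𝓥) := mul_assoc _ _ _
      _ ≤ 𝓥 ^ n * (𝓥 * 𝓗) := mul_le_mul' le_rfl hc.cross_le
      _ = 𝓥 ^ (n + 1) * 𝓗 := by rw [pow_succ, mul_assoc]

theorem mul_fil_mem {n : ℕ} {a h : A} (ha : a ∈ fil 𝓥 𝓗 n) (hh : h ∈ 𝓗) : h * a ∈ fil 𝓥 𝓗 n := by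
  have : fil 𝓥 𝓗 n ≤ (fil 𝓥 𝓗 n).comap (LinearMap.mulLeft F h) := by
    refine fil_le fun k hk => ?_
    intro x hx
    refine le_fil hk ?_
    have h1 : h * x ∈ 𝓗 * (𝓥 ^ k * 𝓗) := Submodule.mul_mem_mul hh hx
    rw [← mul_assoc] at h1
    have h2 := mul_le_mul' (hc.mul_pow_le k) le_rfl h1
    rw [mul_assoc] at h2
    exact mul_le_mul' le_rfl hc.mul_le h2
  exact this ha

theorem swap_mem_fil {n : ℕ} {v w a : A} (hv : v ∈ 𝓥) (hw : w ∈ 𝓥) (ha : a ∈ 𝓥 ^ n) :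
    v * (w * a) - w * (v * a) ∈ fil 𝓥 𝓗 (n + 1) := by
  rw [← mul_assoc, ← mul_assoc, ← sub_mul]
  exact le_fil n.lt_succ_self
    (hc.mul_pow_le n (Submodule.mul_mem_mul (hc.comm_mem v hv w hw) ha))

/-- Each swap trades two generators for an element of `𝓗`, so the commutator, which has nominal
degree `n + 1`, has degree at most `n - 1`. This is the meaning of `fil 𝓥 𝓗 n`. -/
theorem commutator_mem_fil {n : ℕ} {v a : A} (hv : v ∈ 𝓥) (ha : a ∈ 𝓥 ^ n) :
    v * a - a * v ∈ fil 𝓥 𝓗 n := by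
  induction n generalizing a with
  | zero =>
    rw [pow_zero] at ha
    obtain ⟨c, rfl⟩ := Submodule.mem_one.1 ha
    rw [Algebra.commutes, sub_self]
    exact zero_mem _
  | succ n ih =>
    rw [pow_succ'] at ha
    induction ha using Submodule.mul_induction_on' with
    | mem_mul_mem w hw b hb =>
      have : v * (w * b) - w * b * v = (v * (w * b) - w * (v * b)) + w * (v * b - b * v) := by
        noncomm_ring
      rw [this]
      exact add_mem (hc.swap_mem_fil hv hw hb) (mul_mem_fil_succ hw (ih hb))
    | add x _ y _ hx hy =>
      have : v * (x + y) - (x + y) * v = (v * x - x * v) + (v * y - y * v) := by noncomm_ring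
      rw [this]
      exact add_mem hx hy

theorem exists_mem_fil (htop : ∀ S : Submodule F A, (1 : A) ∈ S →
    (∀ v ∈ 𝓥, ∀ a ∈ S, v * a ∈ S) → (∀ h ∈ 𝓗, ∀ a ∈ S, h * a ∈ S) → S = ⊤) (a : A) :
    ∃ n, a ∈ fil 𝓥 𝓗 n := by
  have hdir : Directed (· ≤ ·) (fil 𝓥 𝓗) := (monotone_nat_of_le_succ fun n =>
    fil_mono n.le_succ).directed_le
  have h := htop (⨆ n, fil 𝓥 𝓗 n) (Submodule.mem_iSup_of_mem 1 (le_fil Nat.zero_lt_one (by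
    simpa using hc.one_mem))) ?_ ?_
  · have ha : a ∈ ⨆ n, fil 𝓥 𝓗 n := h ▸ Submodule.mem_top
    exact (Submodule.mem_iSup_of_directed _ hdir).1 ha
  · intro v hv a ha
    obtain ⟨n, hn⟩ := (Submodule.mem_iSup_of_directed _ hdir).1 ha
    exact Submodule.mem_iSup_of_mem (n + 1) (mul_mem_fil_succ hv hn)
  · intro v hv a ha
    obtain ⟨n, hn⟩ := (Submodule.mem_iSup_of_directed _ hdir).1 ha
    exact Submodule.mem_iSup_of_mem n (hc.mul_fil_mem hn hv)

end AlmostCommuting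

end Filtration

/-! ### The symmetrization map on polynomials -/

section Symmetrization

open MvPolynomial

variable {F : Type*} [Field F] {A : Type*} [Ring A] [Algebra F A] {ι : Type*}

theorem pderiv_isHomogeneous_succ {n : ℕ} {p : MvPolynomial ι F} (hp : p.IsHomogeneous (n + 1))
    (k : ι) : (pderiv k p).IsHomogeneous n := by
  simpa using hp.pderiv (i := k)

theorem eq_C_of_isHomogeneous_zero {p : MvPolynomial ι F} (hp : p.IsHomogeneous 0) :
    ∃ c, p = C c := 
  ⟨_, totalDegree_eq_zero_iff_eq_C.1 ((totalDegree_zero_iff_isHomogeneous ι).2 hp)⟩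

theorem pderiv_comm (k l : ι) (p : MvPolynomial ι F) :
    pderiv k (pderiv l p) = pderiv l (pderiv k p) := by
  classical
  have : ⁅pderiv (R := F) k, pderiv (R := F) l⁆ = 0 := by
    refine derivation_ext fun i => ?_
    rw [Derivation.commutator_apply, pderiv_X, pderiv_X, Pi.single_apply, Pi.single_apply]
    split_ifs <;> simp
  have h := congrArg (fun D => D p) this
  rw [Derivation.commutator_apply] at h
  exact sub_eq_zero.1 h

variable [Fintype ι]

/-- The component of degree `n` of the symmetrization map, by recursion with Euler's identity. -/
def symDeg (v : ι → A) : ℕ → MvPolynomial ι F →ₗ[F] A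
  | 0 => Algebra.linearMap F A ∘ₗ (aeval (0 : ι → F)).toLinearMap
  | n + 1 => ((n + 1 : ℕ) : F)⁻¹ • ∑ k, LinearMap.mulLeft F (v k) ∘ₗ symDeg v n ∘ₗ
      (pderiv (R := F) k).toLinearMap

/-- The symmetrization map `S(V) → A`. It maps the `n`-th power of a linear form to the `n`-th
power of the corresponding element of `A`. -/
def symmetrize (v : ι → A) : MvPolynomial ι F →ₗ[F] A :=
  (basisMonomials ι F).constr F fun s => symDeg v s.degree (monomial s (1 : F))

variable (v : ι → A)

theorem symDeg_succ (n : ℕ) (p : MvPolynomial ι F) : symDeg v (n + 1) p =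
    ((n + 1 : ℕ) : F)⁻¹ • ∑ k, v k * symDeg v n (pderiv k p) := by
  simp [symDeg]

theorem symmetrize_eq_symDeg {n : ℕ} {p : MvPolynomial ι F} (hp : p.IsHomogeneous n) :
    symmetrize v p = symDeg v n p := by
  conv_lhs => rw [p.as_sum]
  conv_rhs => rw [p.as_sum]
  rw [map_sum, map_sum]
  refine Finset.sum_congr rfl fun s hs => ?_
  have hdeg : s.degree = n := by
    rw [Finsupp.degree_eq_weight_one]
    exact hp (mem_support_iff.1 hs)
  have h1 : monomial s (coeff s p) = coeff s p • monomial s (1 : F) := by simp [smul_monomial]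
  rw [h1, map_smul, map_smul, ← hdeg]
  congr 1
  have := (basisMonomials ι F).constr_basis F (fun s => symDeg v s.degree (monomial s (1 : F))) s
  rwa [coe_basisMonomials] at this

theorem symmetrize_one : symmetrize v (1 : MvPolynomial ι F) = 1 := by
  rw [symmetrize_eq_symDeg v (isHomogeneous_one ι F)]
  simp [symDeg]

variable [CharZero F]

/-- The recursion with the division cleared, which also covers degree zero. Later inductions apply
Euler's identity in this form. -/
theorem smul_symmetrize {n : ℕ} {p : MvPolynomial ι F} (hp : p.IsHomogeneous n) :
    (n : F) • symmetrize v p = ∑ k, v k * symmetrize v (pderiv k p) := by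
  rcases n with _ | n
  · obtain ⟨c, rfl⟩ := eq_C_of_isHomogeneous_zero hp
    simp
  · rw [symmetrize_eq_symDeg v hp, symDeg_succ, smul_inv_smul₀ (Nat.cast_ne_zero.2 n.succ_ne_zero)]
    refine Finset.sum_congr rfl fun k _ => ?_
    rw [symmetrize_eq_symDeg v (pderiv_isHomogeneous_succ hp k)]

variable {𝓥 𝓗 : Submodule F A} {v} (hv : ∀ k, v k ∈ 𝓥)
include hv

theorem symmetrize_mem_pow {n : ℕ} {p : MvPolynomial ι F} (hp : p.IsHomogeneous n) :
    symmetrize v p ∈ 𝓥 ^ n := by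
  induction n generalizing p with
  | zero =>
    obtain ⟨c, rfl⟩ := eq_C_of_isHomogeneous_zero hp
    rw [← mul_one (C c), ← smul_eq_C_mul, map_smul, symmetrize_one, pow_zero]
    exact Submodule.smul_mem _ _ (Submodule.mem_one.2 ⟨1, map_one _⟩)
  | succ n ih =>
    have hn : ((n + 1 : ℕ) : F) ≠ 0 := Nat.cast_ne_zero.2 n.succ_ne_zero
    rw [← inv_smul_smul₀ hn (symmetrize v p), smul_symmetrize v hp, pow_succ']
    exact Submodule.smul_mem _ _ (sum_mem fun k _ => Submodule.mul_mem_mul (hv k)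
      (ih (pderiv_isHomogeneous_succ hp k)))

variable (hc : AlmostCommuting 𝓥 𝓗)
include hc

/-- To leading order symmetrization respects multiplication by a variable. The error is expanded by
Euler's identity into errors of smaller degree and into swaps of two generators. -/
theorem symmetrize_X_mul_sub_mem {n : ℕ} {p : MvPolynomial ι F} (hp : p.IsHomogeneous n) (k : ι) :
    symmetrize v (X k * p) - v k * symmetrize v p ∈ fil 𝓥 𝓗 (n + 1) := by
  classical
  induction n generalizing p with
  | zero =>
    obtain ⟨c, rfl⟩ := eq_C_of_isHomogeneous_zero hp
    have h : (X k : MvPolynomial ι F).IsHomogeneous 1 := isHomogeneous_X F k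
    have h1 : symmetrize v (X k : MvPolynomial ι F) = v k := by
      have := smul_symmetrize v h
      simp only [pderiv_X, Nat.cast_one, one_smul] at this
      rw [this, Finset.sum_eq_single k]
      · simp [symmetrize_one]
      · intro l _ hl
        simp [hl.symm]
      · simp
    rw [mul_comm, ← smul_eq_C_mul, ← mul_one (C c), ← smul_eq_C_mul, map_smul, map_smul, symmetrize_one, h1]
    simp
  | succ n ih =>
    have hn : ((n + 1 + 1 : ℕ) : F) ≠ 0 := Nat.cast_ne_zero.2 (n + 1).succ_ne_zero
    have hXp : (X k * p).IsHomogeneous (n + 1 + 1) := by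
      rw [add_comm (n + 1)]
      exact (isHomogeneous_X F k).mul hp
    -- Euler's identity is applied to `X k * p` in degree `n + 2` and to `p` in degree `n + 1`. The
    -- difference of the two degrees leaves one copy of `v k * symmetrize v p`, which cancels the
    -- Leibniz term where the derivative hits `X k`.
    have key : ((n + 1 + 1 : ℕ) : F) • (symmetrize v (X k * p) - v k * symmetrize v p) =
        ∑ l, (v l * (symmetrize v (X k * pderiv l p) - v k * symmetrize v (pderiv l p)) +
          (v l * (v k * symmetrize v (pderiv l p)) - v k * (v l * symmetrize v (pderiv l p)))) := by
      have h1 : ∑ l, v l * symmetrize v (pderiv l (X k * p)) = v k * symmetrize v p +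
          ∑ l, v l * symmetrize v (X k * pderiv l p) := by
        have : ∀ l, v l * symmetrize v (pderiv l (X k * p)) = v l * symmetrize v (X k * pderiv l p) +
            (if l = k then v k * symmetrize v p else 0) := by
          intro l
          rw [Derivation.leibniz, pderiv_X, smul_eq_mul, smul_eq_mul, map_add, mul_add]
          split_ifs with h
          · subst h
            simp
          · simp [Ne.symm h]
        simp only [this, Finset.sum_add_distrib, Finset.sum_ite_eq', Finset.mem_univ, if_true]
        rw [add_comm]
      have h2 : ∑ l, v k * (v l * symmetrize v (pderiv l p)) = v k * ((n + 1 : ℕ) : F) • symmetrize v p := by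
        rw [smul_symmetrize v hp, Finset.mul_sum]
      rw [smul_sub, smul_symmetrize v hXp, h1, Finset.sum_add_distrib, Finset.sum_sub_distrib, h2,
        Nat.cast_succ, add_smul, one_smul, mul_smul_comm]
      simp only [mul_sub, Finset.sum_sub_distrib]
      abel
    rw [← inv_smul_smul₀ hn (symmetrize v (X k * p) - v k * symmetrize v p), key]
    refine Submodule.smul_mem _ _ (sum_mem fun l _ => add_mem ?_ ?_)
    · exact mul_mem_fil_succ (hv l) (ih (pderiv_isHomogeneous_succ hp l))
    · exact fil_mono (n + 1).le_succ
        (hc.swap_mem_fil (hv l) (hv k) (symmetrize_mem_pow hv (pderiv_isHomogeneous_succ hp l)))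

end Symmetrization

/-! ### Equivariance of symmetrization under linear substitutions and linear derivations -/

section Equivariance

open MvPolynomial

variable {F : Type*} [Field F] {A : Type*} [Ring A] [Algebra F A] {ι : Type*}

theorem mem_of_forall_isHomogeneous (S : Submodule F (MvPolynomial ι F))
    (h : ∀ n, ∀ p : MvPolynomial ι F, p.IsHomogeneous n → p ∈ S) (p : MvPolynomial ι F) : p ∈ S := by
  rw [← sum_homogeneousComponent p]
  exact sum_mem fun n _ => h n _ (homogeneousComponent_isHomogeneous n p)

variable [Fintype ι]

/-- The substitution of variables by linear forms given by a matrix. -/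
def linSubst (T : Matrix ι ι F) : MvPolynomial ι F →ₐ[F] MvPolynomial ι F :=
  aeval fun k => ∑ l, T l k • X l

theorem linSubst_isHomogeneous (T : Matrix ι ι F) {n : ℕ} {p : MvPolynomial ι F}
    (hp : p.IsHomogeneous n) : (linSubst T p).IsHomogeneous n := by
  have := hp.aeval (fun k => ∑ l, T l k • (X l : MvPolynomial ι F)) (n := 1) fun k =>
    IsHomogeneous.sum _ _ _ fun l _ => by
      rw [smul_eq_C_mul]
      exact (isHomogeneous_X F l).C_mul _
  rwa [one_mul] at this

theorem pderiv_linSubst (T : Matrix ι ι F) (m : ι) (p : MvPolynomial ι F) :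
    pderiv m (linSubst T p) = ∑ k, T m k • linSubst T (pderiv k p) := by
  classical
  induction p using MvPolynomial.induction_on with
  | C a =>
    have : linSubst T (C a) = C a := (linSubst T).commutes a
    simp [this]
  | add p q hp hq => simp only [map_add, smul_add, Finset.sum_add_distrib, hp, hq]
  | mul_X p i hp =>
    have hX : linSubst T (X i) = ∑ l, T l i • X l := aeval_X _ _
    have h1 : pderiv m (linSubst T (X i)) = C (T m i) := by
      rw [hX, map_sum, Finset.sum_eq_single m]
      · rw [Derivation.map_smul, pderiv_X_self, smul_eq_C_mul, mul_one]
      · intro l _ hl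
        rw [Derivation.map_smul, pderiv_X_of_ne hl, smul_zero]
      · simp
    have h2 : ∀ k, T m k • linSubst T (pderiv k (p * X i)) =
        (T m k • linSubst T (pderiv k p)) * linSubst T (X i) +
          if i = k then linSubst T p * C (T m i) else 0 := by
      intro k
      rw [pderiv_mul, map_add, map_mul, map_mul, smul_add, smul_mul_assoc]
      congr 1
      split_ifs with h
      · subst h
        rw [pderiv_X_self, map_one, mul_one, smul_eq_C_mul, mul_comm]
      · rw [pderiv_X_of_ne h, map_zero, mul_zero, smul_zero]
    rw [map_mul, pderiv_mul, hp, h1]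
    simp only [h2, Finset.sum_add_distrib, Finset.sum_mul, Finset.sum_ite_eq, Finset.mem_univ,
      if_true]

/-- The derivation of the polynomial algebra given by a matrix. -/
def linDer (T : Matrix ι ι F) : MvPolynomial ι F →ₗ[F] MvPolynomial ι F :=
  ∑ k, ∑ l, T l k • (LinearMap.mulLeft F (X l) ∘ₗ (pderiv (R := F) k).toLinearMap)

theorem linDer_apply (T : Matrix ι ι F) (p : MvPolynomial ι F) :
    linDer T p = ∑ k, ∑ l, T l k • (X l * pderiv k p) := by
  simp [linDer]

theorem linDer_isHomogeneous (T : Matrix ι ι F) {n : ℕ} {p : MvPolynomial ι F}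
    (hp : p.IsHomogeneous n) : (linDer T p).IsHomogeneous n := by
  rw [linDer_apply]
  refine IsHomogeneous.sum _ _ _ fun k _ => IsHomogeneous.sum _ _ _ fun l _ => ?_
  rw [smul_eq_C_mul]
  refine IsHomogeneous.C_mul ?_ _
  rcases n with _ | n
  · obtain ⟨c, rfl⟩ := eq_C_of_isHomogeneous_zero hp
    rw [pderiv_C, mul_zero]
    exact isHomogeneous_zero _ _ _
  · rw [add_comm]
    exact (isHomogeneous_X F l).mul (pderiv_isHomogeneous_succ hp k)

theorem pderiv_linDer (T : Matrix ι ι F) (m : ι) (p : MvPolynomial ι F) :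
    pderiv m (linDer T p) = linDer T (pderiv m p) + ∑ k, T m k • pderiv k p := by
  classical
  rw [linDer_apply, linDer_apply, map_sum, ← Finset.sum_add_distrib]
  refine Finset.sum_congr rfl fun k _ => ?_
  have : ∀ l, pderiv m (T l k • (X l * pderiv k p)) =
      T l k • (X l * pderiv k (pderiv m p)) + if l = m then T m k • pderiv k p else 0 := by
    intro l
    rw [Derivation.map_smul, pderiv_mul, smul_add, add_comm, pderiv_comm m k]
    congr 1
    split_ifs with h
    · subst h
      rw [pderiv_X_self, one_mul]
    · rw [pderiv_X_of_ne h, zero_mul, smul_zero]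
  rw [map_sum]
  simp only [this, Finset.sum_add_distrib, Finset.sum_ite_eq', Finset.mem_univ, if_true]

variable {v : ι → A}

/-- The hypotheses on `τ` describe conjugation by a group-like element. The chain rule makes the
Euler recursion invariant under a linear change of variables, so the claim follows by induction on
the degree. -/
theorem map_symmetrize_linSubst (T : Matrix ι ι F) (τ : A →ₗ[F] A) (h1 : τ 1 = 1)
    (hτ : ∀ k a, τ (v k * a) = ∑ l, T l k • (v l * τ a)) (p : MvPolynomial ι F) :
    τ (symmetrize v p) = symmetrize v (linSubst T p) := by
  refine mem_of_forall_isHomogeneous (LinearMap.eqLocus (τ ∘ₗ symmetrize v)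
    (symmetrize v ∘ₗ (linSubst T).toLinearMap)) (fun n p hp => ?_) p
  change τ (symmetrize v p) = symmetrize v (linSubst T p)
  induction n generalizing p with
  | zero =>
    obtain ⟨c, rfl⟩ := eq_C_of_isHomogeneous_zero hp
    have : linSubst T (C c) = C c := (linSubst T).commutes c
    rw [this, ← mul_one (C c), ← smul_eq_C_mul, map_smul, map_smul, symmetrize_one, h1]
  | succ n ih =>
    rw [symmetrize_eq_symDeg v (linSubst_isHomogeneous T hp), symmetrize_eq_symDeg v hp, symDeg_succ,
      symDeg_succ, map_smul, map_sum]
    congr 1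
    simp only [hτ, pderiv_linSubst, map_sum, map_smul, Finset.mul_sum, mul_smul_comm]
    rw [Finset.sum_comm]
    refine Finset.sum_congr rfl fun l _ => Finset.sum_congr rfl fun k _ => ?_
    have hk := pderiv_isHomogeneous_succ hp k
    rw [← symmetrize_eq_symDeg v hk, ih _ hk, symmetrize_eq_symDeg v (linSubst_isHomogeneous T hk)]

/-- The infinitesimal counterpart, with `τ` modelled on the commutator with a primitive element. -/
theorem map_symmetrize_linDer (T : Matrix ι ι F) (τ : A →ₗ[F] A) (h1 : τ 1 = 0)
    (hτ : ∀ k a, τ (v k * a) = v k * τ a + ∑ l, T l k • (v l * a)) (p : MvPolynomial ι F) :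
    τ (symmetrize v p) = symmetrize v (linDer T p) := by
  refine mem_of_forall_isHomogeneous (LinearMap.eqLocus (τ ∘ₗ symmetrize v)
    (symmetrize v ∘ₗ linDer T)) (fun n p hp => ?_) p
  change τ (symmetrize v p) = symmetrize v (linDer T p)
  induction n generalizing p with
  | zero =>
    obtain ⟨c, rfl⟩ := eq_C_of_isHomogeneous_zero hp
    have : linDer T (C c) = 0 := by simp [linDer_apply]
    rw [this, ← mul_one (C c), ← smul_eq_C_mul, map_smul, symmetrize_one, map_smul, h1, smul_zero, map_zero]
  | succ n ih =>
    rw [symmetrize_eq_symDeg v (linDer_isHomogeneous T hp), symmetrize_eq_symDeg v hp, symDeg_succ,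
      symDeg_succ, map_smul, map_sum]
    congr 1
    simp only [hτ, pderiv_linDer, map_sum, map_add, map_smul, mul_add, Finset.mul_sum,
      mul_smul_comm, Finset.sum_add_distrib]
    congr 1
    · refine Finset.sum_congr rfl fun k _ => ?_
      have hk := pderiv_isHomogeneous_succ hp k
      rw [← symmetrize_eq_symDeg v hk, ih _ hk, symmetrize_eq_symDeg v (linDer_isHomogeneous T hk)]
    · exact Finset.sum_comm

end Equivariance

/-! ### Generators and relations of the algebra `A` -/

section HeckeRelations

variable {F : Type*} [Field F] {H : Type*} [Ring H] [HopfAlgebra F H]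
  {V : Type*} [AddCommGroup V] [Module F V]
  (ρ : H →ₐ[F] Module.End F V) (κ : V [⋀^Fin 2]→ₗ[F] H)

theorem heckeH_mul_heckeV (h : H) (v : V) : heckeH ρ κ h * heckeV ρ κ v =
    LinearMap.mul' F (HeckeAlgebra ρ κ) (TensorProduct.map (heckeV ρ κ ∘ₗ ρ.toLinearMap.flip v)
      (heckeH ρ κ).toLinearMap (Coalgebra.comul h)) := by
  have h1 := congrArg (heckeMk ρ κ) (smashMk_rel (SmashRel.cross (ρ := ρ) h v))
  rw [map_mul, map_mul] at h1
  refine h1.trans ?_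
  generalize (Coalgebra.comul h : H ⊗[F] H) = z
  induction z with
  | zero => simp only [map_zero]
  | tmul a b =>
    simp only [TensorProduct.map_tmul, LinearMap.mul'_apply, map_mul]
    rfl
  | add a b ha hb => simp only [map_add, ha, hb]

theorem groupLike_mul_heckeV {g : H} (hg : IsGroupLikeElem F g) (v : V) :
    heckeH ρ κ g * heckeV ρ κ v = heckeV ρ κ (ρ g v) * heckeH ρ κ g := by
  rw [heckeH_mul_heckeV, hg.comul_eq_tmul_self]
  simp

theorem primitive_mul_heckeV {x : H} (hx : IsPrimitiveElem F x) (v : V) :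
    heckeH ρ κ x * heckeV ρ κ v = heckeV ρ κ v * heckeH ρ κ x + heckeV ρ κ (ρ x v) := by
  rw [heckeH_mul_heckeV, show (Coalgebra.comul x : H ⊗[F] H) = 1 ⊗ₜ[F] x + x ⊗ₜ[F] 1 from hx]
  simp

theorem heckeV_commutator (v w : V) : heckeV ρ κ v * heckeV ρ κ w - heckeV ρ κ w * heckeV ρ κ v =
    heckeH ρ κ (κ ![v, w]) := by
  have h1 : heckeMk ρ κ _ = heckeMk ρ κ _ := RingQuot.mkAlgHom_rel F (HeckeRel.comm (ρ := ρ) v w)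
  rw [map_sub, map_mul, map_mul] at h1
  exact h1

theorem almostCommuting_hecke : AlmostCommuting (LinearMap.range (heckeV ρ κ))
    (LinearMap.range (heckeH ρ κ).toLinearMap) where
  one_mem := ⟨1, map_one (heckeH ρ κ)⟩
  mul_le := by
    rw [Submodule.mul_le]
    rintro _ ⟨a, rfl⟩ _ ⟨b, rfl⟩
    exact ⟨a * b, map_mul (heckeH ρ κ) _ _⟩
  cross_le := by
    rw [Submodule.mul_le]
    rintro _ ⟨h, rfl⟩ _ ⟨v, rfl⟩
    change heckeH ρ κ h * heckeV ρ κ v ∈ _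
    rw [heckeH_mul_heckeV]
    generalize (Coalgebra.comul h : H ⊗[F] H) = z
    induction z with
    | zero => simp only [map_zero, zero_mem]
    | tmul a b =>
      rw [TensorProduct.map_tmul, LinearMap.mul'_apply]
      exact Submodule.mul_mem_mul ⟨_, rfl⟩ ⟨b, rfl⟩
    | add a b ha hb =>
      simp only [map_add]
      exact add_mem ha hb
  comm_mem := by
    rintro _ ⟨v, rfl⟩ _ ⟨w, rfl⟩
    exact ⟨_, (heckeV_commutator ρ κ v w).symm⟩

theorem hecke_eq_top (S : Submodule F (HeckeAlgebra ρ κ)) (h1 : (1 : HeckeAlgebra ρ κ) ∈ S)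
    (hV : ∀ v ∈ LinearMap.range (heckeV ρ κ), ∀ a ∈ S, v * a ∈ S)
    (hH : ∀ h ∈ LinearMap.range (heckeH ρ κ).toLinearMap, ∀ a ∈ S, h * a ∈ S) : S = ⊤ := by
  rw [eq_top_iff]
  rintro a -
  obtain ⟨b, rfl⟩ := RingQuot.mkAlgHom_surjective F (HeckeRel ρ κ) a
  obtain ⟨t, rfl⟩ := RingQuot.mkAlgHom_surjective F (SmashRel ρ) b
  change heckeMk ρ κ (smashMk ρ t) ∈ S
  have key : ∀ a ∈ S, heckeMk ρ κ (smashMk ρ t) * a ∈ S := by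
    induction t using TensorAlgebra.induction with
    | algebraMap r =>
      intro a ha
      rw [AlgHom.commutes, AlgHom.commutes, ← Algebra.smul_def]
      exact S.smul_mem r ha
    | ι x =>
      intro a ha
      have : heckeMk ρ κ (smashMk ρ (TensorAlgebra.ι F x)) = heckeV ρ κ x.1 + heckeH ρ κ x.2 := by
        have hx : x = (x.1, 0) + (0, x.2) := by simp
        conv_lhs => rw [hx, map_add, map_add, map_add]
        rfl
      rw [this, add_mul]
      exact add_mem (hV _ ⟨_, rfl⟩ a ha) (hH _ ⟨_, rfl⟩ a ha)
    | mul s t hs ht =>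
      intro a ha
      rw [map_mul, map_mul, mul_assoc]
      exact hs _ (ht a ha)
    | add s t hs ht =>
      intro a ha
      rw [map_add, map_add, add_mul]
      exact add_mem (hs a ha) (ht a ha)
  simpa using key 1 h1

theorem filtLT_eq_fil (n : ℕ) : filtLT ρ κ n =
    fil (LinearMap.range (heckeV ρ κ)) (LinearMap.range (heckeH ρ κ).toLinearMap) n := rfl

end HeckeRelations

/-! ## The PBW isomorphism given by symmetrization -/

section DegreeFiltration

open MvPolynomial

variable {F : Type*} [Field F] {ι : Type*} {W : Type*} [AddCommGroup W] [Module F W]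

variable (F ι W) in
/-- The elements of degree less than `n` in the space of polynomials with coefficients in `W`. -/
def degLT (n : ℕ) : Submodule F (MvPolynomial ι F ⊗[F] W) :=
  Submodule.span F {y | ∃ m < n, ∃ p : MvPolynomial ι F, p.IsHomogeneous m ∧ ∃ w, y = p ⊗ₜ w}

theorem tmul_mem_degLT {m n : ℕ} (h : m < n) {p : MvPolynomial ι F} (hp : p.IsHomogeneous m)
    (w : W) : p ⊗ₜ w ∈ degLT F ι W n :=
  Submodule.subset_span ⟨m, h, p, hp, w, rfl⟩

theorem degLT_mono {m n : ℕ} (h : m ≤ n) : degLT F ι W m ≤ degLT F ι W n :=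
  Submodule.span_mono fun _ ⟨k, hk, hy⟩ => ⟨k, hk.trans_le h, hy⟩

theorem degLT_zero : degLT F ι W 0 = ⊥ := by
  rw [eq_bot_iff, degLT, Submodule.span_le]
  rintro _ ⟨m, hm, -⟩
  exact absurd hm m.not_lt_zero

theorem exists_mem_degLT (y : MvPolynomial ι F ⊗[F] W) : ∃ n, y ∈ degLT F ι W n := by
  induction y with
  | zero => exact ⟨0, zero_mem _⟩
  | tmul p w =>
    refine ⟨p.totalDegree + 1, ?_⟩
    rw [← sum_homogeneousComponent p, TensorProduct.sum_tmul]
    refine sum_mem fun i hi => ?_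
    rw [sum_homogeneousComponent p]
    exact tmul_mem_degLT (Finset.mem_range.1 hi) (homogeneousComponent_isHomogeneous i p) w
  | add x y hx hy =>
    obtain ⟨m, hm⟩ := hx
    obtain ⟨n, hn⟩ := hy
    exact ⟨max m n, add_mem (degLT_mono (le_max_left _ _) hm) (degLT_mono (le_max_right _ _) hn)⟩

theorem exists_eq_add_of_mem_degLT_succ {n : ℕ} {y : MvPolynomial ι F ⊗[F] W}
    (hy : y ∈ degLT F ι W (n + 1)) : ∃ z : homogeneousSubmodule ι F n ⊗[F] W,
      ∃ y' ∈ degLT F ι W n, y = (homogeneousSubmodule ι F n).subtype.rTensor W z + y' := by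
  induction hy using Submodule.span_induction with
  | mem y hy =>
    obtain ⟨m, hm, p, hp, w, rfl⟩ := hy
    rcases Nat.lt_succ_iff_lt_or_eq.1 hm with h | rfl
    · exact ⟨0, _, tmul_mem_degLT h hp w, by simp⟩
    · exact ⟨⟨p, hp⟩ ⊗ₜ w, 0, zero_mem _, by simp⟩
  | zero => exact ⟨0, 0, zero_mem _, by simp⟩
  | add x y _ _ hx hy =>
    obtain ⟨z, x', hx', rfl⟩ := hx
    obtain ⟨z', y', hy', rfl⟩ := hy
    exact ⟨z + z', x' + y', add_mem hx' hy', by rw [map_add]; abel⟩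
  | smul c x _ hx =>
    obtain ⟨z, x', hx', rfl⟩ := hx
    exact ⟨c • z, c • x', Submodule.smul_mem _ _ hx', by rw [map_smul, smul_add]⟩

end DegreeFiltration

/-! ### Bijectivity of the symmetrized PBW map -/

section PBW

open MvPolynomial

variable {F : Type*} [Field F] {H : Type*} [Ring H] [HopfAlgebra F H]
  {V : Type*} [AddCommGroup V] [Module F V]
  (ρ : H →ₐ[F] Module.End F V) (κ : V [⋀^Fin 2]→ₗ[F] H)
  {ι : Type*} (b : Module.Basis ι F V)

theorem map_range_ι_eq :
    (LinearMap.range (SymmetricAlgebra.ι F V)).map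
      (SymmetricAlgebra.equivMvPolynomial b).toAlgHom.toLinearMap = homogeneousSubmodule ι F 1 := by
  rw [homogeneousSubmodule_one_eq_span_X, ← LinearMap.range_comp, LinearMap.range_eq_map,
    ← b.span_eq, Submodule.map_span, ← Set.range_comp]
  congr 2
  ext1 k
  exact SymmetricAlgebra.equivMvPolynomial_ι_apply b k

theorem map_symPiece_eq (n : ℕ) :
    (symPiece F V n).map (SymmetricAlgebra.equivMvPolynomial b).toAlgHom.toLinearMap =
      homogeneousSubmodule ι F n := by
  rw [symPiece, Submodule.map_pow, map_range_ι_eq, homogeneousSubmodule_one_pow]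

theorem isHomogeneous_of_mem_symPiece {n : ℕ} {t : SymmetricAlgebra F V} (ht : t ∈ symPiece F V n) :
    (SymmetricAlgebra.equivMvPolynomial b t).IsHomogeneous n := by
  have : SymmetricAlgebra.equivMvPolynomial b t ∈ homogeneousSubmodule ι F n := by
    rw [← map_symPiece_eq b n]
    exact Submodule.mem_map_of_mem ht
  exact this

theorem mem_symPiece_of_isHomogeneous {n : ℕ} {p : MvPolynomial ι F} (hp : p.IsHomogeneous n) :
    (SymmetricAlgebra.equivMvPolynomial b).symm p ∈ symPiece F V n := by
  have : p ∈ homogeneousSubmodule ι F n := hp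
  rw [← map_symPiece_eq b n] at this
  obtain ⟨t, ht, rfl⟩ := this
  change (SymmetricAlgebra.equivMvPolynomial b).symm (SymmetricAlgebra.equivMvPolynomial b t) ∈ _
  rwa [AlgEquiv.symm_apply_apply]

variable [Fintype ι]

/-- The map `S(V) ⊗ H → A` given by symmetrization and multiplication. -/
def pbwMap : MvPolynomial ι F ⊗[F] H →ₗ[F] HeckeAlgebra ρ κ :=
  LinearMap.mul' F _ ∘ₗ
    TensorProduct.map (symmetrize fun k => heckeV ρ κ (b k)) (heckeH ρ κ).toLinearMap

theorem pbwMap_tmul (p : MvPolynomial ι F) (h : H) :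
    pbwMap ρ κ b (p ⊗ₜ h) = symmetrize (fun k => heckeV ρ κ (b k)) p * heckeH ρ κ h := rfl

variable [CharZero F]

theorem symmetrize_linear_mul_sub_mem (x : V) {n : ℕ} {p : MvPolynomial ι F}
    (hp : p.IsHomogeneous n) :
    symmetrize (fun k => heckeV ρ κ (b k))
        (SymmetricAlgebra.equivMvPolynomial b (SymmetricAlgebra.ι F V x) * p) -
      heckeV ρ κ x * symmetrize (fun k => heckeV ρ κ (b k)) p ∈ filtLT ρ κ (n + 1) := by
  have hx : x ∈ Submodule.span F (Set.range b) := b.mem_span x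
  induction hx using Submodule.span_induction with
  | mem x hx =>
    obtain ⟨k, rfl⟩ := hx
    rw [SymmetricAlgebra.equivMvPolynomial_ι_apply]
    exact symmetrize_X_mul_sub_mem (𝓥 := LinearMap.range (heckeV ρ κ)) (fun k => ⟨b k, rfl⟩) (almostCommuting_hecke ρ κ) hp k
  | zero => simp
  | add x y _ _ hx hy =>
    have := add_mem hx hy
    rw [sub_add_sub_comm, ← map_add, ← add_mul, ← add_mul, ← map_add, ← map_add, ← map_add] at this
    exact this
  | smul c x _ hx =>
    have := Submodule.smul_mem _ c hx
    rw [smul_sub, ← map_smul, ← smul_mul_assoc, ← smul_mul_assoc, ← map_smul, ← map_smul,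
      ← map_smul] at this
    exact this

theorem symmetrize_word_sub_mem (n : ℕ) (x : Fin n → V) :
    symmetrize (fun k => heckeV ρ κ (b k)) (SymmetricAlgebra.equivMvPolynomial b
        (List.ofFn fun i => SymmetricAlgebra.ι F V (x i)).prod) -
      (List.ofFn fun i => heckeV ρ κ (x i)).prod ∈ filtLT ρ κ n := by
  induction n with
  | zero => simp [symmetrize_one]
  | succ n ih =>
    rw [List.ofFn_succ, List.prod_cons, List.ofFn_succ, List.prod_cons, map_mul]
    have h1 := symmetrize_linear_mul_sub_mem ρ κ b (x 0) (isHomogeneous_of_mem_symPiece b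
      (prod_ofFn_mem_pow (SymmetricAlgebra.ι F V) n fun i => x i.succ))
    have h2 : _ ∈ filtLT ρ κ (n + 1) := mul_mem_fil_succ (v := heckeV ρ κ (x 0)) ⟨x 0, rfl⟩
      (ih fun i => x i.succ)
    rw [mul_sub] at h2
    have := add_mem h1 h2
    rwa [sub_add_sub_cancel] at this

theorem pbwMap_mem {n : ℕ} {p : MvPolynomial ι F} (hp : p.IsHomogeneous n) (h : H) :
    pbwMap ρ κ b (p ⊗ₜ h) ∈ filtLT ρ κ (n + 1) :=
  le_fil n.lt_succ_self (Submodule.mul_mem_mul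
    (symmetrize_mem_pow (𝓥 := LinearMap.range (heckeV ρ κ)) (fun k => ⟨b k, rfl⟩) hp) ⟨h, rfl⟩)

theorem map_degLT_le (n : ℕ) : (degLT F ι H n).map (pbwMap ρ κ b) ≤ filtLT ρ κ n := by
  rw [degLT, Submodule.map_span, Submodule.span_le]
  rintro _ ⟨_, ⟨m, hm, p, hp, h, rfl⟩, rfl⟩
  exact fil_mono hm (pbwMap_mem ρ κ b hp h)

theorem exists_sub_symmetrize_mem {n : ℕ} {a : HeckeAlgebra ρ κ}
    (ha : a ∈ LinearMap.range (heckeV ρ κ) ^ n) : ∃ p : MvPolynomial ι F, p.IsHomogeneous n ∧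
      a - symmetrize (fun k => heckeV ρ κ (b k)) p ∈ filtLT ρ κ n := by
  induction ha using Submodule.pow_induction_on_left' with
  | algebraMap r =>
    refine ⟨C r, isHomogeneous_C _ _, ?_⟩
    rw [← mul_one (C r), ← smul_eq_C_mul, map_smul, symmetrize_one, Algebra.algebraMap_eq_smul_one,
      sub_self]
    exact zero_mem _
  | add x y n _ _ hx hy =>
    obtain ⟨p, hp, hp'⟩ := hx
    obtain ⟨q, hq, hq'⟩ := hy
    refine ⟨p + q, hp.add hq, ?_⟩
    rw [map_add, add_sub_add_comm]
    exact add_mem hp' hq'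
  | mem_mul m hm n x _ hx =>
    obtain ⟨y, rfl⟩ := hm
    obtain ⟨p, hp, hp'⟩ := hx
    refine ⟨SymmetricAlgebra.equivMvPolynomial b (SymmetricAlgebra.ι F V y) * p, ?_, ?_⟩
    · rw [Nat.succ_eq_add_one, add_comm]
      refine IsHomogeneous.mul (isHomogeneous_of_mem_symPiece b ?_) hp
      rw [symPiece, pow_one]
      exact ⟨y, rfl⟩
    · have h1 : _ ∈ filtLT ρ κ (n + 1) := mul_mem_fil_succ (v := heckeV ρ κ y) ⟨y, rfl⟩ hp'
      have h2 := sub_mem h1 (symmetrize_linear_mul_sub_mem ρ κ b y hp)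
      rwa [mul_sub, sub_sub_sub_cancel_right] at h2

theorem filtLT_le_map (n : ℕ) : filtLT ρ κ n ≤ (degLT F ι H n).map (pbwMap ρ κ b) := by
  induction n with
  | zero =>
    rw [filtLT_eq_fil, fil_zero]
    exact bot_le
  | succ n ih =>
    rw [filtLT_eq_fil, fil_succ]
    have ih' := ih.trans (Submodule.map_mono (degLT_mono n.le_succ))
    refine sup_le ih' ?_
    rw [Submodule.mul_le]
    rintro a ha _ ⟨h, rfl⟩
    obtain ⟨p, hp, hp'⟩ := exists_sub_symmetrize_mem ρ κ b ha
    have h1 := (almostCommuting_hecke ρ κ).fil_mul_mem hp' ⟨h, rfl⟩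
    rw [sub_mul] at h1
    have h2 := add_mem (ih' h1)
      (Submodule.mem_map_of_mem (tmul_mem_degLT n.lt_succ_self hp h))
    rwa [pbwMap_tmul, AlgHom.toLinearMap_apply, sub_add_cancel] at h2

theorem filtLT_eq_map (n : ℕ) : filtLT ρ κ n = (degLT F ι H n).map (pbwMap ρ κ b) :=
  le_antisymm (filtLT_le_map ρ κ b n) (map_degLT_le ρ κ b n)

theorem pbwMap_surjective : Function.Surjective (pbwMap ρ κ b) := by
  intro a
  obtain ⟨n, hn⟩ := (almostCommuting_hecke ρ κ).exists_mem_fil (hecke_eq_top ρ κ) a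
  obtain ⟨y, -, hy⟩ := filtLT_le_map ρ κ b n hn
  exact ⟨y, hy⟩

variable {ρ κ} (hP : HasPBW ρ κ)
include hP

/-- The symmetrization of a word differs from the word by terms of lower degree. Hence the given
isomorphism `φ` in degree `n` is the leading term of `pbwMap`, and that leading term is injective.
-/
theorem pbw_eq_zero {n : ℕ} {z : homogeneousSubmodule ι F n ⊗[F] H}
    (hz : pbwMap ρ κ b ((homogeneousSubmodule ι F n).subtype.rTensor H z) ∈ filtLT ρ κ n) :
    z = 0 := by
  obtain ⟨φ, hφ⟩ := hP n
  set ê := SymmetricAlgebra.equivMvPolynomial b with hê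
  set M : symPiece F V n ⊗[F] H →ₗ[F] HeckeAlgebra ρ κ := pbwMap ρ κ b ∘ₗ
    TensorProduct.map (ê.toLinearMap ∘ₗ (symPiece F V n).subtype) LinearMap.id with hM
  have hMmem : ∀ y, M y ∈ filtLT ρ κ (n + 1) := by
    intro y
    induction y with
    | zero => rw [map_zero]; exact zero_mem _
    | tmul t h => exact pbwMap_mem ρ κ b (isHomogeneous_of_mem_symPiece b t.2) h
    | add x y hx hy => rw [map_add]; exact add_mem hx hy
  -- Both maps are determined on words, because words span the symmetric power.
  have hφM : φ.toLinearMap = Submodule.mkQ _ ∘ₗ M.codRestrict (filtLT ρ κ (n + 1)) hMmem := by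
    refine TensorProduct.ext ?_
    rw [Submodule.linearMap_eq_iff_of_eq_span (S := Set.range fun x : Fin n → V =>
      (List.ofFn fun i => SymmetricAlgebra.ι F V (x i)).prod)]
    · rintro ⟨_, x, rfl⟩
      ext1 h
      refine (hφ x h).trans ((Submodule.Quotient.eq _).2 ?_)
      change _ ∈ filtLT ρ κ n
      have h1 := (almostCommuting_hecke ρ κ).fil_mul_mem (neg_mem (symmetrize_word_sub_mem ρ κ b n x))
        (LinearMap.mem_range_self (heckeH ρ κ).toLinearMap h)
      rw [neg_sub, sub_mul] at h1
      exact h1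
    · rw [symPiece, ← Submodule.span_eq (LinearMap.range (SymmetricAlgebra.ι F V)),
        Submodule.span_pow]
      congr 1
      ext t
      rw [Set.mem_pow]
      constructor
      · rintro ⟨f, rfl⟩
        choose x hx using fun i => (f i).2
        exact ⟨x, by simp only [hx]⟩
      · rintro ⟨x, rfl⟩
        exact ⟨fun i => ⟨_, ⟨x i, rfl⟩⟩, rfl⟩
  set e : homogeneousSubmodule ι F n →ₗ[F] symPiece F V n :=
    ê.symm.toLinearMap.restrict (p := homogeneousSubmodule ι F n) (q := symPiece F V n)
      (fun p hp => mem_symPiece_of_isHomogeneous b hp) with he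
  have hinj : Function.Injective e := by
    intro p q hpq
    exact Subtype.ext (ê.symm.injective (congrArg Subtype.val hpq))
  have hMe : M ∘ₗ e.rTensor H = pbwMap ρ κ b ∘ₗ (homogeneousSubmodule ι F n).subtype.rTensor H := by
    refine TensorProduct.ext' fun p h => ?_
    simp only [hM, LinearMap.comp_apply, LinearMap.rTensor_tmul, TensorProduct.map_tmul]
    congr 2
    exact ê.apply_symm_apply _
  have h1 : φ (e.rTensor H z) = 0 := by
    change φ.toLinearMap _ = 0
    rw [hφM]
    refine (Submodule.Quotient.mk_eq_zero _).2 ?_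
    change _ ∈ filtLT ρ κ n
    have := LinearMap.congr_fun hMe z
    simp only [LinearMap.comp_apply] at this
    rw [← this] at hz
    exact hz
  have h2 := (LinearEquiv.map_eq_zero_iff φ).1 h1
  exact Module.Flat.rTensor_preserves_injective_linearMap e hinj (h2.trans (map_zero _).symm)

theorem pbwMap_injective : Function.Injective (pbwMap ρ κ b) := by
  rw [← LinearMap.ker_eq_bot, eq_bot_iff]
  have key : ∀ n, ∀ y ∈ degLT F ι H n, pbwMap ρ κ b y = 0 → y = 0 := by
    intro n
    induction n with
    | zero =>
      intro y hy _
      rwa [degLT_zero] at hy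
    | succ n ih =>
      intro y hy h0
      obtain ⟨z, y', hy', rfl⟩ := exists_eq_add_of_mem_degLT_succ hy
      have hz : z = 0 := by
        refine pbw_eq_zero b hP ?_
        rw [map_add] at h0
        rw [eq_neg_of_add_eq_zero_left h0]
        exact neg_mem (map_degLT_le ρ κ b n ⟨y', hy', rfl⟩)
      rw [hz, map_zero, zero_add] at h0 ⊢
      exact ih y' hy' h0
  intro y hy
  obtain ⟨n, hn⟩ := exists_mem_degLT y
  exact key n y hn hy

/-- The linear isomorphism `S(V) ⊗ H ≅ A` given by symmetrization. -/
def pbwEquiv : (MvPolynomial ι F ⊗[F] H) ≃ₗ[F] HeckeAlgebra ρ κ :=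
  LinearEquiv.ofBijective (pbwMap ρ κ b) ⟨pbwMap_injective b hP, pbwMap_surjective ρ κ b⟩

end PBW

/-! ## Contraction and insertion operators on the Clifford algebra -/

section Clifford

variable {F : Type*} [Field F] {V : Type*} [AddCommGroup V] [Module F V]
  {B : LinearMap.BilinForm F V}

theorem cliffV_mul_add_swap (hB : B.IsSymm) (v w : V) :
    cliffV B v * cliffV B w + cliffV B w * cliffV B v = algebraMap F _ (2 * B v w) := by
  rw [CliffordAlgebra.ι_mul_ι_add_swap, LinearMap.BilinMap.polar_toQuadraticMap, hB.eq w v, two_mul]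

/-- Right multiplication by `v`, with a sign on the odd elements. -/
def cliffRight : V →ₗ[F] Module.End F (Cliff B) :=
  (LinearMap.lcomp F (Cliff B) CliffordAlgebra.involute.toLinearMap) ∘ₗ
    (LinearMap.mul F (Cliff B)).flip ∘ₗ cliffV B

theorem cliffRight_apply (v : V) (c : Cliff B) :
    cliffRight v c = CliffordAlgebra.involute c * cliffV B v := rfl

/-- The super commutator with `v`, a multiple of the contraction with `v`. -/
def contraction : V →ₗ[F] Module.End F (Cliff B) :=
  LinearMap.mul F (Cliff B) ∘ₗ cliffV B - cliffRight

/-- The super anticommutator with `v`, a multiple of the exterior multiplication with `v`. -/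
def insertion : V →ₗ[F] Module.End F (Cliff B) :=
  LinearMap.mul F (Cliff B) ∘ₗ cliffV B + cliffRight

theorem contraction_apply (v : V) (c : Cliff B) :
    contraction v c = cliffV B v * c - CliffordAlgebra.involute c * cliffV B v := rfl

theorem insertion_apply (v : V) (c : Cliff B) :
    insertion v c = cliffV B v * c + CliffordAlgebra.involute c * cliffV B v := rfl

theorem involute_insertion (v : V) (c : Cliff B) :
    CliffordAlgebra.involute (insertion v c) = -insertion v (CliffordAlgebra.involute c) := by
  simp only [insertion_apply, map_add, map_mul, CliffordAlgebra.involute_ι]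
  noncomm_ring

/-- The canonical anticommutation relation. The factor 4 appears because each of the two operators
is twice the customary interior or exterior multiplication. -/
theorem contraction_insertion_add (hB : B.IsSymm) (v w : V) (c : Cliff B) :
    contraction v (insertion w c) + insertion w (contraction v c) = (4 * B v w) • c := by
  have h1 := congrArg (· * c) (cliffV_mul_add_swap hB v w)
  have h2 := congrArg (c * ·) (cliffV_mul_add_swap hB v w)
  simp only [← Algebra.commutes _ c, ← Algebra.smul_def] at h1 h2
  have h3 : (4 * B v w) • c = (2 * B v w) • c + (2 * B v w) • c := by
    rw [← add_smul]
    congr 1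
    ring
  rw [h3]
  nth_rw 1 [← h1]
  rw [← h2]
  simp only [contraction_apply, insertion_apply, map_add, map_sub, map_mul,
    CliffordAlgebra.involute_ι, CliffordAlgebra.involute_involute]
  noncomm_ring

theorem contraction_mul (hB : B.IsSymm) (v w : V) (c : Cliff B) :
    contraction v (cliffV B w * c) = (2 * B v w) • c - cliffV B w * contraction v c := by
  have h1 := congrArg (· * c) (cliffV_mul_add_swap hB v w)
  simp only [← Algebra.smul_def] at h1
  rw [← h1]
  simp only [contraction_apply, map_mul, CliffordAlgebra.involute_ι]
  noncomm_ring

theorem insertion_mul (hB : B.IsSymm) (v w : V) (c : Cliff B) :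
    insertion v (cliffV B w * c) = (2 * B v w) • c - cliffV B w * insertion v c := by
  have h1 := congrArg (· * c) (cliffV_mul_add_swap hB v w)
  simp only [← Algebra.smul_def] at h1
  rw [← h1]
  simp only [insertion_apply, map_mul, CliffordAlgebra.involute_ι]
  noncomm_ring

variable (B) in
/-- The filtration of the Clifford algebra: the elements of degree less than `j`. -/
def cliffLT : ℕ → Submodule F (Cliff B)
  | 0 => ⊥
  | j + 1 => (1 ⊔ LinearMap.range (cliffV B)) ^ j

theorem cliffLT_le_succ (j : ℕ) : cliffLT B j ≤ cliffLT B (j + 1) := by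
  rcases j with _ | j
  · exact bot_le
  · exact pow_le_pow_right₀ le_sup_left j.le_succ

theorem cliffV_mul_mem (v : V) {j : ℕ} {c : Cliff B} (hc : c ∈ cliffLT B j) :
    cliffV B v * c ∈ cliffLT B (j + 1) := by
  rcases j with _ | j
  · rw [show c = 0 from hc, mul_zero]
    exact zero_mem _
  · rw [cliffLT, pow_succ']
    exact Submodule.mul_mem_mul (Submodule.mem_sup_right ⟨v, rfl⟩) hc

/-- The index only bounds the degree, so besides products with vectors the property must survive
raising the bound. -/
theorem cliffLT_induction {P : ℕ → Cliff B → Prop} (h1 : ∀ r : F, P 0 (algebraMap F _ r))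
    (hadd : ∀ j, ∀ x ∈ cliffLT B (j + 1), ∀ y ∈ cliffLT B (j + 1), P j x → P j y → P j (x + y))
    (hsucc : ∀ j, ∀ c ∈ cliffLT B (j + 1), P j c → P (j + 1) c)
    (hsmul : ∀ j, ∀ c ∈ cliffLT B (j + 1), ∀ r : F, P j c → P j (r • c))
    (hmul : ∀ j, ∀ v, ∀ c ∈ cliffLT B (j + 1), P j c → P (j + 1) (cliffV B v * c)) {j : ℕ}
    {c : Cliff B} (hc : c ∈ cliffLT B (j + 1)) : P j c := by
  induction j generalizing c with
  | zero =>
    obtain ⟨r, rfl⟩ := Submodule.mem_one.1 hc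
    exact h1 r
  | succ j ih =>
    have hc' := hc
    rw [cliffLT, pow_succ'] at hc'
    induction hc' using Submodule.mul_induction_on' with
    | mem_mul_mem m hm c hc₂ =>
      obtain ⟨x, hx, _, ⟨v, rfl⟩, rfl⟩ := Submodule.mem_sup.1 hm
      obtain ⟨r, rfl⟩ := Submodule.mem_one.1 hx
      rw [add_mul, ← Algebra.smul_def]
      have hc1 : c ∈ cliffLT B (j + 1) := hc₂
      exact hadd _ _ (cliffLT_le_succ _ (Submodule.smul_mem _ _ hc1)) _ (cliffV_mul_mem v hc1)
        (hsucc _ _ (Submodule.smul_mem _ _ hc1) (hsmul _ _ hc1 _ (ih hc1))) (hmul _ _ _ hc1 (ih hc1))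
    | add x hx y hy hx' hy' =>
      rw [← pow_succ'] at hx hy
      exact hadd _ _ hx _ hy (hx' hx) (hy' hy)

/-- Modulo lower degree the Clifford algebra is the exterior algebra, where left multiplication by
`w` and signed right multiplication by `w` agree. -/
theorem cliffRight_sub_mul_mem (hB : B.IsSymm) (w : V) {j : ℕ} {c : Cliff B}
    (hc : c ∈ cliffLT B (j + 1)) : cliffRight w c - cliffV B w * c ∈ cliffLT B (j + 1) := by
  refine cliffLT_induction (P := fun j c => cliffRight w c - cliffV B w * c ∈ cliffLT B (j + 1))
    ?_ ?_ ?_ ?_ ?_ hc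
  · intro r
    rw [cliffRight_apply, AlgHom.commutes, Algebra.commutes, sub_self]
    exact zero_mem _
  · intro j x _ y _ hx hy
    rw [map_add, mul_add, add_sub_add_comm]
    exact add_mem hx hy
  · exact fun j c _ hc => cliffLT_le_succ _ hc
  · intro j c _ r hc
    rw [map_smul, mul_smul_comm, ← smul_sub]
    exact Submodule.smul_mem _ _ hc
  · intro j v c hcj hc
    have h1 := congrArg (· * c) (cliffV_mul_add_swap hB v w)
    simp only [← Algebra.smul_def] at h1
    have h2 : cliffRight w (cliffV B v * c) - cliffV B w * (cliffV B v * c) =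
        -(cliffV B v * (cliffRight w c - cliffV B w * c)) - (2 * B v w) • c := by
      rw [← h1]
      simp only [cliffRight_apply, map_mul, CliffordAlgebra.involute_ι]
      noncomm_ring
    rw [h2]
    exact sub_mem (neg_mem (cliffV_mul_mem v hc)) (Submodule.smul_mem _ _ (cliffLT_le_succ _ hcj))

theorem exists_mem_cliffLT (c : Cliff B) : ∃ j, c ∈ cliffLT B j := by
  have hmono : Monotone (cliffLT B) := monotone_nat_of_le_succ cliffLT_le_succ
  suffices h : ∃ j, c ∈ cliffLT B (j + 1) from ⟨_, h.choose_spec⟩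
  induction c using CliffordAlgebra.induction with
  | algebraMap r => exact ⟨0, Submodule.mem_one.2 ⟨r, rfl⟩⟩
  | ι v => exact ⟨1, by simpa using cliffV_mul_mem v (j := 1) (Submodule.mem_one.2 ⟨1, map_one _⟩)⟩
  | mul x y hx hy =>
    obtain ⟨i, hi⟩ := hx
    obtain ⟨j, hj⟩ := hy
    refine ⟨i + j, ?_⟩
    rw [cliffLT, pow_add]
    exact Submodule.mul_mem_mul hi hj
  | add x y hx hy =>
    obtain ⟨i, hi⟩ := hx
    obtain ⟨j, hj⟩ := hy
    exact ⟨max i j, add_mem (hmono (Nat.succ_le_succ (le_max_left i j)) hi)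
      (hmono (Nat.succ_le_succ (le_max_right i j)) hj)⟩

variable {ι : Type*} [Fintype ι] [DecidableEq ι] (hnd : B.Nondegenerate) (b : Module.Basis ι F V)

/-- The number operator `∑ e_k ι^k` on the Clifford algebra. -/
def numberOp : Module.End F (Cliff B) :=
  ∑ k, insertion (b k) ∘ₗ contraction (B.dualBasis hnd b k)

theorem numberOp_apply (c : Cliff B) :
    numberOp hnd b c = ∑ k, insertion (b k) (contraction (B.dualBasis hnd b k) c) := by
  simp [numberOp]

theorem sum_apply_dualBasis_smul (w : V) : ∑ k, B (B.dualBasis hnd b k) w • b k = w := by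
  suffices h : ∑ k, (B (B.dualBasis hnd b k)).smulRight (b k) = LinearMap.id by
    simpa using LinearMap.congr_fun h w
  refine b.ext fun l => ?_
  simp [LinearMap.BilinForm.apply_dualBasis_left]

theorem sum_apply_smul_dualBasis (hB : B.IsSymm) (w : V) :
    ∑ k, B (b k) w • B.dualBasis hnd b k = w := by
  suffices h : ∑ k, (B (b k)).smulRight (B.dualBasis hnd b k) = LinearMap.id by
    simpa using LinearMap.congr_fun h w
  refine (B.dualBasis hnd b).ext fun l => ?_
  simp [LinearMap.BilinForm.apply_dualBasis_right hnd hB]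

/-- Contraction and insertion both anticommute with left multiplication by `w` up to a scalar `2
B(·, w)`. Summed over dual bases, the scalar terms become twice the difference of insertion and
contraction by `w`, which is four times the signed right multiplication. -/
theorem numberOp_mul (hB : B.IsSymm) (w : V) (c : Cliff B) :
    numberOp hnd b (cliffV B w * c) =
      cliffV B w * numberOp hnd b c + (4 : F) • cliffRight w c := by
  have h1 : ∀ k, insertion (b k) (contraction (B.dualBasis hnd b k) (cliffV B w * c)) =
      cliffV B w * insertion (b k) (contraction (B.dualBasis hnd b k) c) +
        ((2 : F) • insertion (B (B.dualBasis hnd b k) w • b k) c -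
          (2 : F) • contraction (B (b k) w • B.dualBasis hnd b k) c) := by
    intro k
    rw [contraction_mul hB, map_sub, map_smul, insertion_mul hB]
    simp only [map_smul, LinearMap.smul_apply, smul_smul]
    abel
  rw [numberOp_apply, Finset.sum_congr rfl fun k _ => h1 k, Finset.sum_add_distrib,
    ← Finset.mul_sum, ← numberOp_apply, Finset.sum_sub_distrib, ← Finset.smul_sum,
    ← Finset.smul_sum, ← LinearMap.sum_apply, ← LinearMap.sum_apply, ← map_sum, ← map_sum,
    sum_apply_dualBasis_smul, sum_apply_smul_dualBasis hnd b hB, insertion_apply,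
    contraction_apply, cliffRight_apply]
  module

/-- The number operator has eigenvalue `4 j` on the part of degree `j` to leading order: each
further vector contributes 4, since signed right multiplication equals left multiplication up to
lower terms. -/
theorem numberOp_sub_mem (hB : B.IsSymm) {j : ℕ} {c : Cliff B} (hc : c ∈ cliffLT B (j + 1)) :
    numberOp hnd b c - (4 * j : F) • c ∈ cliffLT B j := by
  refine cliffLT_induction (P := fun j c => numberOp hnd b c - (4 * j : F) • c ∈ cliffLT B j)
    ?_ ?_ ?_ ?_ ?_ hc
  · intro r
    have : ∀ v : V, contraction v (algebraMap F (Cliff B) r) = 0 := fun v => by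
      rw [contraction_apply, AlgHom.commutes, Algebra.commutes, sub_self]
    simp [numberOp_apply, this]
  · intro j x _ y _ hx hy
    rw [map_add, smul_add, add_sub_add_comm]
    exact add_mem hx hy
  · intro j c hc h
    have : numberOp hnd b c - (4 * (j + 1 : ℕ) : F) • c =
        (numberOp hnd b c - (4 * j : F) • c) - (4 : F) • c := by
      push_cast
      module
    rw [this]
    exact sub_mem (cliffLT_le_succ _ h) (Submodule.smul_mem _ _ hc)
  · intro j c _ r hc
    rw [map_smul, smul_comm, ← smul_sub]
    exact Submodule.smul_mem _ _ hc
  · intro j w c hcj hc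
    have : numberOp hnd b (cliffV B w * c) - (4 * (j + 1 : ℕ) : F) • (cliffV B w * c) =
        cliffV B w * (numberOp hnd b c - (4 * j : F) • c) +
          (4 : F) • (cliffRight w c - cliffV B w * c) := by
      rw [numberOp_mul hnd b hB, mul_sub, mul_smul_comm]
      push_cast
      module
    rw [this]
    exact add_mem (cliffV_mul_mem w hc) (Submodule.smul_mem _ _ (cliffRight_sub_mul_mem hB w hcj))

end Clifford

/-! ## Twisting by a convolution invertible map -/

section Twist

open WithConv Coalgebra

variable {F : Type*} [Field F] {H : Type*} [Ring H] [Bialgebra F H] {C : Type*} [Ring C]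
  [Algebra F C]

/-- The map `c ⊗ h ↦ c φ(h₍₁₎) ⊗ h₍₂₎`. -/
def twist (φ : WithConv (H →ₗ[F] C)) : C ⊗[F] H →ₗ[F] C ⊗[F] H :=
  LinearMap.mul' F (C ⊗[F] H) ∘ₗ TensorProduct.map
    (Algebra.TensorProduct.includeLeft : C →ₐ[F] C ⊗[F] H).toLinearMap
    (φ.ofConv.rTensor H ∘ₗ comul)

theorem twist_tmul (φ : WithConv (H →ₗ[F] C)) (c : C) (h : H) :
    twist φ (c ⊗ₜ h) = (c ⊗ₜ 1) * φ.ofConv.rTensor H (comul h) := rfl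

theorem twist_mul (φ : WithConv (H →ₗ[F] C)) (c : C) (y : C ⊗[F] H) :
    twist φ ((c ⊗ₜ 1) * y) = (c ⊗ₜ 1) * twist φ y := by
  induction y with
  | zero => simp
  | tmul a h =>
    rw [Algebra.TensorProduct.tmul_mul_tmul, one_mul, twist_tmul, twist_tmul, ← mul_assoc,
      Algebra.TensorProduct.tmul_mul_tmul, one_mul]
  | add x y hx hy => rw [mul_add, map_add, hx, hy, map_add, mul_add]

/-- Coassociativity makes twisting an action of the convolution algebra, so a convolution inverse
yields an inverse map. -/
theorem twist_twist (φ ψ : WithConv (H →ₗ[F] C)) (y : C ⊗[F] H) :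
    twist ψ (twist φ y) = twist (φ * ψ) y := by
  induction y with
  | zero => simp
  | add x y hx hy => simp only [map_add, hx, hy]
  | tmul c h =>
    rw [twist_tmul, twist_mul, twist_tmul]
    congr 1
    set G : H ⊗[F] (H ⊗[F] H) →ₗ[F] C ⊗[F] H :=
      (LinearMap.mul' F C ∘ₗ TensorProduct.map φ.ofConv ψ.ofConv).rTensor H ∘ₗ
        (TensorProduct.assoc F H H H).symm.toLinearMap with hG
    have h1 : ∀ z : H ⊗[F] H, twist ψ (φ.ofConv.rTensor H z) = G ((comul (R := F)).lTensor H z) := by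
      intro z
      induction z with
      | zero => simp
      | add x y hx hy => simp only [map_add, hx, hy]
      | tmul x y =>
        rw [LinearMap.rTensor_tmul, twist_tmul, LinearMap.lTensor_tmul]
        generalize (comul y : H ⊗[F] H) = z
        induction z with
        | zero => simp
        | add x y hx hy => simp only [map_add, hx, hy, TensorProduct.tmul_add, mul_add]
        | tmul y z => simp [hG]
    have h2 : (φ * ψ).ofConv = LinearMap.mul' F C ∘ₗ TensorProduct.map φ.ofConv ψ.ofConv ∘ₗ comul := by
      ext x
      exact LinearMap.convMul_apply φ ψ x
    rw [h1, ← coassoc_apply, h2, hG, LinearMap.comp_apply, LinearEquiv.coe_coe,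
      LinearEquiv.symm_apply_apply, ← LinearMap.comp_assoc, LinearMap.rTensor_comp_apply,
      LinearMap.rTensor_comp_apply]
    rw [LinearMap.rTensor_comp_apply]

theorem twist_one (y : C ⊗[F] H) : twist (1 : WithConv (H →ₗ[F] C)) y = y := by
  induction y with
  | zero => simp
  | add x y hx hy => simp only [map_add, hx, hy]
  | tmul c h =>
    have : (1 : WithConv (H →ₗ[F] C)).ofConv = Algebra.linearMap F C ∘ₗ counit := rfl
    rw [twist_tmul, this, LinearMap.rTensor_comp_apply, rTensor_counit_comul]
    simp

/-- Twisting by a convolution invertible map is bijective. -/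
def twistEquiv (φ ψ : WithConv (H →ₗ[F] C)) (h : φ * ψ = 1) (h' : ψ * φ = 1) :
    (C ⊗[F] H) ≃ₗ[F] (C ⊗[F] H) :=
  LinearEquiv.ofLinearMap (twist φ) (twist ψ)
    (LinearMap.ext fun y => by rw [LinearMap.comp_apply, twist_twist, h', twist_one]; rfl)
    (LinearMap.ext fun y => by rw [LinearMap.comp_apply, twist_twist, h, twist_one]; rfl)

end Twist

/-! ### A coalgebra section of the pin cover and the twist it defines -/

section Section

open WithConv Coalgebra

variable {F : Type*} [Field F] {H : Type*} [Ring H] [HopfAlgebra F H]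
  {Ht : Type*} [Ring Ht] [HopfAlgebra F Ht]

/-- One of the two copies of `H` is mapped bijectively by `π`, and its inclusion is corrected by the
inverse of that bijection. The section respects comultiplication but need not be multiplicative. -/
theorem IsDoubleCover.exists_section {π : Ht →ₐc[F] H} (h : IsDoubleCover π) :
    ∃ j : H →ₗc[F] Ht, ∀ x, π (j x) = x := by
  obtain ⟨e, he, -⟩ := h.split
  set i : H →ₗc[F] H × H :=
    { LinearMap.inl F H H with
      counit_comp := by ext; simp
      map_comp_comul := by ext; simp } with hi
  set β : H →ₗc[F] H := (π : Ht →ₗc[F] H).comp ((e : H × H →ₗc[F] Ht).comp i) with hβ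
  have hb : Function.Bijective β := he
  refine ⟨((e : H × H →ₗc[F] Ht).comp i).comp (CoalgEquiv.ofBijective hb).symm, fun x => ?_⟩
  exact (CoalgEquiv.ofBijective hb).apply_symm_apply x

variable {C : Type*} [Ring C] [Algebra F C] (j : H →ₗc[F] Ht) (γ : Ht →ₐ[F] C)

/-- Convolution inverses only involve the coalgebra structure of the source, so the antipode of `Ht`
provides one although `j` need not be multiplicative. -/
theorem conv_mul_antipode : (toConv (γ.toLinearMap ∘ₗ j.toLinearMap) : WithConv (H →ₗ[F] C)) *
    toConv (γ.toLinearMap ∘ₗ HopfAlgebra.antipode F ∘ₗ j.toLinearMap) = 1 := by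
  ext h
  have h1 : ∀ z : H ⊗[F] H, LinearMap.mul' F C (TensorProduct.map (γ.toLinearMap ∘ₗ j.toLinearMap)
      (γ.toLinearMap ∘ₗ HopfAlgebra.antipode F ∘ₗ j.toLinearMap) z) =
      γ (LinearMap.mul' F Ht ((HopfAlgebra.antipode F).lTensor Ht
        (TensorProduct.map j.toLinearMap j.toLinearMap z))) := by
    intro z
    induction z with
    | zero => simp
    | add x y hx hy => simp only [map_add, hx, hy]
    | tmul x y => simp
  refine (LinearMap.convMul_apply _ _ h).trans ((h1 _).trans ?_)
  have h2 : TensorProduct.map j.toLinearMap j.toLinearMap (comul h) = comul (R := F) (j h) :=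
    CoalgHomClass.map_comp_comul_apply j h
  rw [h2, HopfAlgebra.mul_antipode_lTensor_comul_apply, AlgHom.commutes,
    CoalgHomClass.counit_comp_apply]
  rfl

theorem conv_antipode_mul : toConv (γ.toLinearMap ∘ₗ HopfAlgebra.antipode F ∘ₗ j.toLinearMap) *
    (toConv (γ.toLinearMap ∘ₗ j.toLinearMap) : WithConv (H →ₗ[F] C)) = 1 := by
  ext h
  have h1 : ∀ z : H ⊗[F] H, LinearMap.mul' F C (TensorProduct.map
      (γ.toLinearMap ∘ₗ HopfAlgebra.antipode F ∘ₗ j.toLinearMap)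
      (γ.toLinearMap ∘ₗ j.toLinearMap) z) =
      γ (LinearMap.mul' F Ht ((HopfAlgebra.antipode F).rTensor Ht
        (TensorProduct.map j.toLinearMap j.toLinearMap z))) := by
    intro z
    induction z with
    | zero => simp
    | add x y hx hy => simp only [map_add, hx, hy]
    | tmul x y => simp
  refine (LinearMap.convMul_apply _ _ h).trans ((h1 _).trans ?_)
  have h2 : TensorProduct.map j.toLinearMap j.toLinearMap (comul h) = comul (R := F) (j h) :=
    CoalgHomClass.map_comp_comul_apply j h
  rw [h2, HopfAlgebra.mul_antipode_rTensor_comul_apply, AlgHom.commutes,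
    CoalgHomClass.counit_comp_apply]
  rfl

variable {V : Type*} [AddCommGroup V] [Module F V] {B : LinearMap.BilinForm F V}

/-- The reason for the twist: it turns the factor `H` into the diagonal copy of `H` in `H ⊗ C`.
Cocommutativity matches the order of the two legs. -/
theorem comm_twist_eq [IsCocomm F H] {π : Ht →ₐc[F] H} {j : H →ₗc[F] Ht} (hj : ∀ x, π (j x) = x)
    (γ : Ht →ₐ[F] Cliff B) (c : Cliff B) (h : H) :
    TensorProduct.comm F _ _ (twist (toConv (γ.toLinearMap ∘ₗ j.toLinearMap)) (c ⊗ₜ h)) =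
      (1 ⊗ₜ c) * diag π γ (j h) := by
  have h1 : ∀ z : H ⊗[F] H, TensorProduct.comm F (Cliff B) H ((c ⊗ₜ 1) *
      (γ.toLinearMap ∘ₗ j.toLinearMap).rTensor H z) =
      (1 ⊗ₜ c) * Algebra.TensorProduct.map (π : Ht →ₐ[F] H) γ
        (TensorProduct.map j.toLinearMap j.toLinearMap (TensorProduct.comm F H H z)) := by
    intro z
    induction z with
    | zero => simp
    | add x y hx hy => simp only [map_add, mul_add, hx, hy]
    | tmul x y => simp [hj]
  have h2 : TensorProduct.map j.toLinearMap j.toLinearMap (comul h) = comul (R := F) (j h) :=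
    CoalgHomClass.map_comp_comul_apply j h
  rw [twist_tmul, ofConv_toConv, h1, comm_comul, h2]
  rfl

end Section

/-! ## Supercommutators with an operator that is almost inverted by a filtered homotopy -/

section SuperCommutator

variable {F : Type*} [Field F] {R : Type*} [Ring R] [Algebra F R] (θ : R →ₐ[F] R) (Q : Submodule F R)
  (D : R)

/-- The supercommutator with an odd element `D`, for the involution `θ` of `R`. -/
def superComm : Module.End F R := LinearMap.mulLeft F D - LinearMap.mulRight F D ∘ₗ θ.toLinearMap

theorem superComm_apply (a : R) : superComm θ D a = D * a - θ a * D := rfl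

/-- The elements of parity `i` that commute with `Q`, up to the sign `(-1)^i` on the odd part
of `Q`. -/
def superCentralizer (i : ZMod 2) : Submodule F R where
  carrier := {a | θ a = sgn F i • a ∧ ∀ q ∈ Q, q * a = a * (if i = 0 then q else θ q)}
  zero_mem' := ⟨by simp, fun q _ => by simp⟩
  add_mem' := fun ha hb => ⟨by rw [map_add, ha.1, hb.1, smul_add],
    fun q hq => by rw [mul_add, ha.2 q hq, hb.2 q hq, add_mul]⟩
  smul_mem' := fun c a ha => ⟨by rw [map_smul, ha.1, smul_comm],
    fun q hq => by rw [mul_smul_comm, ha.2 q hq, smul_mul_assoc]⟩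

variable {θ Q D}

theorem mem_superCentralizer_zero {a : R} :
    a ∈ superCentralizer θ Q 0 ↔ θ a = a ∧ ∀ q ∈ Q, q * a = a * q := by
  simp [superCentralizer, sgn]

theorem mem_superCentralizer_one {a : R} :
    a ∈ superCentralizer θ Q 1 ↔ θ a = -a ∧ ∀ q ∈ Q, q * a = a * θ q := by
  simp [superCentralizer, sgn, ZMod.val_one]

theorem zmod_two_cases (i : ZMod 2) : i = 0 ∨ i = 1 := by
  revert i
  decide

/-- Used for both the differential and its homotopy: the two are odd, linear over `Q` on the right,
and linear over `Q` on the left up to `θ`. -/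
theorem map_mem_superCentralizer {f : R →ₗ[F] R} (hθθ : ∀ a, θ (θ a) = a) (hθQ : ∀ q ∈ Q, θ q ∈ Q)
    (hfθ : ∀ a, f (θ a) = -θ (f a)) (hr : ∀ a, ∀ q ∈ Q, f (a * q) = f a * q)
    (hl : ∀ a, ∀ q ∈ Q, f (q * a) = θ q * f a) {i : ZMod 2} {a : R}
    (ha : a ∈ superCentralizer θ Q i) : f a ∈ superCentralizer θ Q (i + 1) := by
  rcases zmod_two_cases i with rfl | rfl
  · rw [mem_superCentralizer_zero] at ha
    rw [zero_add, mem_superCentralizer_one]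
    refine ⟨by rw [← neg_eq_iff_eq_neg, ← hfθ, ha.1], fun q hq => ?_⟩
    rw [← hθθ q, ← hl _ _ (hθQ q hq), ha.2 _ (hθQ q hq), hr _ _ (hθQ q hq), hθθ]
  · rw [mem_superCentralizer_one] at ha
    rw [show (1 + 1 : ZMod 2) = 0 from rfl, mem_superCentralizer_zero]
    refine ⟨by rw [← neg_inj, ← hfθ, ha.1, map_neg], fun q hq => ?_⟩
    nth_rw 1 [← hθθ q]
    rw [← hl _ _ (hθQ q hq), ha.2 _ (hθQ q hq), hθθ, hr _ _ hq]

theorem superComm_θ (hθθ : ∀ a, θ (θ a) = a) (hD : θ D = -D) (a : R) :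
    superComm θ D (θ a) = -θ (superComm θ D a) := by
  simp only [superComm_apply, map_sub, map_mul, hD, hθθ]
  noncomm_ring

theorem superComm_mul_right (hDQ : ∀ q ∈ Q, D * q = θ q * D) (a : R) {q : R} (hq : q ∈ Q) :
    superComm θ D (a * q) = superComm θ D a * q := by
  rw [superComm_apply, superComm_apply, map_mul, mul_assoc (θ a), ← hDQ q hq]
  noncomm_ring

theorem superComm_mul_left (hDQ : ∀ q ∈ Q, D * q = θ q * D) (a : R) {q : R} (hq : q ∈ Q) :
    superComm θ D (q * a) = θ q * superComm θ D a := by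
  rw [superComm_apply, superComm_apply, map_mul, ← mul_assoc, hDQ q hq]
  noncomm_ring

/-- Since `D` is odd, the square of the supercommutator is the ordinary commutator with `D²`. An
even element of `Q` commutes with elements of either parity in the supercentralizer. -/
theorem superComm_superComm (hθθ : ∀ a, θ (θ a) = a) (hD : θ D = -D) {i : ZMod 2}
    (hDD : ∃ z ∈ Subalgebra.center F R, ∃ q ∈ Q, θ q = q ∧ D ^ 2 = z + q) {a : R}
    (ha : a ∈ superCentralizer θ Q i) : superComm θ D (superComm θ D a) = 0 := by
  obtain ⟨z, hz, q, hq, hθq, hz'⟩ := hDD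
  have h1 : q * a = a * q := by
    have := ha.2 q hq
    rwa [hθq, ite_self] at this
  have h2 : D ^ 2 * a = a * D ^ 2 := by
    rw [hz', add_mul, mul_add, h1, Subalgebra.mem_center_iff.1 hz a]
  have h3 : superComm θ D (superComm θ D a) = D ^ 2 * a - a * D ^ 2 := by
    simp only [superComm_apply, map_sub, map_mul, hθθ, hD]
    noncomm_ring
  rw [h3, h2, sub_self]

end SuperCommutator

/-! ### Successive approximation by a filtered homotopy -/

section Homotopy

variable {F : Type*} [Field F] [CharZero F] {R : Type*} [AddCommGroup R] [Module F R]
  (d s : Module.End F R) (X : ZMod 2 → Submodule F R) (Q : Submodule F R)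
  (𝓡 : ℕ → Submodule F R) (𝓖 : ℕ → ℕ → Submodule F R)

/-- `s` is a homotopy for `d` which is an isomorphism on the associated graded object in positive
degrees. -/
structure IsFilteredHomotopy : Prop where
  map_d : ∀ i, ∀ a ∈ X i, d a ∈ X (i + 1)
  map_s : ∀ i, ∀ a ∈ X i, s a ∈ X (i + 1)
  d_d : ∀ i, ∀ a ∈ X i, d (d a) = 0
  zero : 𝓡 0 = ⊥
  exists_mem : ∀ a, ∃ n, a ∈ 𝓡 n
  le_succ : ∀ n, 𝓡 n ≤ 𝓡 (n + 1)
  zero_le : ∀ n, 𝓖 n 0 ≤ 𝓡 n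
  le : ∀ n j, 𝓡 n ≤ 𝓖 n j
  exists_mem_succ : ∀ n, ∀ a ∈ 𝓡 (n + 1), ∃ j, a ∈ 𝓖 n j
  le_right : ∀ n j, 𝓖 n j ≤ 𝓡 (n + 1)
  s_mem : ∀ n, ∀ a ∈ 𝓡 (n + 1), s a ∈ 𝓡 n
  laplace : ∀ n j, ∀ a ∈ 𝓖 n (j + 1), d (s a) + s (d a) - (4 * (n + j) : F) • a ∈ 𝓖 n j
  base : ∀ a ∈ 𝓡 1, d a ∈ 𝓡 1 → a ∈ Q
  Q_le : Q ≤ 𝓡 1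
  d_Q : ∀ a ∈ Q, d a = 0

variable {d s X Q 𝓡 𝓖} (h : IsFilteredHomotopy d s X Q 𝓡 𝓖)
include h

omit [CharZero F] in
theorem IsFilteredHomotopy.mono : Monotone 𝓡 := monotone_nat_of_le_succ h.le_succ

/-- In the application `𝓡 n` consists of degree less than `n` in `A`, and `𝓖 n j` restricts the
degree `n` part to Clifford degree less than `j`. The differential usually raises the degree by one,
so the hypothesis on `d a` says that the leading term of `a` is a cocycle. One lowers the Clifford
degree of the leading term step by step. -/
theorem IsFilteredHomotopy.exists_sub_mem {n : ℕ} (hn : 1 ≤ n) {i : ZMod 2} {a : R} (ha : a ∈ X i)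
    (han : a ∈ 𝓡 (n + 1)) (hda : d a ∈ 𝓡 (n + 1)) :
    ∃ b ∈ X (i + 1), b ∈ 𝓡 n ∧ a - d b ∈ 𝓡 n := by
  obtain ⟨j, hj⟩ := h.exists_mem_succ n a han
  clear han
  induction j generalizing a with
  | zero => exact ⟨0, zero_mem _, zero_mem _, by rw [map_zero, sub_zero]; exact h.zero_le n hj⟩
  | succ j ih =>
    -- The eigenvalue of the Laplacian on the leading term, nonzero because `n ≥ 1`. Since `s (d a)`
    -- already has lower degree, `c⁻¹ • s a` is a primitive of `a` up to `𝓖 n j`.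
    set c : F := 4 * (n + j) with hc
    have hc0 : c ≠ 0 := by
      have : ((4 * (n + j) : ℕ) : F) ≠ 0 := Nat.cast_ne_zero.2 (by omega)
      rw [hc]
      exact_mod_cast this
    have h1 : c⁻¹ • s a ∈ X (i + 1) := Submodule.smul_mem _ _ (h.map_s i a ha)
    have h2 : c⁻¹ • s a ∈ 𝓡 n := Submodule.smul_mem _ _ (h.s_mem n a (h.le_right n _ hj))
    have h3 : i + 1 + 1 = i := by
      rw [add_assoc, show (1 + 1 : ZMod 2) = 0 from rfl, add_zero]
    have h4 : a - d (c⁻¹ • s a) ∈ 𝓖 n j := by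
      have h5 := sub_mem (h.laplace n j a hj) (h.le n j (h.s_mem n _ hda))
      rw [← hc] at h5
      have h6 : a - d (c⁻¹ • s a) = -(c⁻¹ • (d (s a) + s (d a) - c • a - s (d a))) := by
        rw [map_smul, smul_sub, smul_sub, smul_add, inv_smul_smul₀ hc0]
        abel
      rw [h6]
      exact neg_mem (Submodule.smul_mem _ _ h5)
    have h5 : a - d (c⁻¹ • s a) ∈ X i := sub_mem ha (by
      have := h.map_d _ _ h1
      rwa [h3] at this)
    have h6 : d (a - d (c⁻¹ • s a)) = d a := by rw [map_sub, h.d_d _ _ h1, sub_zero]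
    obtain ⟨b, hb, hb', hb''⟩ := ih h5 (h6.symm ▸ hda) h4
    refine ⟨b + c⁻¹ • s a, add_mem hb h1, add_mem hb' h2, ?_⟩
    rwa [map_add, add_comm, ← sub_sub]

theorem IsFilteredHomotopy.exists_eq_add {i : ZMod 2} {a : R} (ha : a ∈ X i) (hda : d a ∈ 𝓡 1) :
    ∃ q ∈ Q, ∃ b ∈ X (i + 1), a = q + d b := by
  obtain ⟨n, hn⟩ := h.exists_mem a
  induction n generalizing a with
  | zero =>
    rw [h.zero] at hn
    exact ⟨0, zero_mem _, 0, zero_mem _, by rw [map_zero, add_zero]; exact hn⟩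
  | succ n ih =>
    rcases n with _ | n
    · exact ⟨a, h.base a hn hda, 0, zero_mem _, by rw [map_zero, add_zero]⟩
    · obtain ⟨b, hb, -, hb'⟩ := h.exists_sub_mem n.succ_pos ha hn
        (h.mono (Nat.succ_le_succ (Nat.zero_le _)) hda)
      have h3 : i + 1 + 1 = i := by
        rw [add_assoc, show (1 + 1 : ZMod 2) = 0 from rfl, add_zero]
      have h5 : a - d b ∈ X i := sub_mem ha (by
        have := h.map_d _ _ hb
        rwa [h3] at this)
      have h6 : d (a - d b) = d a := by rw [map_sub, h.d_d _ _ hb, sub_zero]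
      obtain ⟨q, hq, c, hc, hac⟩ := ih h5 (h6.symm ▸ hda) hb'
      exact ⟨q, hq, c + b, add_mem hc hb, by rw [map_add, ← add_assoc, ← hac, sub_add_cancel]⟩

/-- The decomposition applies to `a` itself, because `d a` lies in `Q` and so in degree zero; `d`
kills both of its terms. -/
theorem IsFilteredHomotopy.d_eq_zero {i : ZMod 2} {a : R} (ha : a ∈ X i) (hda : d a ∈ Q) :
    d a = 0 := by
  obtain ⟨q, hq, b, hb, rfl⟩ := h.exists_eq_add ha (h.Q_le hda)
  rw [map_add, h.d_Q q hq, h.d_d _ b hb, add_zero]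

end Homotopy

/-! ## The diagonal map and the Dirac element -/

section HopfPrelim

variable {F : Type*} [Field F] {K : Type*} [Ring K] [HopfAlgebra F K]

theorem sgn_zero : sgn F 0 = 1 := by simp [sgn]

theorem sgn_one : sgn F 1 = -1 := by simp [sgn, ZMod.val_one]

theorem sgn_add (i j : ZMod 2) : sgn F (i + j) = sgn F i * sgn F j := by
  rcases zmod_two_cases i with rfl | rfl <;> rcases zmod_two_cases j with rfl | rfl
  all_goals simp [sgn_zero, sgn_one, show (1 + 1 : ZMod 2) = 0 from rfl]

theorem sgn_mul_self (i : ZMod 2) : sgn F i * sgn F i = 1 := by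
  rcases zmod_two_cases i with rfl | rfl <;> simp [sgn_zero, sgn_one]

theorem IsPrimitiveElem.counit_eq_zero {x : K} (hx : IsPrimitiveElem F x) :
    Coalgebra.counit (R := F) x = 0 := by
  have h1 := Coalgebra.rTensor_counit_comul (R := F) x
  rw [show (Coalgebra.comul x : K ⊗[F] K) = 1 ⊗ₜ[F] x + x ⊗ₜ[F] 1 from hx, map_add,
    LinearMap.rTensor_tmul, LinearMap.rTensor_tmul, Bialgebra.counit_one, add_eq_left] at h1
  have h2 := congrArg ((TensorProduct.lid F F).toLinearMap ∘ₗ (Coalgebra.counit (R := F)).lTensor F) h1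
  simpa using h2

theorem IsPrimitiveElem.antipode_eq_neg {x : K} (hx : IsPrimitiveElem F x) :
    HopfAlgebra.antipode F x = -x := by
  have h1 := HopfAlgebra.mul_antipode_rTensor_comul_apply (R := F) x
  rw [show (Coalgebra.comul x : K ⊗[F] K) = 1 ⊗ₜ[F] x + x ⊗ₜ[F] 1 from hx, hx.counit_eq_zero] at h1
  simp at h1
  exact eq_neg_of_add_eq_zero_right h1

variable {R : Type*} [Ring R] [Algebra F R] (f : K →ₐ[F] R)

theorem adAct_groupLike {g : K} (hg : IsGroupLikeElem F g) (r : R) :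
    adAct f g r = f g * r * f (HopfAlgebra.antipode F g) := by
  simp [adAct, hg.comul_eq_tmul_self, mul_assoc]

theorem adAct_primitive {x : K} (hx : IsPrimitiveElem F x) (r : R) :
    adAct f x r = f x * r - r * f x := by
  rw [adAct, LinearMap.comp_apply, LinearMap.comp_apply,
    show (Coalgebra.comul x : K ⊗[F] K) = 1 ⊗ₜ[F] x + x ⊗ₜ[F] 1 from hx]
  simp [hx.antipode_eq_neg]
  abel

theorem IsPointed.eq_top [CharZero F] [Coalgebra.IsCocomm F K] (hK : IsPointed F K)
    (S : Subalgebra F K) (hg : ∀ g, IsGroupLikeElem F g → g ∈ S)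
    (hx : ∀ x, IsPrimitiveElem F x → x ∈ S) : S = ⊤ := by
  rw [eq_top_iff, ← groupPrimitiveSubalgebra_eq_top hK]
  exact Algebra.adjoin_le (Set.union_subset hg hx)

variable {V : Type*} [AddCommGroup V] [Module F V] {ρ : K →ₐ[F] Module.End F V}
  {B : LinearMap.BilinForm F V}

/-- Invariance makes `ρ g` an isometry, and the Gram determinant cancels. It follows that every
group-like element is homogeneous. -/
theorem IsOrthogonal.det_eq [FiniteDimensional F V] (hB : IsOrthogonal ρ B) {g : K}
    (hg : IsGroupLikeElem F g) : LinearMap.det (ρ g) = 1 ∨ LinearMap.det (ρ g) = -1 := by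
  have h1 : B.comp (ρ g) (ρ g) = B := by
    ext v w
    rw [LinearMap.BilinForm.comp_apply, hB.invariant, ← Module.End.mul_apply, ← map_mul,
      hg.antipode_mul_cancel, map_one, Module.End.one_apply]
  have h2 : LinearMap.det (ρ g) * LinearMap.det (ρ g) = 1 := by
    set b := Module.finBasis F V
    have h3 := congrArg (fun B' => (LinearMap.BilinForm.toMatrix b B').det) h1
    simp only [LinearMap.BilinForm.toMatrix_comp b b, Matrix.det_mul, Matrix.det_transpose,
      LinearMap.det_toMatrix] at h3
    have h4 := (LinearMap.BilinForm.nondegenerate_iff_det_ne_zero b).1 hB.nondegenerate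
    refine mul_right_cancel₀ h4 ?_
    rw [one_mul]
    linear_combination h3
  exact mul_self_eq_one_iff.1 h2

end HopfPrelim

/-! ### The image of the diagonal map and its parity -/

section Diag

variable {F : Type*} [Field F] {H : Type*} [Ring H] [HopfAlgebra F H]
  {V : Type*} [AddCommGroup V] [Module F V]
  (ρ : H →ₐ[F] Module.End F V) (κ : V [⋀^Fin 2]→ₗ[F] H) {B : LinearMap.BilinForm F V}
  {Ht : Type*} [Ring Ht] [HopfAlgebra F Ht] (π : Ht →ₐc[F] H) (γ : Ht →ₐ[F] Cliff B)

variable (B) in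
/-- The involution of `A ⊗ C` whose eigenspaces are the homogeneous subspaces of the gradation
inherited from `C`. -/
def acInvolute : AC ρ κ B →ₐ[F] AC ρ κ B :=
  Algebra.TensorProduct.map (AlgHom.id F _) CliffordAlgebra.involute

theorem acInvolute_tmul (a : HeckeAlgebra ρ κ) (c : Cliff B) :
    acInvolute ρ κ B (a ⊗ₜ c) = a ⊗ₜ CliffordAlgebra.involute c := rfl

theorem acInvolute_acInvolute (a : AC ρ κ B) : acInvolute ρ κ B (acInvolute ρ κ B a) = a := by
  induction a using TensorProduct.induction_on with
  | zero => simp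
  | tmul a c => simp [acInvolute_tmul]
  | add x y hx hy => rw [map_add, map_add, hx, hy]

theorem isPrimitiveElem_map {x : Ht} (hx : IsPrimitiveElem F x) : IsPrimitiveElem F (π x) := by
  have h := CoalgHomClass.map_comp_comul_apply π x
  rw [show (Coalgebra.comul x : Ht ⊗[F] Ht) = 1 ⊗ₜ[F] x + x ⊗ₜ[F] 1 from hx] at h
  rw [IsPrimitiveElem, ← h]
  simp

theorem diagAC_groupLike {g : Ht} (hg : IsGroupLikeElem F g) :
    diagAC ρ κ π γ g = heckeH ρ κ (π g) ⊗ₜ γ g := by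
  simp [diagAC, diag, hg.comul_eq_tmul_self]

theorem diagAC_primitive {x : Ht} (hx : IsPrimitiveElem F x) :
    diagAC ρ κ π γ x = 1 ⊗ₜ γ x + heckeH ρ κ (π x) ⊗ₜ 1 := by
  simp [diagAC, diag, show (Coalgebra.comul x : Ht ⊗[F] Ht) = 1 ⊗ₜ[F] x + x ⊗ₜ[F] 1 from hx]

theorem involute_eq_sgn_smul {i : ZMod 2} {c : Cliff B} (hc : c ∈ cliffParity B i) :
    CliffordAlgebra.involute c = sgn F i • c := by
  rcases zmod_two_cases i with rfl | rfl
  · rw [CliffordAlgebra.involute_eq_of_mem_even hc, sgn_zero, one_smul]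
  · rw [CliffordAlgebra.involute_eq_of_mem_odd hc, sgn_one, neg_one_smul]

variable {ρ π γ} (hpin : IsPinCover ρ B π γ)
include hpin

theorem IsPinCover.involute_eq {i : ZMod 2} {h : Ht} (hh : IsHomogeneousProduct (pullRep ρ π) i h) :
    CliffordAlgebra.involute (γ h) = sgn F i • γ h :=
  involute_eq_sgn_smul (hpin.map_parity i h (Submodule.subset_span hh))

theorem IsPinCover.compat_groupLike {i : ZMod 2} {g : Ht} (hg : IsGroupLikeElem F g)
    (hi : IsHomogeneousProduct (pullRep ρ π) i g) (v : V) :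
    sgn F i • (cliffV B (ρ (π g) v) * γ g) = γ g * cliffV B v := by
  rw [← smul_mul_assoc, hpin.compat i g (Submodule.subset_span hi), adAct_groupLike γ hg,
    mul_assoc, ← map_mul, hg.antipode_mul_cancel, map_one, mul_one]

theorem IsPinCover.compat_primitive {x : Ht} (hx : IsPrimitiveElem F x) (v : V) :
    cliffV B (ρ (π x) v) = γ x * cliffV B v - cliffV B v * γ x := by
  rw [← adAct_primitive γ hx, ← hpin.compat 0 x (Submodule.subset_span (.primitive x hx)), sgn_zero,
    one_smul]

theorem IsPinCover.acInvolute_diagAC {i : ZMod 2} {h : Ht}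
    (hh : IsHomogeneousProduct (pullRep ρ π) i h) :
    acInvolute ρ κ B (diagAC ρ κ π γ h) = sgn F i • diagAC ρ κ π γ h := by
  have hgl : ∀ (i : ZMod 2) (g : Ht), IsHomogeneousProduct (pullRep ρ π) i g → IsGroupLikeElem F g →
      acInvolute ρ κ B (diagAC ρ κ π γ g) = sgn F i • diagAC ρ κ π γ g := by
    intro i g hi hg
    rw [diagAC_groupLike ρ κ π γ hg, acInvolute_tmul, hpin.involute_eq hi, TensorProduct.tmul_smul]
  induction hh with
  | groupLike_even g hg hdet => exact hgl 0 g (.groupLike_even g hg hdet) hg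
  | groupLike_odd g hg hdet => exact hgl 1 g (.groupLike_odd g hg hdet) hg
  | primitive x hx =>
    rw [diagAC_primitive ρ κ π γ hx, map_add, acInvolute_tmul, acInvolute_tmul,
      hpin.involute_eq (.primitive x hx), sgn_zero, one_smul, one_smul, map_one]
  | mul i j a b _ _ ha hb =>
    rw [map_mul, map_mul, ha, hb, sgn_add, smul_mul_smul_comm]

omit hpin in
theorem IsOrthogonal.isHomogeneousProduct [FiniteDimensional F V] (hB : IsOrthogonal ρ B) {g : Ht}
    (hg : IsGroupLikeElem F g) : ∃ i, IsHomogeneousProduct (pullRep ρ π) i g := by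
  rcases hB.det_eq (hg.map π) with h | h
  · exact ⟨0, .groupLike_even g hg h⟩
  · exact ⟨1, .groupLike_odd g hg h⟩

/-- To check a multiplicative property of all elements of a pin cover, it suffices to check it on
the homogeneous generators. -/
theorem IsPinCover.eq_top [CharZero F] [FiniteDimensional F V] (hB : IsOrthogonal ρ B)
    (S : Subalgebra F Ht)
    (hg : ∀ i g, IsGroupLikeElem F g → IsHomogeneousProduct (pullRep ρ π) i g → g ∈ S)
    (hx : ∀ x, IsPrimitiveElem F x → x ∈ S) (h : Ht) : h ∈ S := by
  have := hpin.cocomm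
  rw [hpin.pointed.eq_top S (fun g hg' => ?_) hx]
  · exact Algebra.mem_top
  · obtain ⟨i, hi⟩ := hB.isHomogeneousProduct hg'
    exact hg i g hg' hi

theorem IsPinCover.acInvolute_mem [CharZero F] [FiniteDimensional F V] (hB : IsOrthogonal ρ B)
    (h : Ht) : acInvolute ρ κ B (diagAC ρ κ π γ h) ∈ (diagAC ρ κ π γ).range := by
  refine hpin.eq_top hB ((diagAC ρ κ π γ).range.comap
    ((acInvolute ρ κ B).comp (diagAC ρ κ π γ))) (fun i g _ hi => ?_) (fun x hx => ?_) h
  · rw [Subalgebra.mem_comap, AlgHom.comp_apply, hpin.acInvolute_diagAC κ hi]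
    exact Subalgebra.smul_mem _ (AlgHom.mem_range_self _ g) _
  · rw [Subalgebra.mem_comap, AlgHom.comp_apply, hpin.acInvolute_diagAC κ (.primitive x hx)]
    exact Subalgebra.smul_mem _ (AlgHom.mem_range_self _ x) _

end Diag

/-! ### Commutation of the Dirac element with the diagonal image -/

section Dirac

variable {F : Type*} [Field F] {H : Type*} [Ring H] [HopfAlgebra F H]
  {V : Type*} [AddCommGroup V] [Module F V]
  (ρ : H →ₐ[F] Module.End F V) (κ : V [⋀^Fin 2]→ₗ[F] H) {B : LinearMap.BilinForm F V}
  {ι : Type*} [Fintype ι] [DecidableEq ι] (hnd : B.Nondegenerate) (b : Module.Basis ι F V)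

theorem acInvolute_dirac : acInvolute ρ κ B (dirac ρ κ B hnd b) = -dirac ρ κ B hnd b := by
  rw [dirac, map_sum, ← Finset.sum_neg_distrib]
  refine Finset.sum_congr rfl fun k _ => ?_
  rw [acInvolute_tmul, CliffordAlgebra.involute_ι, TensorProduct.tmul_neg]

/-- An operator can be moved across the canonical tensor `∑ v_k ⊗ v^k` to its adjoint, since both
have the same matrix in dual bases. -/
theorem sum_dualBasis_adjoint (hB : B.IsSymm) {W : Type*} [AddCommGroup W] [Module F W]
    (f : V →ₗ[F] V →ₗ[F] W) {T T' : V →ₗ[F] V} (hT : ∀ v w, B (T v) w = B v (T' w)) :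
    ∑ k, f (T (b k)) (B.dualBasis hnd b k) = ∑ k, f (b k) (T' (B.dualBasis hnd b k)) := by
  have h1 : ∀ k, T (b k) = ∑ l, B (T (b k)) (B.dualBasis hnd b l) • b l := fun k => by
    conv_lhs => rw [← sum_apply_dualBasis_smul hnd b (T (b k))]
    simp_rw [hB.eq _ (T (b k))]
  have h2 : ∀ l, T' (B.dualBasis hnd b l) =
      ∑ k, B (T (b k)) (B.dualBasis hnd b l) • B.dualBasis hnd b k := fun l => by
    conv_lhs => rw [← sum_apply_smul_dualBasis hnd b hB (T' _)]
    simp_rw [hT]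
  rw [Finset.sum_congr rfl fun k _ => by rw [h1 k],
    Finset.sum_congr (s₁ := Finset.univ) (f := fun k => f (b k) _) rfl fun k _ => by rw [h2 k]]
  simp only [map_sum, map_smul, LinearMap.sum_apply, LinearMap.smul_apply]
  exact Finset.sum_comm

variable {Ht : Type*} [Ring Ht] [HopfAlgebra F Ht] {π : Ht →ₐc[F] H} {γ : Ht →ₐ[F] Cliff B}
  {ρ} (hpin : IsPinCover ρ B π γ) (hB : IsOrthogonal ρ B)
include hpin hB

theorem IsPinCover.dirac_mul_groupLike {i : ZMod 2} {g : Ht} (hg : IsGroupLikeElem F g)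
    (hi : IsHomogeneousProduct (pullRep ρ π) i g) :
    dirac ρ κ B hnd b * diagAC ρ κ π γ g =
      sgn F i • (diagAC ρ κ π γ g * dirac ρ κ B hnd b) := by
  have hg' : IsGroupLikeElem F (π g) := hg.map π
  set f : V →ₗ[F] V →ₗ[F] AC ρ κ B := LinearMap.compl₁₂ (TensorProduct.mk F _ _)
    (LinearMap.mulRight F (heckeH ρ κ (π g)) ∘ₗ heckeV ρ κ)
    (LinearMap.mulRight F (γ g) ∘ₗ cliffV B) with hf
  -- The second slot is precomposed with `π g`, so that the adjoint, which is the antipode of `π g`,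
  -- cancels against it.
  have h1 := sum_dualBasis_adjoint hnd b hB.symm (f.compl₂ (ρ (π g)))
    (fun v w => hB.invariant (π g) v w)
  have h2 : ∀ v, ρ (π g) (ρ (HopfAlgebra.antipode F (π g)) v) = v := fun v => by
    rw [← Module.End.mul_apply, ← map_mul, hg'.mul_antipode_cancel, map_one, Module.End.one_apply]
  simp only [LinearMap.compl₂_apply, h2] at h1
  rw [dirac, diagAC_groupLike ρ κ π γ hg, Finset.sum_mul, Finset.mul_sum, Finset.smul_sum]
  refine Eq.trans ?_ (h1.symm.trans ?_)
  · refine Finset.sum_congr rfl fun k _ => ?_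
    rw [Algebra.TensorProduct.tmul_mul_tmul]
    rfl
  · refine Finset.sum_congr rfl fun k _ => ?_
    rw [Algebra.TensorProduct.tmul_mul_tmul, groupLike_mul_heckeV ρ κ hg',
      ← hpin.compat_groupLike hg hi, TensorProduct.tmul_smul, smul_smul, sgn_mul_self, one_smul]
    rfl

theorem IsPinCover.dirac_mul_primitive {x : Ht} (hx : IsPrimitiveElem F x) :
    dirac ρ κ B hnd b * diagAC ρ κ π γ x = diagAC ρ κ π γ x * dirac ρ κ B hnd b := by
  have hx' := isPrimitiveElem_map π hx
  set f : V →ₗ[F] V →ₗ[F] AC ρ κ B := LinearMap.compl₁₂ (TensorProduct.mk F _ _)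
    (heckeV ρ κ) (cliffV B) with hf
  have h1 := sum_dualBasis_adjoint hnd b hB.symm f (fun v w => hB.invariant (π x) v w)
  rw [hx'.antipode_eq_neg, map_neg] at h1
  simp only [LinearMap.neg_apply, map_neg, Finset.sum_neg_distrib] at h1
  rw [eq_neg_iff_add_eq_zero, ← Finset.sum_add_distrib] at h1
  rw [dirac, diagAC_primitive ρ κ π γ hx, Finset.sum_mul, Finset.mul_sum, eq_comm, ← sub_eq_zero,
    ← Finset.sum_sub_distrib, ← h1]
  refine Finset.sum_congr rfl fun k _ => ?_
  rw [mul_add, add_mul]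
  simp only [Algebra.TensorProduct.tmul_mul_tmul, one_mul, mul_one,
    primitive_mul_heckeV ρ κ hx', TensorProduct.add_tmul]
  have h2 := hpin.compat_primitive hx (B.dualBasis hnd b k)
  have h3 : f (b k) (ρ (π x) (B.dualBasis hnd b k)) =
      heckeV ρ κ (b k) ⊗ₜ (γ x * cliffV B (B.dualBasis hnd b k)) -
      heckeV ρ κ (b k) ⊗ₜ (cliffV B (B.dualBasis hnd b k) * γ x) := by
    rw [← TensorProduct.tmul_sub, ← h2]
    rfl
  have h4 : f (ρ (π x) (b k)) (B.dualBasis hnd b k) =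
      heckeV ρ κ (ρ (π x) (b k)) ⊗ₜ cliffV B (B.dualBasis hnd b k) := rfl
  rw [h3, h4]
  abel

theorem IsPinCover.dirac_mul [CharZero F] [FiniteDimensional F V] (h : Ht) :
    dirac ρ κ B hnd b * diagAC ρ κ π γ h =
      acInvolute ρ κ B (diagAC ρ κ π γ h) * dirac ρ κ B hnd b := by
  let S : Subalgebra F Ht :=
    { carrier := {h | dirac ρ κ B hnd b * diagAC ρ κ π γ h =
        acInvolute ρ κ B (diagAC ρ κ π γ h) * dirac ρ κ B hnd b}
      mul_mem' := fun {x y} (hx : _ = _) (hy : _ = _) => by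
        change _ = _
        rw [map_mul, map_mul, ← mul_assoc, hx, mul_assoc, hy, mul_assoc]
      add_mem' := fun {x y} (hx : _ = _) (hy : _ = _) => by
        change _ = _
        rw [map_add, map_add, mul_add, hx, hy, add_mul]
      algebraMap_mem' := fun r => by
        change _ = _
        rw [AlgHom.commutes, AlgHom.commutes, Algebra.commutes] }
  refine hpin.eq_top hB S (fun i g hg hi => ?_) (fun x hx => ?_) h
  · change _ = _
    rw [hpin.dirac_mul_groupLike κ hnd b hB hg hi, hpin.acInvolute_diagAC κ hi, smul_mul_assoc]
  · change _ = _
    rw [hpin.dirac_mul_primitive κ hnd b hB hx, hpin.acInvolute_diagAC κ (.primitive x hx),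
      sgn_zero, one_smul]

end Dirac

/-! ## The Koszul differential and its homotopy -/

section Koszul

open MvPolynomial

variable {F : Type*} [Field F] {V : Type*} [AddCommGroup V] [Module F V]
  {B : LinearMap.BilinForm F V} (H : Type*) [AddCommGroup H] [Module F H]
  {ι : Type*} [Fintype ι] [DecidableEq ι] (hnd : B.Nondegenerate) (b : Module.Basis ι F V)

/-- The operator `∑ X_k ⊗ ι^k` on `S(V) ⊗ C ⊗ H`. -/
def koszulD : Module.End F (MvPolynomial ι F ⊗[F] (Cliff B ⊗[F] H)) :=
  ∑ k, TensorProduct.map (LinearMap.mulLeft F (X k))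
    ((contraction (B.dualBasis hnd b k)).rTensor H)

variable (B) in
/-- The operator `∑ ∂_k ⊗ e_k` on `S(V) ⊗ C ⊗ H`. -/
def koszulS : Module.End F (MvPolynomial ι F ⊗[F] (Cliff B ⊗[F] H)) :=
  ∑ k, TensorProduct.map (pderiv k).toLinearMap ((insertion (B := B) (b k)).rTensor H)

variable {H}

theorem koszulD_tmul (p : MvPolynomial ι F) (w : Cliff B ⊗[F] H) : koszulD H hnd b (p ⊗ₜ w) =
    ∑ k, (X k * p) ⊗ₜ (contraction (B.dualBasis hnd b k)).rTensor H w := by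
  simp [koszulD]

omit [DecidableEq ι] in
theorem koszulS_tmul (p : MvPolynomial ι F) (w : Cliff B ⊗[F] H) : koszulS B H b (p ⊗ₜ w) =
    ∑ k, pderiv k p ⊗ₜ (insertion (b k)).rTensor H w := by
  simp [koszulS]

theorem koszulD_mem {n : ℕ} {y : MvPolynomial ι F ⊗[F] (Cliff B ⊗[F] H)}
    (hy : y ∈ degLT F ι (Cliff B ⊗[F] H) n) :
    koszulD H hnd b y ∈ degLT F ι (Cliff B ⊗[F] H) (n + 1) := by
  induction hy using Submodule.span_induction with
  | mem y hy =>
    obtain ⟨m, hm, p, hp, w, rfl⟩ := hy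
    rw [koszulD_tmul]
    refine sum_mem fun k _ => tmul_mem_degLT (Nat.succ_lt_succ hm) ?_ _
    rw [Nat.succ_eq_add_one, add_comm]
    exact (isHomogeneous_X F k).mul hp
  | zero => rw [map_zero]; exact zero_mem _
  | add x y _ _ hx hy => rw [map_add]; exact add_mem hx hy
  | smul c x _ hx => rw [map_smul]; exact Submodule.smul_mem _ _ hx

omit [DecidableEq ι] in
theorem koszulS_mem {n : ℕ} {y : MvPolynomial ι F ⊗[F] (Cliff B ⊗[F] H)}
    (hy : y ∈ degLT F ι (Cliff B ⊗[F] H) (n + 1)) :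
    koszulS B H b y ∈ degLT F ι (Cliff B ⊗[F] H) n := by
  induction hy using Submodule.span_induction with
  | mem y hy =>
    obtain ⟨m, hm, p, hp, w, rfl⟩ := hy
    rw [koszulS_tmul]
    refine sum_mem fun k _ => ?_
    rcases m with _ | m
    · obtain ⟨c, rfl⟩ := eq_C_of_isHomogeneous_zero hp
      rw [pderiv_C, TensorProduct.zero_tmul]
      exact zero_mem _
    · exact tmul_mem_degLT (Nat.lt_of_succ_lt_succ hm) (pderiv_isHomogeneous_succ hp k) _
  | zero => rw [map_zero]; exact zero_mem _
  | add x y _ _ hx hy => rw [map_add]; exact add_mem hx hy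
  | smul c x _ hx => rw [map_smul]; exact Submodule.smul_mem _ _ hx

/-- Where `∂_l` hits the factor `X_k`, the sum is the number operator. The remaining terms combine
into anticommutators of contractions and insertions, which are `4 δ_kl`, and leave four times the
Euler operator. -/
theorem koszul_laplace (hB : B.IsSymm) {n : ℕ} {p : MvPolynomial ι F} (hp : p.IsHomogeneous n)
    (c : Cliff B) (h : H) :
    koszulD H hnd b (koszulS B H b (p ⊗ₜ (c ⊗ₜ h))) + koszulS B H b (koszulD H hnd b (p ⊗ₜ (c ⊗ₜ h))) =
      p ⊗ₜ (numberOp hnd b c ⊗ₜ h) + (4 * n : F) • (p ⊗ₜ (c ⊗ₜ h)) := by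
  set f : MvPolynomial ι F →ₗ[F] Cliff B →ₗ[F] MvPolynomial ι F ⊗[F] (Cliff B ⊗[F] H) :=
    (TensorProduct.mk F _ _).compl₂ ((TensorProduct.mk F (Cliff B) H).flip h) with hf
  have h1 : koszulD H hnd b (koszulS B H b (p ⊗ₜ (c ⊗ₜ h))) =
      ∑ l, ∑ k, f (X k * pderiv l p) (contraction (B.dualBasis hnd b k) (insertion (b l) c)) := by
    rw [koszulS_tmul, map_sum]
    refine Finset.sum_congr rfl fun l _ => ?_
    rw [koszulD_tmul]
    rfl
  have h2 : koszulS B H b (koszulD H hnd b (p ⊗ₜ (c ⊗ₜ h))) =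
      ∑ k, ∑ l, f (pderiv l (X k * p)) (insertion (b l) (contraction (B.dualBasis hnd b k) c)) := by
    rw [koszulD_tmul, map_sum]
    refine Finset.sum_congr rfl fun l _ => ?_
    rw [koszulS_tmul]
    rfl
  have h3 : ∀ k l, f (pderiv l (X k * p)) (insertion (b l) (contraction (B.dualBasis hnd b k) c)) =
      (if k = l then f p (insertion (b k) (contraction (B.dualBasis hnd b k) c)) else 0) +
      f (X k * pderiv l p) (insertion (b l) (contraction (B.dualBasis hnd b k) c)) := by
    intro k l
    rw [Derivation.leibniz, pderiv_X, Pi.single_apply, smul_eq_mul, smul_eq_mul]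
    split_ifs with h
    · subst h
      rw [mul_one, map_add, LinearMap.add_apply, add_comm]
    · simp
  have h4 : ∀ k l, f (X k * pderiv l p) (insertion (b l) (contraction (B.dualBasis hnd b k) c)) +
      f (X k * pderiv l p) (contraction (B.dualBasis hnd b k) (insertion (b l) c)) =
      if k = l then (4 : F) • f (X k * pderiv k p) c else 0 := by
    intro k l
    rw [← map_add, add_comm, contraction_insertion_add hB, map_smul,
      LinearMap.BilinForm.apply_dualBasis_left]
    by_cases h : k = l
    · subst h
      simp
    · rw [if_neg h, if_neg (Ne.symm h), mul_zero, zero_smul]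
  have h5 : ∑ k, f (X k * pderiv k p) c = (n : F) • f p c := by
    rw [← LinearMap.smul_apply, ← map_smul, ← LinearMap.sum_apply, ← map_sum,
      hp.sum_X_mul_pderiv, Nat.cast_smul_eq_nsmul]
  rw [h1, h2, Finset.sum_comm, ← Finset.sum_add_distrib,
    show p ⊗ₜ[F] (numberOp hnd b c ⊗ₜ[F] h) = f p (numberOp hnd b c) from rfl,
    show p ⊗ₜ[F] (c ⊗ₜ[F] h) = f p c from rfl, mul_smul, ← h5, numberOp_apply, map_sum,
    Finset.smul_sum, ← Finset.sum_add_distrib]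
  refine Finset.sum_congr rfl fun k _ => ?_
  rw [← Finset.sum_add_distrib]
  simp only [h3]
  rw [Finset.sum_congr rfl fun l _ => show _ = (if k = l then
    f p (insertion (b k) (contraction (B.dualBasis hnd b k) c)) else 0) +
    (if k = l then (4 : F) • f (X k * pderiv k p) c else 0) by rw [← h4]; abel,
    Finset.sum_add_distrib, Finset.sum_ite_eq, Finset.sum_ite_eq, if_pos (Finset.mem_univ k),
    if_pos (Finset.mem_univ k)]

/-- If `w` has positive Clifford degree `j`, then `4 j w` is of lower degree, because the number
operator kills `w`. Dividing by `4 j` and descending, only scalars remain in the Clifford factor. -/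
theorem exists_eq_one_tmul [CharZero F] (hB : B.IsSymm) {w : Cliff B ⊗[F] H}
    (hw : (numberOp hnd b).rTensor H w = 0) : ∃ h, w = 1 ⊗ₜ h := by
  set G : ℕ → Submodule F (Cliff B ⊗[F] H) := fun j =>
    Submodule.span F {w | ∃ c ∈ cliffLT B j, ∃ h, w = c ⊗ₜ h} with hG
  have hGmono : Monotone G := fun i j hij => Submodule.span_mono fun w ⟨c, hc, h, hw⟩ =>
    ⟨c, monotone_nat_of_le_succ cliffLT_le_succ hij hc, h, hw⟩
  have h1 : ∀ j, ∀ w ∈ G (j + 1), (numberOp hnd b).rTensor H w - (4 * j : F) • w ∈ G j := by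
    intro j w hw
    induction hw using Submodule.span_induction with
    | mem w hw =>
      obtain ⟨c, hc, h, rfl⟩ := hw
      rw [LinearMap.rTensor_tmul, TensorProduct.smul_tmul', ← TensorProduct.sub_tmul]
      exact Submodule.subset_span ⟨_, numberOp_sub_mem hnd b hB hc, h, rfl⟩
    | zero => rw [map_zero, smul_zero, sub_zero]; exact zero_mem _
    | add x y _ _ hx hy => rw [map_add, smul_add, add_sub_add_comm]; exact add_mem hx hy
    | smul c x _ hx => 
      have h3 := Submodule.smul_mem _ c hx
      rw [map_smul, smul_comm]
      exact (smul_sub c ((numberOp hnd b).rTensor H x) ((4 * j : F) • x)) ▸ h3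
  have h2 : ∀ j, w ∈ G (j + 1) → w ∈ G 1 := by
    intro j
    induction j with
    | zero => exact id
    | succ j ih =>
      intro hj
      have h3 := h1 _ w hj
      rw [hw, zero_sub] at h3
      have h4 : (-(4 * (j + 1 : ℕ)) : F) ≠ 0 :=
        neg_ne_zero.2 (by
          have : ((4 * (j + 1) : ℕ) : F) ≠ 0 := Nat.cast_ne_zero.2 (by omega)
          exact_mod_cast this)
      exact ih (((G (j + 1)).smul_mem_iff h4).1 (neg_smul (4 * (j + 1 : ℕ) : F) w ▸ h3))
  have h3 : ∀ w, ∃ j, w ∈ G (j + 1) := by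
    intro w
    induction w with
    | zero => exact ⟨0, zero_mem _⟩
    | tmul c h =>
      obtain ⟨j, hj⟩ := exists_mem_cliffLT c
      exact ⟨j, Submodule.subset_span ⟨c, cliffLT_le_succ _ hj, h, rfl⟩⟩
    | add x y hx hy =>
      obtain ⟨i, hi⟩ := hx
      obtain ⟨j, hj⟩ := hy
      exact ⟨max i j, add_mem (hGmono (Nat.succ_le_succ (le_max_left _ _)) hi)
        (hGmono (Nat.succ_le_succ (le_max_right _ _)) hj)⟩
  obtain ⟨j, hj⟩ := h3 w
  have h4 := h2 j hj
  clear hw hj h2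
  induction h4 using Submodule.span_induction with
  | mem w hw =>
    obtain ⟨c, hc, h, rfl⟩ := hw
    obtain ⟨r, rfl⟩ := Submodule.mem_one.1 hc
    exact ⟨r • h, by rw [Algebra.algebraMap_eq_smul_one, TensorProduct.smul_tmul]⟩
  | zero => exact ⟨0, by simp⟩
  | add x y _ _ hx hy =>
    obtain ⟨h, rfl⟩ := hx
    obtain ⟨k, rfl⟩ := hy
    exact ⟨h + k, by rw [TensorProduct.tmul_add]⟩
  | smul c x _ hx =>
    obtain ⟨h, rfl⟩ := hx
    exact ⟨c • h, by rw [TensorProduct.tmul_smul]⟩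

omit [Fintype ι] [DecidableEq ι] in
theorem exists_eq_one_tmul_of_mem_degLT_one {W : Type*} [AddCommGroup W] [Module F W]
    {y : MvPolynomial ι F ⊗[F] W} (hy : y ∈ degLT F ι W 1) : ∃ w, y = 1 ⊗ₜ w := by
  induction hy using Submodule.span_induction with
  | mem y hy =>
    obtain ⟨m, hm, p, hp, w, rfl⟩ := hy
    rw [Nat.lt_one_iff] at hm
    subst hm
    obtain ⟨r, rfl⟩ := eq_C_of_isHomogeneous_zero hp
    refine ⟨r • w, ?_⟩
    rw [← TensorProduct.smul_tmul, smul_eq_C_mul, mul_one]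
  | zero => exact ⟨0, by simp⟩
  | add x y _ _ hx hy =>
    obtain ⟨h, rfl⟩ := hx
    obtain ⟨k, rfl⟩ := hy
    exact ⟨h + k, by rw [TensorProduct.tmul_add]⟩
  | smul c x _ hx =>
    obtain ⟨h, rfl⟩ := hx
    exact ⟨c • h, by rw [TensorProduct.tmul_smul]⟩

/-- In degree zero the Koszul differential has image `∑ X_k ⊗ ι^k w`, purely of degree one. If it
also has degree zero, all coefficients `ι^k w` vanish, and the number operator kills `w`. -/
theorem exists_eq_one_tmul_of_koszulD_mem [CharZero F] (hB : B.IsSymm)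
    {y : MvPolynomial ι F ⊗[F] (Cliff B ⊗[F] H)} (hy : y ∈ degLT F ι (Cliff B ⊗[F] H) 1)
    (hdy : koszulD H hnd b y ∈ degLT F ι (Cliff B ⊗[F] H) 1) : ∃ h : H, y = 1 ⊗ₜ (1 ⊗ₜ h) := by
  obtain ⟨w, rfl⟩ := exists_eq_one_tmul_of_mem_degLT_one hy
  obtain ⟨w', hw'⟩ := exists_eq_one_tmul_of_mem_degLT_one hdy
  have h1 : ∀ k, (contraction (B.dualBasis hnd b k)).rTensor H w = 0 := by
    intro k
    have h2 := congrArg ((TensorProduct.lid F (Cliff B ⊗[F] H)).toLinearMap ∘ₗ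
      (lcoeff F (Finsupp.single k 1)).rTensor _) hw'
    rw [koszulD_tmul, map_sum] at h2
    simpa [coeff_X, coeff_one, Finsupp.single_left_inj, eq_comm (a := (0 : ι →₀ ℕ))] using h2
  have h2 : (numberOp hnd b).rTensor H w = 0 := by
    have : numberOp hnd b = ∑ k, insertion (b k) ∘ₗ contraction (B.dualBasis hnd b k) := rfl
    rw [this, ← LinearMap.coe_rTensorHom, map_sum, LinearMap.sum_apply]
    refine Finset.sum_eq_zero fun k _ => ?_
    rw [LinearMap.coe_rTensorHom, LinearMap.rTensor_comp_apply, h1, map_zero]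
  obtain ⟨h, rfl⟩ := exists_eq_one_tmul hnd b hB h2
  exact ⟨h, rfl⟩

end Koszul

/-! ## The filtration of `A ⊗ C` -/

section Filtration

open MvPolynomial WithConv

variable {F : Type*} [Field F] [CharZero F] {H : Type*} [Ring H] [HopfAlgebra F H]
  {V : Type*} [AddCommGroup V] [Module F V]
  {ρ : H →ₐ[F] Module.End F V} {κ : V [⋀^Fin 2]→ₗ[F] H} {B : LinearMap.BilinForm F V}
  {Ht : Type*} [Ring Ht] [HopfAlgebra F Ht] {π : Ht →ₐc[F] H} (γ : Ht →ₐ[F] Cliff B)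
  {ι : Type*} [Fintype ι] (b : Module.Basis ι F V) (hP : HasPBW ρ κ) (j : H →ₗc[F] Ht)

/-- The linear isomorphism `S(V) ⊗ C ⊗ H ≅ A ⊗ C` given by symmetrization and by the diagonal
map on `H`, lifted to the pin cover. -/
def acEquiv : (MvPolynomial ι F ⊗[F] (Cliff B ⊗[F] H)) ≃ₗ[F] AC ρ κ B :=
  (TensorProduct.congr (LinearEquiv.refl F _)
    ((twistEquiv (toConv (γ.toLinearMap ∘ₗ j.toLinearMap)) _ (conv_mul_antipode j γ)
      (conv_antipode_mul j γ)).trans (TensorProduct.comm F _ _))).trans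
  ((TensorProduct.assoc F _ _ _).symm.trans
    (TensorProduct.congr (pbwEquiv b hP) (LinearEquiv.refl F _)))

local notation "Sym" => symmetrize fun k => heckeV ρ κ (b k)

variable (ρ κ B) in
/-- The embedding of `H ⊗ C` in `A ⊗ C`. -/
def hcIncl : H ⊗[F] Cliff B →ₐ[F] AC ρ κ B :=
  Algebra.TensorProduct.map (heckeH ρ κ) (AlgHom.id F (Cliff B))

theorem acEquiv_tmul (p : MvPolynomial ι F) (w : Cliff B ⊗[F] H) :
    acEquiv γ b hP j (p ⊗ₜ w) = (Sym p ⊗ₜ 1) * hcIncl ρ κ B (TensorProduct.comm F _ _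
      (twist (toConv (γ.toLinearMap ∘ₗ j.toLinearMap)) w)) := by
  change TensorProduct.map (pbwMap ρ κ b) LinearMap.id ((TensorProduct.assoc F _ _ _).symm
    (p ⊗ₜ (TensorProduct.comm F _ _ (twist _ w)))) = _
  generalize TensorProduct.comm F (Cliff B) H (twist (toConv (γ.toLinearMap ∘ₗ j.toLinearMap)) w) = x
  induction x with
  | zero => simp
  | tmul h c => simp [hcIncl, pbwMap_tmul]
  | add x y hx hy => simp only [TensorProduct.tmul_add, map_add, hx, hy, mul_add]

variable {j}

variable (j) in
/-- The filtration of `A ⊗ C` by the degree in `A`. -/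
def acFilt (n : ℕ) : Submodule F (AC ρ κ B) :=
  (degLT F ι (Cliff B ⊗[F] H) n).map (acEquiv γ b hP j).toLinearMap

theorem acEquiv_mem {n : ℕ} {y : MvPolynomial ι F ⊗[F] (Cliff B ⊗[F] H)}
    (hy : y ∈ degLT F ι (Cliff B ⊗[F] H) n) : acEquiv γ b hP j y ∈ acFilt γ b hP j n :=
  Submodule.mem_map_of_mem hy

theorem acEquiv_mem_iff {n : ℕ} {y : MvPolynomial ι F ⊗[F] (Cliff B ⊗[F] H)} :
    acEquiv γ b hP j y ∈ acFilt γ b hP j n ↔ y ∈ degLT F ι (Cliff B ⊗[F] H) n :=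
  (acEquiv γ b hP j).injective.mem_set_image

/-- The twist is a bijection onto `H ⊗ C`, so the filtration transported by `acEquiv` sees only the
degree in `A`, whichever element of `H ⊗ C` stands on the right. -/
theorem mul_hcIncl_mem {n : ℕ} {a : HeckeAlgebra ρ κ} (ha : a ∈ filtLT ρ κ n)
    (x : H ⊗[F] Cliff B) : (a ⊗ₜ 1) * hcIncl ρ κ B x ∈ acFilt γ b hP j n := by
  rw [filtLT_eq_map ρ κ b] at ha
  obtain ⟨y, hy, rfl⟩ := ha
  induction hy using Submodule.span_induction with
  | mem y hy =>
    obtain ⟨m, hm, p, hp, h, rfl⟩ := hy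
    set e := (twistEquiv (toConv (γ.toLinearMap ∘ₗ j.toLinearMap)) _ (conv_mul_antipode j γ)
      (conv_antipode_mul j γ)).trans (TensorProduct.comm F _ _) with he
    have h1 := acEquiv_mem γ b hP (j := j) (tmul_mem_degLT hm hp (e.symm ((h ⊗ₜ 1) * x)))
    rw [acEquiv_tmul] at h1
    have h2 : TensorProduct.comm F _ _ (twist (toConv (γ.toLinearMap ∘ₗ j.toLinearMap))
      (e.symm ((h ⊗ₜ 1) * x))) = (h ⊗ₜ 1) * x := e.apply_symm_apply _
    rw [h2, map_mul, ← mul_assoc] at h1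
    rw [pbwMap_tmul]
    simpa [hcIncl] using h1
  | zero => rw [map_zero, TensorProduct.zero_tmul, zero_mul]; exact zero_mem _
  | add y z _ _ hy hz => rw [map_add, TensorProduct.add_tmul, add_mul]; exact add_mem hy hz
  | smul r y _ hy =>
    rw [map_smul, ← TensorProduct.smul_tmul', smul_mul_assoc]
    exact Submodule.smul_mem _ _ hy

theorem tmul_mul_diagAC_mem {n : ℕ} {a : HeckeAlgebra ρ κ} (ha : a ∈ filtLT ρ κ n) (c : Cliff B)
    (h : Ht) : (a ⊗ₜ c) * diagAC ρ κ π γ h ∈ acFilt γ b hP j n := by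
  have h1 := mul_hcIncl_mem γ b hP (j := j) ha ((1 ⊗ₜ c) * diag π γ h)
  rw [map_mul, ← mul_assoc] at h1
  have h2 : (a ⊗ₜ[F] (1 : Cliff B)) * hcIncl ρ κ B (1 ⊗ₜ c) = a ⊗ₜ c := by simp [hcIncl]
  rwa [h2] at h1

theorem diagAC_mem (h : Ht) : diagAC ρ κ π γ h ∈ acFilt γ b hP j 1 := by
  have h1 := tmul_mul_diagAC_mem γ b hP (j := j) (π := π) (n := 1) (a := 1)
    (le_fil Nat.zero_lt_one (by simpa using (almostCommuting_hecke ρ κ).one_mem)) 1 h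
  rwa [← Algebra.TensorProduct.one_def, one_mul] at h1

theorem acFilt_mono : Monotone (acFilt γ b hP j) := fun _ _ h => Submodule.map_mono (degLT_mono h)

variable (j) in
/-- The filtration of `acFilt (n + 1) / acFilt n` by the degree in the Clifford algebra. -/
def acFiltCliff (n k : ℕ) : Submodule F (AC ρ κ B) :=
  (Submodule.span F {y | ∃ p : MvPolynomial ι F, p.IsHomogeneous n ∧ ∃ c ∈ cliffLT B k, ∃ h : H,
    y = p ⊗ₜ (c ⊗ₜ h)}).map (acEquiv γ b hP j).toLinearMap ⊔ acFilt γ b hP j n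

theorem exists_mem_acFiltCliff {n : ℕ} {a : AC ρ κ B} (ha : a ∈ acFilt γ b hP j (n + 1)) :
    ∃ k, a ∈ acFiltCliff γ b hP j n k := by
  have hmono : Monotone (acFiltCliff γ b hP j n) := fun k l hkl => sup_le_sup_right
    (Submodule.map_mono (Submodule.span_mono (by
      rintro y ⟨p, hp, c, hc, h, hy⟩
      exact ⟨p, hp, c, monotone_nat_of_le_succ cliffLT_le_succ hkl hc, h, hy⟩))) _
  have hadd : ∀ a a' : AC ρ κ B, (∃ k, a ∈ acFiltCliff γ b hP j n k) →
      (∃ k, a' ∈ acFiltCliff γ b hP j n k) → ∃ k, a + a' ∈ acFiltCliff γ b hP j n k := by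
    rintro a a' ⟨k, hk⟩ ⟨l, hl⟩
    exact ⟨max k l, add_mem (hmono (le_max_left _ _) hk) (hmono (le_max_right _ _) hl)⟩
  obtain ⟨y, hy, rfl⟩ := ha
  induction hy using Submodule.span_induction with
  | mem y hy =>
    obtain ⟨m, hm, p, hp, w, rfl⟩ := hy
    rcases Nat.lt_succ_iff_lt_or_eq.1 hm with h | rfl
    · exact ⟨0, Submodule.mem_sup_right (acEquiv_mem γ b hP (tmul_mem_degLT h hp w))⟩
    · induction w with
      | zero => exact ⟨0, by rw [TensorProduct.tmul_zero, map_zero]; exact zero_mem _⟩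
      | add w w' hw hw' => rw [TensorProduct.tmul_add, map_add]; exact hadd _ _ hw hw'
      | tmul c h =>
        obtain ⟨k, hk⟩ := exists_mem_cliffLT c
        exact ⟨k, Submodule.mem_sup_left (Submodule.mem_map_of_mem
          (Submodule.subset_span ⟨p, hp, c, hk, h, rfl⟩))⟩
  | zero => exact ⟨0, by rw [map_zero]; exact zero_mem _⟩
  | add x y _ _ hx hy => rw [map_add]; exact hadd _ _ hx hy
  | smul r y _ hy =>
    obtain ⟨k, hk⟩ := hy
    exact ⟨k, by rw [map_smul]; exact Submodule.smul_mem _ _ hk⟩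

variable [Coalgebra.IsCocomm F H] (hj : ∀ x, π (j x) = x)
include hj

theorem acEquiv_tmul_tmul (p : MvPolynomial ι F) (c : Cliff B) (h : H) :
    acEquiv γ b hP j (p ⊗ₜ (c ⊗ₜ h)) = (Sym p ⊗ₜ c) * diagAC ρ κ π γ (j h) := by
  rw [acEquiv_tmul, comm_twist_eq hj, map_mul, ← mul_assoc]
  congr 1
  simp [hcIncl]

theorem acEquiv_one_tmul (h : H) :
    acEquiv γ b hP j (1 ⊗ₜ (1 ⊗ₜ h)) = diagAC ρ κ π γ (j h) := by
  rw [acEquiv_tmul_tmul γ b hP hj, symmetrize_one, ← Algebra.TensorProduct.one_def, one_mul]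

include hP in
/-- To prove a linear statement about `A ⊗ C`, it suffices to consider `x ⊗ c` times an element
of the image of the diagonal map. -/
theorem acEquiv_induction {S : Submodule F (AC ρ κ B)}
    (h : ∀ p : MvPolynomial ι F, ∀ c : Cliff B, ∀ x : H,
      (Sym p ⊗ₜ c) * diagAC ρ κ π γ (j x) ∈ S) (a : AC ρ κ B) : a ∈ S := by
  obtain ⟨y, rfl⟩ := (acEquiv γ b hP j).surjective a
  induction y with
  | zero => rw [map_zero]; exact zero_mem _
  | add y z hy hz => rw [map_add]; exact add_mem hy hz
  | tmul p w =>
    induction w with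
    | zero => rw [TensorProduct.tmul_zero, map_zero]; exact zero_mem _
    | add y z hy hz => rw [TensorProduct.tmul_add, map_add]; exact add_mem hy hz
    | tmul c x =>
      rw [acEquiv_tmul_tmul γ b hP hj]
      exact h p c x

variable [DecidableEq ι] (hnd : B.Nondegenerate)

/-- The Koszul differential is the leading term of `d`: each may raise the degree by one, but their
difference does not. -/
theorem superComm_acEquiv_sub_mem (hDQ : ∀ h, dirac ρ κ B hnd b * diagAC ρ κ π γ h =
      acInvolute ρ κ B (diagAC ρ κ π γ h) * dirac ρ κ B hnd b) {n : ℕ}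
    {y : MvPolynomial ι F ⊗[F] (Cliff B ⊗[F] H)} (hy : y ∈ degLT F ι (Cliff B ⊗[F] H) n) :
    superComm (acInvolute ρ κ B) (dirac ρ κ B hnd b) (acEquiv γ b hP j y) -
      acEquiv γ b hP j (koszulD H hnd b y) ∈ acFilt γ b hP j n := by
  induction hy using Submodule.span_induction with
  | mem y hy =>
    obtain ⟨m, hm, p, hp, w, rfl⟩ := hy
    induction w with
    | zero => simp only [TensorProduct.tmul_zero, map_zero, sub_zero]; exact zero_mem _
    | add w w' hw hw' =>
      simp only [TensorProduct.tmul_add, map_add]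
      rw [add_sub_add_comm]
      exact add_mem hw hw'
    | tmul c h =>
      -- `v x ⊗ w c - x v ⊗ θ(c) w` is split as `v x` tensored with the contraction of `c`, plus the
      -- commutator of `v` and `x` tensored with `θ(c) w`. The first differs from the Koszul term by
      -- an error of symmetrization; the second has lower degree.
      have h1 : superComm (acInvolute ρ κ B) (dirac ρ κ B hnd b)
            (acEquiv γ b hP j (p ⊗ₜ (c ⊗ₜ h))) - acEquiv γ b hP j (koszulD H hnd b (p ⊗ₜ (c ⊗ₜ h))) =
          ∑ k, (((heckeV ρ κ (b k) * Sym p - Sym (X k * p)) ⊗ₜ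
              contraction (B.dualBasis hnd b k) c) * diagAC ρ κ π γ (j h) +
            ((heckeV ρ κ (b k) * Sym p - Sym p * heckeV ρ κ (b k)) ⊗ₜ
              (CliffordAlgebra.involute c * cliffV B (B.dualBasis hnd b k))) *
                diagAC ρ κ π γ (j h)) := by
        rw [acEquiv_tmul_tmul γ b hP hj, superComm_mul_right
          (Q := Subalgebra.toSubmodule (diagAC ρ κ π γ).range)
          (by rintro _ ⟨h, rfl⟩; exact hDQ h) _ (AlgHom.mem_range_self _ (j h)), koszulD_tmul, map_sum, superComm_apply,
          dirac, Finset.sum_mul, acInvolute_tmul, Finset.mul_sum, ← Finset.sum_sub_distrib,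
          Finset.sum_mul, ← Finset.sum_sub_distrib]
        refine Finset.sum_congr rfl fun k _ => ?_
        rw [LinearMap.rTensor_tmul, acEquiv_tmul_tmul γ b hP hj, ← sub_mul, ← add_mul]
        congr 1
        simp only [Algebra.TensorProduct.tmul_mul_tmul, contraction_apply, TensorProduct.sub_tmul,
          TensorProduct.tmul_sub]
        abel
      rw [h1]
      refine sum_mem fun k _ => add_mem ?_ ?_
      · refine tmul_mul_diagAC_mem γ b hP (fil_mono hm ?_) _ _
        have h2 := neg_mem (symmetrize_X_mul_sub_mem (𝓥 := LinearMap.range (heckeV ρ κ))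
          (fun k => ⟨b k, rfl⟩) (almostCommuting_hecke ρ κ) hp k)
        rwa [neg_sub] at h2
      · refine tmul_mul_diagAC_mem γ b hP (fil_mono hm.le ?_) _ _
        exact (almostCommuting_hecke ρ κ).commutator_mem_fil ⟨b k, rfl⟩
          (symmetrize_mem_pow (𝓥 := LinearMap.range (heckeV ρ κ)) (fun k => ⟨b k, rfl⟩) hp)
  | zero => simp only [map_zero, sub_zero]; exact zero_mem _
  | add x y _ _ hx hy =>
    simp only [map_add]
    rw [add_sub_add_comm]
    exact add_mem hx hy
  | smul r y _ hy =>
    simp only [map_smul]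
    have := Submodule.smul_mem _ r hy
    rwa [smul_sub] at this

theorem superComm_mem (hDQ : ∀ h, dirac ρ κ B hnd b * diagAC ρ κ π γ h =
      acInvolute ρ κ B (diagAC ρ κ π γ h) * dirac ρ κ B hnd b) {n : ℕ} {a : AC ρ κ B}
    (ha : a ∈ acFilt γ b hP j n) :
    superComm (acInvolute ρ κ B) (dirac ρ κ B hnd b) a ∈ acFilt γ b hP j (n + 1) := by
  obtain ⟨y, hy, rfl⟩ := ha
  have h1 := acFilt_mono γ b hP n.le_succ (superComm_acEquiv_sub_mem γ b hP hj hnd hDQ hy)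
  have h2 := add_mem h1 (acEquiv_mem γ b hP (koszulD_mem hnd b hy))
  rwa [sub_add_cancel] at h2

theorem eq_diagAC_of_superComm_mem (hB : B.IsSymm)
    (hDQ : ∀ h, dirac ρ κ B hnd b * diagAC ρ κ π γ h =
      acInvolute ρ κ B (diagAC ρ κ π γ h) * dirac ρ κ B hnd b) {a : AC ρ κ B}
    (ha : a ∈ acFilt γ b hP j 1)
    (hda : superComm (acInvolute ρ κ B) (dirac ρ κ B hnd b) a ∈ acFilt γ b hP j 1) :
    ∃ h, a = diagAC ρ κ π γ (j h) := by
  obtain ⟨y, hy, rfl⟩ := ha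
  have h1 := sub_mem hda (superComm_acEquiv_sub_mem γ b hP hj hnd hDQ hy)
  rw [LinearEquiv.coe_coe, sub_sub_cancel, acEquiv_mem_iff] at h1
  obtain ⟨h, rfl⟩ := exists_eq_one_tmul_of_koszulD_mem hnd b hB hy h1
  exact ⟨h, acEquiv_one_tmul γ b hP hj h⟩

include hP in
-- An element `Δ_C(h)` has degree zero in `A` and is killed by `d`, so the degree zero computation
-- already expresses it through the section. Thus `Q` is exhausted by `Δ_C(j(H))`.
theorem exists_diagAC_section_eq (hB : B.IsSymm)
    (hDQ : ∀ h, dirac ρ κ B hnd b * diagAC ρ κ π γ h =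
      acInvolute ρ κ B (diagAC ρ κ π γ h) * dirac ρ κ B hnd b) (h : Ht) :
    ∃ h', diagAC ρ κ π γ h = diagAC ρ κ π γ (j h') := by
  refine eq_diagAC_of_superComm_mem γ b hP hj hnd hB hDQ (diagAC_mem γ b hP h) ?_
  rw [superComm_apply, hDQ, sub_self]
  exact zero_mem _

end Filtration

/-! ## The homotopy on `A ⊗ C` -/

theorem exists_matrix_apply_basis {F V ι : Type*} [Field F] [AddCommGroup V] [Module F V] [Fintype ι]
    (b : Module.Basis ι F V) (f : Module.End F V) :
    ∃ T : Matrix ι ι F, ∀ k, f (b k) = ∑ l, T l k • b l :=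
  ⟨fun l k => b.repr (f (b k)) l, fun k => (b.sum_repr (f (b k))).symm⟩

section Homotopy

open MvPolynomial WithConv

variable {F : Type*} [Field F] [CharZero F] {H : Type*} [Ring H] [HopfAlgebra F H]
  {V : Type*} [AddCommGroup V] [Module F V]
  {ρ : H →ₐ[F] Module.End F V} {κ : V [⋀^Fin 2]→ₗ[F] H} {B : LinearMap.BilinForm F V}
  {Ht : Type*} [Ring Ht] [HopfAlgebra F Ht] {π : Ht →ₐc[F] H} (γ : Ht →ₐ[F] Cliff B)
  {ι : Type*} [Fintype ι] (b : Module.Basis ι F V) (hP : HasPBW ρ κ) (j : H →ₗc[F] Ht)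

local notation "Sym" => symmetrize fun k => heckeV ρ κ (b k)

/-- The operator `koszulS`, transported to `A ⊗ C`. -/
def acHomotopy : Module.End F (AC ρ κ B) := (acEquiv γ b hP j).conj (koszulS B H b)

variable {j}

theorem acHomotopy_acEquiv (y : MvPolynomial ι F ⊗[F] (Cliff B ⊗[F] H)) :
    acHomotopy γ b hP j (acEquiv γ b hP j y) = acEquiv γ b hP j (koszulS B H b y) := by
  rw [acHomotopy, LinearEquiv.conj_apply_apply, LinearEquiv.symm_apply_apply]

theorem acHomotopy_mem {n : ℕ} {a : AC ρ κ B} (ha : a ∈ acFilt γ b hP j (n + 1)) :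
    acHomotopy γ b hP j a ∈ acFilt γ b hP j n := by
  obtain ⟨y, hy, rfl⟩ := ha
  rw [LinearEquiv.coe_coe, acHomotopy_acEquiv]
  exact acEquiv_mem γ b hP (koszulS_mem b hy)

variable [Coalgebra.IsCocomm F H] (hj : ∀ x, π (j x) = x)
  (hQ : ∀ h, ∃ h', diagAC ρ κ π γ h = diagAC ρ κ π γ (j h'))
include hj

section Laplace

variable [DecidableEq ι] (hnd : B.Nondegenerate)
  (hDQ : ∀ h, dirac ρ κ B hnd b * diagAC ρ κ π γ h =
    acInvolute ρ κ B (diagAC ρ κ π γ h) * dirac ρ κ B hnd b)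
include hDQ

/-- Replacing `d` by its leading term changes `d s + s d` only in lower degree, since `s` lowers the
degree by one. The Koszul identity and the leading eigenvalue of the number operator then give `4 n
+ 4 k`. -/
theorem laplace_mem (hB : B.IsSymm) {n k : ℕ} {a : AC ρ κ B}
    (ha : a ∈ acFiltCliff γ b hP j n (k + 1)) :
    superComm (acInvolute ρ κ B) (dirac ρ κ B hnd b) (acHomotopy γ b hP j a) +
      acHomotopy γ b hP j (superComm (acInvolute ρ κ B) (dirac ρ κ B hnd b) a) -
      (4 * (n + k) : F) • a ∈ acFiltCliff γ b hP j n k := by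
  set d := superComm (acInvolute ρ κ B) (dirac ρ κ B hnd b) with hd
  set s := acHomotopy (ρ := ρ) (κ := κ) γ b hP j with hs
  obtain ⟨x, hx, r, hr, rfl⟩ := Submodule.mem_sup.1 ha
  have hsplit : d (s (x + r)) + s (d (x + r)) - (4 * (n + k) : F) • (x + r) =
      (d (s x) + s (d x) - (4 * (n + k) : F) • x) +
        (d (s r) + s (d r) - (4 * (n + k) : F) • r) := by
    simp only [map_add]
    module
  rw [hsplit]
  clear ha hsplit
  refine add_mem ?_ (Submodule.mem_sup_right ?_)
  · obtain ⟨y, hy, rfl⟩ := hx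
    induction hy using Submodule.span_induction with
    | mem y hy =>
      obtain ⟨p, hp, c, hc, h, rfl⟩ := hy
      have h0 := tmul_mem_degLT (F := F) n.lt_succ_self hp (c ⊗ₜ[F] h)
      have h1 := superComm_acEquiv_sub_mem γ b hP hj hnd hDQ (koszulS_mem b h0)
      have h2 := acHomotopy_mem γ b hP (superComm_acEquiv_sub_mem γ b hP hj hnd hDQ h0)
      rw [map_sub, acHomotopy_acEquiv] at h2
      rw [← acHomotopy_acEquiv] at h1
      have h3 := add_mem h1 h2
      rw [sub_add_sub_comm, ← map_add, koszul_laplace hnd b hB hp] at h3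
      have h4 := numberOp_sub_mem hnd b hB hc
      have h5 : acEquiv γ b hP j (p ⊗ₜ ((numberOp hnd b c - (4 * k : F) • c) ⊗ₜ h)) ∈
          acFiltCliff γ b hP j n k :=
        Submodule.mem_sup_left (Submodule.mem_map_of_mem (Submodule.subset_span
          ⟨p, hp, _, h4, h, rfl⟩))
      have h6 : p ⊗ₜ[F] (numberOp hnd b c ⊗ₜ[F] h) + (4 * n : F) • (p ⊗ₜ[F] (c ⊗ₜ[F] h)) =
          p ⊗ₜ[F] ((numberOp hnd b c - (4 * k : F) • c) ⊗ₜ[F] h) +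
            (4 * (n + k) : F) • (p ⊗ₜ[F] (c ⊗ₜ[F] h)) := by
        rw [TensorProduct.sub_tmul, TensorProduct.tmul_sub, ← TensorProduct.smul_tmul',
          TensorProduct.tmul_smul]
        module
      rw [h6, map_add, map_smul] at h3
      have h7 := add_mem (Submodule.mem_sup_right h3) h5
      rw [add_comm (acEquiv γ b hP j _) (_ • _), ← sub_sub, sub_add_cancel] at h7
      exact h7
    | zero => simp only [map_zero, add_zero, smul_zero, sub_zero]; exact zero_mem _
    | add y z _ _ hy hz =>
      have h1 := add_mem hy hz
      simp only [map_add]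
      convert h1 using 1
      module
    | smul t y _ hy =>
      have h1 := Submodule.smul_mem _ t hy
      simp only [map_smul]
      convert h1 using 1
      module
  · refine sub_mem (add_mem ?_ (acHomotopy_mem γ b hP (superComm_mem γ b hP hj hnd hDQ hr)))
      (Submodule.smul_mem _ _ hr)
    rcases n with _ | n
    · have hr' := hr
      rw [acFilt, degLT_zero, Submodule.map_bot, Submodule.mem_bot] at hr'
      rw [hr', map_zero, map_zero]
      exact zero_mem _
    · exact superComm_mem γ b hP hj hnd hDQ (acHomotopy_mem γ b hP hr)

end Laplace

include hQ

/-- The homotopy is defined with the section only; since `Δ_C(j(H))` is all of `Q`, its formula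
extends to every `h` in `Ht`. Right linearity over `Q` follows from this form. -/
theorem acHomotopy_tmul_mul (p : MvPolynomial ι F) (c : Cliff B) (h : Ht) :
    acHomotopy γ b hP j ((Sym p ⊗ₜ c) * diagAC ρ κ π γ h) =
      (∑ k, Sym (pderiv k p) ⊗ₜ insertion (b k) c) * diagAC ρ κ π γ h := by
  obtain ⟨h', hh'⟩ := hQ h
  rw [hh', ← acEquiv_tmul_tmul γ b hP hj, acHomotopy_acEquiv, koszulS_tmul, map_sum,
    Finset.sum_mul]
  refine Finset.sum_congr rfl fun k _ => ?_
  rw [LinearMap.rTensor_tmul, acEquiv_tmul_tmul γ b hP hj]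

theorem acHomotopy_mul (a : AC ρ κ B) (h : Ht) :
    acHomotopy γ b hP j (a * diagAC ρ κ π γ h) = acHomotopy γ b hP j a * diagAC ρ κ π γ h := by
  suffices hS : ∀ a, a ∈ LinearMap.eqLocus
      (acHomotopy γ b hP j ∘ₗ LinearMap.mulRight F (diagAC ρ κ π γ h))
      (LinearMap.mulRight F (diagAC ρ κ π γ h) ∘ₗ acHomotopy γ b hP j) from hS a
  refine acEquiv_induction γ b hP hj fun p c x => ?_
  rw [LinearMap.mem_eqLocus, LinearMap.comp_apply, LinearMap.comp_apply, LinearMap.mulRight_apply,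
    LinearMap.mulRight_apply, mul_assoc, ← map_mul (diagAC ρ κ π γ),
    acHomotopy_tmul_mul γ b hP hj hQ, acHomotopy_tmul_mul γ b hP hj hQ, map_mul (diagAC ρ κ π γ),
    mul_assoc]

theorem acHomotopy_acInvolute (hθ : ∀ h, acInvolute ρ κ B (diagAC ρ κ π γ h) ∈ (diagAC ρ κ π γ).range)
    (a : AC ρ κ B) : acHomotopy γ b hP j (acInvolute ρ κ B a) =
      -acInvolute ρ κ B (acHomotopy γ b hP j a) := by
  refine acEquiv_induction γ b hP hj (S := LinearMap.eqLocus
    (acHomotopy γ b hP j ∘ₗ (acInvolute ρ κ B).toLinearMap)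
    (-((acInvolute ρ κ B).toLinearMap ∘ₗ acHomotopy γ b hP j))) (fun p c x => ?_) a
  change acHomotopy γ b hP j (acInvolute ρ κ B _) = -acInvolute ρ κ B (acHomotopy γ b hP j _)
  obtain ⟨h, hh⟩ := hθ (j x)
  have hh' : diagAC ρ κ π γ h = acInvolute ρ κ B (diagAC ρ κ π γ (j x)) := hh
  rw [acHomotopy_tmul_mul γ b hP hj hQ, map_mul (acInvolute ρ κ B), map_mul (acInvolute ρ κ B),
    ← hh', acInvolute_tmul,
    acHomotopy_tmul_mul γ b hP hj hQ, ← neg_mul, map_sum, ← Finset.sum_neg_distrib]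
  congr 1
  refine Finset.sum_congr rfl fun k _ => ?_
  rw [acInvolute_tmul, involute_insertion, TensorProduct.tmul_neg, neg_neg]

variable (hpin : IsPinCover ρ B π γ)
include hpin

/-- Conjugation by `g` acts on polynomials by substitution and on vectors in `C` up to the sign of
`g`. The pairing of derivatives with vectors in `s` is invariant, so only the sign survives. -/
theorem acHomotopy_groupLike_mul {i : ZMod 2} {g : Ht} (hg : IsGroupLikeElem F g)
    (hi : IsHomogeneousProduct (pullRep ρ π) i g) (a : AC ρ κ B) :
    acHomotopy γ b hP j (diagAC ρ κ π γ g * a) =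
      sgn F i • (diagAC ρ κ π γ g * acHomotopy γ b hP j a) := by
  classical
  have hg' : IsGroupLikeElem F (π g) := hg.map π
  obtain ⟨T, hTb⟩ := exists_matrix_apply_basis b (ρ (π g))
  set u := γ g
  set u' := γ (HopfAlgebra.antipode F g) with hu'
  have huu' : u * u' = 1 := by rw [← map_mul, hg.mul_antipode_cancel, map_one]
  have hu'u : u' * u = 1 := by rw [← map_mul, hg.antipode_mul_cancel, map_one]
  have hSym : ∀ p, heckeH ρ κ (π g) * Sym p = Sym (linSubst T p) * heckeH ρ κ (π g) := by
    intro p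
    have hgg : heckeH ρ κ (HopfAlgebra.antipode F (π g)) * heckeH ρ κ (π g) = 1 := by
      rw [← map_mul, hg'.antipode_mul_cancel, map_one]
    have hgg' : heckeH ρ κ (π g) * heckeH ρ κ (HopfAlgebra.antipode F (π g)) = 1 := by
      rw [← map_mul, hg'.mul_antipode_cancel, map_one]
    rw [← map_symmetrize_linSubst (v := fun k => heckeV ρ κ (b k)) T
      (LinearMap.mulLeft F (heckeH ρ κ (π g)) ∘ₗ
        LinearMap.mulRight F (heckeH ρ κ (HopfAlgebra.antipode F (π g))))]
    · simp only [LinearMap.comp_apply, LinearMap.mulLeft_apply, LinearMap.mulRight_apply]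
      rw [mul_assoc, mul_assoc, hgg, mul_one]
    · simp [hgg']
    · intro k a
      simp only [LinearMap.comp_apply, LinearMap.mulLeft_apply, LinearMap.mulRight_apply]
      rw [← mul_assoc, ← mul_assoc, groupLike_mul_heckeV ρ κ hg', hTb, map_sum, Finset.sum_mul,
        Finset.sum_mul, Finset.sum_mul]
      refine Finset.sum_congr rfl fun l _ => ?_
      rw [map_smul, smul_mul_assoc, smul_mul_assoc, smul_mul_assoc, mul_assoc, mul_assoc]
  have hcl : ∀ (p : MvPolynomial ι F) (c : Cliff B), diagAC ρ κ π γ g * (Sym p ⊗ₜ c) =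
      (Sym (linSubst T p) ⊗ₜ (u * c * u')) * diagAC ρ κ π γ g := by
    intro p c
    rw [diagAC_groupLike ρ κ π γ hg, Algebra.TensorProduct.tmul_mul_tmul,
      Algebra.TensorProduct.tmul_mul_tmul, hSym, mul_assoc (u * c), hu'u, mul_one]
  -- The pin condition gives `π(g) v` as the signed conjugate of `v`. In the second term of the
  -- insertion the signs of `u` and its inverse under the involution cancel, so the same overall
  -- sign results.
  have hins : ∀ (v : V) (c : Cliff B), insertion (ρ (π g) v) (u * c * u') =
      sgn F i • (u * insertion v c * u') := by
    intro v c
    have h1 := hpin.compat_groupLike hg hi v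
    have h2 : cliffV B (ρ (π g) v) = sgn F i • (u * cliffV B v * u') := by
      rw [← h1, smul_mul_assoc, smul_smul, sgn_mul_self, one_smul, mul_assoc, huu', mul_one]
    have h3 : CliffordAlgebra.involute u * CliffordAlgebra.involute u' = 1 := by
      rw [← map_mul, huu', map_one]
    have h4 : CliffordAlgebra.involute u = sgn F i • u := hpin.involute_eq hi
    have h5 : CliffordAlgebra.involute u' = sgn F i • u' := by
      rw [h4, smul_mul_assoc] at h3
      have h6 := congrArg (fun x => sgn F i • (u' * x)) h3
      simp only [mul_smul_comm, smul_smul, sgn_mul_self, one_smul, ← mul_assoc, hu'u, one_mul,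
        mul_one] at h6
      exact h6
    rw [insertion_apply, insertion_apply, h2, map_mul, map_mul, h4, h5]
    simp only [smul_mul_assoc, mul_smul_comm, smul_smul, sgn_mul_self, one_smul, mul_add, add_mul,
      smul_add]
    have h7 : u * cliffV B v * u' * (u * c * u') = u * (cliffV B v * c) * u' := by
      calc _ = u * cliffV B v * (u' * u) * c * u' := by noncomm_ring
        _ = _ := by rw [hu'u]; noncomm_ring
    have h8 : u * CliffordAlgebra.involute c * u' * (u * cliffV B v * u') =
        u * (CliffordAlgebra.involute c * cliffV B v) * u' := by
      calc _ = u * CliffordAlgebra.involute c * (u' * u) * cliffV B v * u' := by noncomm_ring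
        _ = _ := by rw [hu'u]; noncomm_ring
    rw [h7, h8]
  refine acEquiv_induction γ b hP hj (S := LinearMap.eqLocus
    (acHomotopy γ b hP j ∘ₗ LinearMap.mulLeft F (diagAC ρ κ π γ g))
    (sgn F i • (LinearMap.mulLeft F (diagAC ρ κ π γ g) ∘ₗ acHomotopy γ b hP j)))
    (fun p c x => ?_) a
  change acHomotopy γ b hP j (_ * (_ * _)) = sgn F i • (_ * acHomotopy γ b hP j (_ * _))
  rw [← mul_assoc, hcl, mul_assoc, ← map_mul (diagAC ρ κ π γ), acHomotopy_tmul_mul γ b hP hj hQ,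
    acHomotopy_tmul_mul γ b hP hj hQ, map_mul (diagAC ρ κ π γ), ← mul_assoc, ← mul_assoc, ← smul_mul_assoc]
  congr 1
  rw [Finset.mul_sum, Finset.smul_sum, Finset.sum_congr (s₁ := Finset.univ)
    (f := fun k => sgn F i • (diagAC ρ κ π γ g * _)) rfl fun k _ => by rw [hcl], ← Finset.smul_sum,
    ← Finset.sum_mul, ← smul_mul_assoc]
  congr 1
  rw [Finset.smul_sum]
  -- The chain rule puts the matrix of `ρ (π g)` on the polynomial factor; moved across the tensor
  -- sign it turns the insertion of `b m` into that of its image.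
  simp only [pderiv_linSubst, map_sum, map_smul, TensorProduct.sum_tmul, TensorProduct.smul_tmul]
  rw [Finset.sum_comm]
  refine Finset.sum_congr rfl fun m _ => ?_
  rw [← TensorProduct.tmul_sum]
  have h9 : ∑ k, T k m • insertion (b k) (u * c * u') = sgn F i • (u * insertion (b m) c * u') := by
    rw [← hins, hTb, map_sum, LinearMap.sum_apply]
    simp only [map_smul, LinearMap.smul_apply]
  rw [h9, TensorProduct.tmul_smul]

/-- The infinitesimal form of the same invariance: differentiating the polynomial factor and
differentiating the inserted vector produce opposite terms. -/
theorem acHomotopy_primitive_mul {x : Ht} (hx : IsPrimitiveElem F x) (a : AC ρ κ B) :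
    acHomotopy γ b hP j (diagAC ρ κ π γ x * a) = diagAC ρ κ π γ x * acHomotopy γ b hP j a := by
  classical
  have hx' := isPrimitiveElem_map π hx
  obtain ⟨T, hTb⟩ := exists_matrix_apply_basis b (ρ (π x))
  set u := γ x
  have hSym : ∀ p, heckeH ρ κ (π x) * Sym p = Sym p * heckeH ρ κ (π x) + Sym (linDer T p) := by
    intro p
    rw [← map_symmetrize_linDer (v := fun k => heckeV ρ κ (b k)) T
      (LinearMap.mulLeft F (heckeH ρ κ (π x)) - LinearMap.mulRight F (heckeH ρ κ (π x)))]
    · simp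
    · simp
    · intro k a
      simp only [LinearMap.sub_apply, LinearMap.mulLeft_apply, LinearMap.mulRight_apply]
      have h1 : ∑ l, T l k • (heckeV ρ κ (b l) * a) = heckeV ρ κ (ρ (π x) (b k)) * a := by
        rw [hTb, map_sum, Finset.sum_mul]
        simp only [map_smul, smul_mul_assoc]
      rw [← mul_assoc, primitive_mul_heckeV ρ κ hx', h1]
      noncomm_ring
  have hcl : ∀ (p : MvPolynomial ι F) (c : Cliff B), diagAC ρ κ π γ x * (Sym p ⊗ₜ c) =
      (Sym p ⊗ₜ c) * diagAC ρ κ π γ x + Sym p ⊗ₜ (u * c - c * u) + Sym (linDer T p) ⊗ₜ c := by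
    intro p c
    rw [diagAC_primitive ρ κ π γ hx, mul_add, add_mul]
    simp only [Algebra.TensorProduct.tmul_mul_tmul, one_mul, mul_one, hSym, TensorProduct.add_tmul,
      TensorProduct.tmul_sub]
    abel
  have hins : ∀ (v : V) (c : Cliff B), insertion v (u * c - c * u) =
      u * insertion v c - insertion v c * u - insertion (ρ (π x) v) c := by
    intro v c
    have h1 := hpin.compat_primitive hx v
    have h4 : CliffordAlgebra.involute u = u := by
      have := hpin.involute_eq (.primitive x hx)
      rwa [sgn_zero, one_smul] at this
    simp only [insertion_apply, h1, map_sub, map_mul, h4]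
    noncomm_ring
  refine acEquiv_induction γ b hP hj (S := LinearMap.eqLocus
    (acHomotopy γ b hP j ∘ₗ LinearMap.mulLeft F (diagAC ρ κ π γ x))
    (LinearMap.mulLeft F (diagAC ρ κ π γ x) ∘ₗ acHomotopy γ b hP j))
    (fun p c y => ?_) a
  change acHomotopy γ b hP j (_ * (_ * _)) = _ * acHomotopy γ b hP j (_ * _)
  rw [← mul_assoc, hcl, add_mul, add_mul, map_add, map_add, mul_assoc, ← map_mul (diagAC ρ κ π γ),
    acHomotopy_tmul_mul γ b hP hj hQ, acHomotopy_tmul_mul γ b hP hj hQ,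
    acHomotopy_tmul_mul γ b hP hj hQ, acHomotopy_tmul_mul γ b hP hj hQ, map_mul (diagAC ρ κ π γ), ← mul_assoc,
    ← mul_assoc, ← add_mul, ← add_mul]
  congr 1
  rw [Finset.mul_sum, Finset.sum_congr (s₁ := Finset.univ)
    (f := fun k => diagAC ρ κ π γ x * _) rfl fun k _ => hcl _ _, Finset.sum_mul]
  simp only [Finset.sum_add_distrib, pderiv_linDer, map_add, TensorProduct.add_tmul, hins,
    TensorProduct.tmul_sub, Finset.sum_sub_distrib]
  -- The additional term in the derivative of `linDer T p` equals the additional term in the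
  -- insertion into a commutator, and the two enter with opposite signs.
  have h9 : ∑ k, Sym (∑ m, T k m • pderiv m p) ⊗ₜ[F] insertion (b k) c =
      ∑ k, Sym (pderiv k p) ⊗ₜ[F] insertion (ρ (π x) (b k)) c := by
    simp only [map_sum, map_smul, TensorProduct.sum_tmul, TensorProduct.smul_tmul]
    rw [Finset.sum_comm]
    refine Finset.sum_congr rfl fun m _ => ?_
    rw [← TensorProduct.tmul_sum, hTb, map_sum, LinearMap.sum_apply]
    simp only [map_smul, LinearMap.smul_apply]
  rw [h9]
  abel

theorem acHomotopy_diagAC_mul [FiniteDimensional F V] (hB : IsOrthogonal ρ B) (h : Ht)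
    (a : AC ρ κ B) : acHomotopy γ b hP j (diagAC ρ κ π γ h * a) =
      acInvolute ρ κ B (diagAC ρ κ π γ h) * acHomotopy γ b hP j a := by
  let S : Subalgebra F Ht :=
    { carrier := {h | ∀ a, acHomotopy γ b hP j (diagAC ρ κ π γ h * a) =
        acInvolute ρ κ B (diagAC ρ κ π γ h) * acHomotopy γ b hP j a}
      mul_mem' := fun {x y} hx hy a => by
        rw [map_mul (diagAC ρ κ π γ), map_mul (acInvolute ρ κ B), mul_assoc, hx, hy, mul_assoc]
      add_mem' := fun {x y} hx hy a => by
        rw [map_add, map_add, add_mul, map_add, hx, hy, add_mul]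
      algebraMap_mem' := fun r a => by
        rw [AlgHom.commutes, AlgHom.commutes, ← Algebra.smul_def, ← Algebra.smul_def, map_smul] }
  refine hpin.eq_top hB S (fun i g hg hi a => ?_) (fun x hx a => ?_) h a
  · rw [acHomotopy_groupLike_mul γ b hP hj hQ hpin hg hi, hpin.acInvolute_diagAC κ hi,
      smul_mul_assoc]
  · rw [acHomotopy_primitive_mul γ b hP hj hQ hpin hx, hpin.acInvolute_diagAC κ (.primitive x hx),
      sgn_zero, one_smul]

end Homotopy

/-! ## The algebra map from the center of `A` to the center of `H'` -/

section SuperCentralizerMul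

variable {F : Type*} [Field F] {R : Type*} [Ring R] [Algebra F R] {θ : R →ₐ[F] R}
  {Q : Submodule F R} {D : R}

theorem mul_mem_superCentralizer_one (hθQ : ∀ q ∈ Q, θ q ∈ Q) {a x : R}
    (ha : a ∈ superCentralizer θ Q 1) (hx : x ∈ superCentralizer θ Q 0) :
    a * x ∈ superCentralizer θ Q 1 := by
  rw [mem_superCentralizer_one] at ha ⊢
  rw [mem_superCentralizer_zero] at hx
  exact ⟨by rw [map_mul, ha.1, hx.1, neg_mul],
    fun q hq => by rw [← mul_assoc, ha.2 q hq, mul_assoc, hx.2 _ (hθQ q hq), mul_assoc]⟩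

theorem mul_mem_superCentralizer_one' {a x : R} (ha : a ∈ superCentralizer θ Q 1)
    (hx : x ∈ superCentralizer θ Q 0) : x * a ∈ superCentralizer θ Q 1 := by
  rw [mem_superCentralizer_one] at ha ⊢
  rw [mem_superCentralizer_zero] at hx
  exact ⟨by rw [map_mul, ha.1, hx.1, mul_neg],
    fun q hq => by rw [← mul_assoc, hx.2 q hq, mul_assoc, ha.2 q hq, mul_assoc]⟩

theorem superComm_mul_of_even {a x : R} (hx : θ x = x) (hdx : superComm θ D x = 0) :
    superComm θ D (a * x) = superComm θ D a * x := by
  rw [superComm_apply, hx, sub_eq_zero] at hdx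
  rw [superComm_apply, superComm_apply, map_mul, hx, mul_assoc (θ a), ← hdx]
  noncomm_ring

theorem superComm_even_mul {a x : R} (hx : θ x = x) (hdx : superComm θ D x = 0) :
    superComm θ D (x * a) = x * superComm θ D a := by
  rw [superComm_apply, hx, sub_eq_zero] at hdx
  rw [superComm_apply, superComm_apply, map_mul, hx, ← mul_assoc, hdx]
  noncomm_ring

end SuperCentralizerMul

/-- A single-valued relation compatible with the operations is the graph of an algebra map; this
avoids computing with choices of the odd element `a`. -/
theorem exists_algHom_of_rel {F Z Y : Type*} [CommRing F] [Ring Z] [Ring Y] [Algebra F Z]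
    [Algebra F Y] (P : Z → Y → Prop) (hex : ∀ z, ∃ y, P z y) (huniq : ∀ z y y', P z y → P z y' → y = y')
    (halg : ∀ r : F, P (algebraMap F Z r) (algebraMap F Y r))
    (hadd : ∀ z z' y y', P z y → P z' y' → P (z + z') (y + y'))
    (hmul : ∀ z z' y y', P z y → P z' y' → P (z * z') (y * y')) :
    ∃ f : Z →ₐ[F] Y, ∀ z, P z (f z) := by
  choose f hf using hex
  refine ⟨{ toFun := f, map_one' := ?_, map_mul' := fun z z' => ?_, map_zero' := ?_,
            map_add' := fun z z' => ?_, commutes' := fun r => ?_ }, hf⟩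
  · have := halg 1
    rw [map_one, map_one] at this
    exact huniq _ _ _ (hf _) this
  · exact huniq _ _ _ (hf _) (hmul _ _ _ _ (hf z) (hf z'))
  · have := halg 0
    rw [map_zero, map_zero] at this
    exact huniq _ _ _ (hf _) this
  · exact huniq _ _ _ (hf _) (hadd _ _ _ _ (hf z) (hf z'))
  · exact huniq _ _ _ (hf _) (halg r)

/-! ### Invariants, injectivity of `H' → A ⊗ C` and the map on centers -/

section Main

variable {F : Type*} [Field F] {H : Type*} [Ring H] [HopfAlgebra F H]
  {V : Type*} [AddCommGroup V] [Module F V]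
  {ρ : H →ₐ[F] Module.End F V} {κ : V [⋀^Fin 2]→ₗ[F] H} {B : LinearMap.BilinForm F V}
  {Ht : Type*} [Ring Ht] [HopfAlgebra F Ht] {π : Ht →ₐc[F] H} {γ : Ht →ₐ[F] Cliff B}

/-- On group-like and primitive elements the condition on the adjoint action is the commutation rule
with the sign carried by `θ`. That rule is closed under products, so it passes to all of `Ht`. -/
theorem mem_superCentralizer_of_isDetOdd [CharZero F] [FiniteDimensional F V]
    (hpin : IsPinCover ρ B π γ) (hB : IsOrthogonal ρ B) {a : AC ρ κ B} (ha : IsDetOdd ρ κ π γ a) :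
    a ∈ superCentralizer (acInvolute ρ κ B) (Subalgebra.toSubmodule (diagAC ρ κ π γ).range) 1 := by
  rw [mem_superCentralizer_one]
  constructor
  · obtain ⟨y, rfl⟩ := ha.1
    clear ha
    induction y with
    | zero => simp
    | add x y hx hy => simp only [map_add, hx, hy, neg_add]
    | tmul x c =>
      rw [LinearMap.lTensor_tmul, acInvolute_tmul, Submodule.subtype_apply,
        CliffordAlgebra.involute_eq_of_mem_odd c.2, TensorProduct.tmul_neg]
  · rintro _ ⟨h, rfl⟩
    change diagAC ρ κ π γ h * a = a * acInvolute ρ κ B (diagAC ρ κ π γ h)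
    let S : Subalgebra F Ht :=
      { carrier := {h | diagAC ρ κ π γ h * a = a * acInvolute ρ κ B (diagAC ρ κ π γ h)}
        mul_mem' := fun {x y} (hx : _ = _) (hy : _ = _) => by
          change _ = _
          rw [map_mul (diagAC ρ κ π γ), map_mul (acInvolute ρ κ B), mul_assoc, hy, ← mul_assoc, hx,
            mul_assoc]
        add_mem' := fun {x y} (hx : _ = _) (hy : _ = _) => by
          change _ = _
          rw [map_add, map_add, add_mul, hx, hy, mul_add]
        algebraMap_mem' := fun r => by
          change _ = _
          rw [AlgHom.commutes, AlgHom.commutes, Algebra.commutes] }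
    refine hpin.eq_top hB S (fun i g hg hi => ?_) (fun x hx => ?_) h
    · change _ = _
      have h1 := ha.2 i g (Submodule.subset_span hi)
      rw [adAct_groupLike _ hg, hg.counit_eq_one, mul_one] at h1
      rw [hpin.acInvolute_diagAC κ hi, mul_smul_comm, ← smul_mul_assoc, ← h1, mul_assoc _ _ (diagAC ρ κ π γ g),
        ← map_mul (diagAC ρ κ π γ), hg.antipode_mul_cancel, map_one, mul_one]
    · change _ = _
      have h1 := ha.2 0 x (Submodule.subset_span (.primitive x hx))
      rw [adAct_primitive _ hx, hx.counit_eq_zero, mul_zero, zero_smul, sub_eq_zero] at h1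
      rw [hpin.acInvolute_diagAC κ (.primitive x hx), sgn_zero, one_smul, h1]

theorem adAct_mul {K R : Type*} [Ring K] [HopfAlgebra F K] [Ring R] [Algebra F R] (f : K →ₐ[F] R)
    (h k : K) (r : R) : adAct f (h * k) r = adAct f h (adAct f k r) := by
  have key : ∀ x y : K ⊗[F] K,
      LinearMap.mul' F (Module.End F R) (TensorProduct.map (LinearMap.mul F R ∘ₗ f.toLinearMap)
        ((LinearMap.mul F R).flip ∘ₗ f.toLinearMap ∘ₗ HopfAlgebra.antipode F) (x * y)) =
      LinearMap.mul' F (Module.End F R) (TensorProduct.map (LinearMap.mul F R ∘ₗ f.toLinearMap)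
        ((LinearMap.mul F R).flip ∘ₗ f.toLinearMap ∘ₗ HopfAlgebra.antipode F) x) *
      LinearMap.mul' F (Module.End F R) (TensorProduct.map (LinearMap.mul F R ∘ₗ f.toLinearMap)
        ((LinearMap.mul F R).flip ∘ₗ f.toLinearMap ∘ₗ HopfAlgebra.antipode F) y) := by
    intro x y
    induction x with
    | zero => simp
    | add x x' hx hx' => simp only [add_mul, map_add, hx, hx']
    | tmul a b =>
      induction y with
      | zero => simp
      | add y y' hy hy' => simp only [mul_add, map_add, hy, hy']
      | tmul c d =>
        ext r
        simp [HopfAlgebra.antipode_mul_antidistrib, mul_assoc]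
  have h1 := key (Coalgebra.comul h) (Coalgebra.comul k)
  rw [← Bialgebra.comul_mul] at h1
  exact LinearMap.congr_fun h1 r

theorem isDetOdd_of_mem_superCentralizer [CharZero F] (hpin : IsPinCover ρ B π γ) {a : AC ρ κ B}
    (ha : a ∈ superCentralizer (acInvolute ρ κ B)
      (Subalgebra.toSubmodule (diagAC ρ κ π γ).range) 1) : IsDetOdd ρ κ π γ a := by
  rw [mem_superCentralizer_one] at ha
  constructor
  · have h1 : ∀ a : AC ρ κ B, a - acInvolute ρ κ B a ∈
        LinearMap.range ((cliffParity B 1).subtype.lTensor (HeckeAlgebra ρ κ)) := by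
      intro a
      induction a using TensorProduct.induction_on with
      | zero => simp
      | add x y hx hy => rw [map_add, add_sub_add_comm]; exact add_mem hx hy
      | tmul x c =>
        rw [acInvolute_tmul, ← TensorProduct.tmul_sub]
        have hc : c - CliffordAlgebra.involute c ∈ cliffParity B 1 := by
          have htop : c ∈ cliffParity B 0 ⊔ cliffParity B 1 := by
            rw [(CliffordAlgebra.evenOdd_isCompl _).sup_eq_top]
            exact Submodule.mem_top
          obtain ⟨c₀, h₀, c₁, h₁, rfl⟩ := Submodule.mem_sup.1 htop
          rw [map_add, CliffordAlgebra.involute_eq_of_mem_even h₀,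
            CliffordAlgebra.involute_eq_of_mem_odd h₁, add_sub_add_left_eq_sub]
          exact sub_mem h₁ (neg_mem h₁)
        exact ⟨x ⊗ₜ ⟨_, hc⟩, rfl⟩
    have h2 := Submodule.smul_mem _ (2⁻¹ : F) (h1 a)
    rw [ha.1, sub_neg_eq_add, ← two_smul F, inv_smul_smul₀ two_ne_zero] at h2
    exact h2
  · have hgl : ∀ (i : ZMod 2) (g : Ht), IsHomogeneousProduct (pullRep ρ π) i g →
        IsGroupLikeElem F g →
        adAct (diagAC ρ κ π γ) g a = (sgn F i * Coalgebra.counit g) • a := by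
      intro i g hi hg
      rw [adAct_groupLike _ hg, ha.2 _ (AlgHom.mem_range_self _ g), hpin.acInvolute_diagAC κ hi,
        mul_smul_comm, smul_mul_assoc, mul_assoc, ← map_mul (diagAC ρ κ π γ),
        hg.mul_antipode_cancel, map_one, mul_one, hg.counit_eq_one, mul_one]
    intro i h hh
    induction hh using Submodule.span_induction with
    | mem h hh =>
      induction hh with
      | groupLike_even g hg hdet => exact hgl 0 g (.groupLike_even g hg hdet) hg
      | groupLike_odd g hg hdet => exact hgl 1 g (.groupLike_odd g hg hdet) hg
      | primitive x hx =>
        rw [adAct_primitive _ hx, ha.2 _ (AlgHom.mem_range_self _ x),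
          hpin.acInvolute_diagAC κ (.primitive x hx), sgn_zero, one_smul, sub_self,
          hx.counit_eq_zero, mul_zero, zero_smul]
      | mul i j x y _ _ hx hy =>
        rw [adAct_mul, hy, map_smul, hx, smul_smul, sgn_add, Bialgebra.counit_mul]
        congr 1
        ring
    | zero => simp
    | add x y _ _ hx hy =>
      rw [map_add, map_add, LinearMap.add_apply, hx, hy, mul_add, add_smul]
    | smul c x _ hx =>
      rw [map_smul, map_smul, LinearMap.smul_apply, hx, smul_eq_mul, smul_smul]
      congr 1
      ring

theorem Parthasarathy.exists_eq {D : AC ρ κ B} (hP : Parthasarathy ρ κ π γ D)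
    (hpin : IsPinCover ρ B π γ) : ∃ z ∈ Subalgebra.center F (AC ρ κ B),
      ∃ q ∈ Subalgebra.toSubmodule (diagAC ρ κ π γ).range,
        acInvolute ρ κ B q = q ∧ D ^ 2 = z + q := by
  obtain ⟨z, hz, _, ⟨k, hk, rfl⟩, h⟩ := Submodule.mem_sup.1 hP
  refine ⟨z, hz, _, AlgHom.mem_range_self _ k, ?_, h.symm⟩
  change acInvolute ρ κ B (diagAC ρ κ π γ k) = diagAC ρ κ π γ k
  clear h
  induction hk using Submodule.span_induction with
  | mem k hk => rw [hpin.acInvolute_diagAC κ hk, sgn_zero, one_smul]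
  | zero => rw [map_zero, map_zero]
  | add x y _ _ hx hy => rw [map_add, map_add, hx, hy]
  | smul c x _ hx => rw [map_smul, map_smul, hx]

variable {ι : Type*} [Fintype ι] [DecidableEq ι] {b : Module.Basis ι F V}

theorem isFilteredHomotopy [CharZero F] [Coalgebra.IsCocomm F H] [FiniteDimensional F V]
    (hA : IsHopfHecke ρ κ B) (hpin : IsPinCover ρ B π γ)
    (hP : Parthasarathy ρ κ π γ (dirac ρ κ B hA.orthogonal.nondegenerate b))
    {j : H →ₗc[F] Ht} (hj : ∀ x, π (j x) = x) :
    IsFilteredHomotopy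
      (superComm (acInvolute ρ κ B) (dirac ρ κ B hA.orthogonal.nondegenerate b))
      (acHomotopy γ b hA.pbw j)
      (superCentralizer (acInvolute ρ κ B) (Subalgebra.toSubmodule (diagAC ρ κ π γ).range))
      (Subalgebra.toSubmodule (diagAC ρ κ π γ).range)
      (acFilt γ b hA.pbw j) (acFiltCliff γ b hA.pbw j) := by
  have hnd := hA.orthogonal.nondegenerate
  have hDQ := hpin.dirac_mul κ hnd b hA.orthogonal
  have hDQ' : ∀ q ∈ Subalgebra.toSubmodule (diagAC ρ κ π γ).range,
      dirac ρ κ B hnd b * q = acInvolute ρ κ B q * dirac ρ κ B hnd b := by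
    rintro _ ⟨h, rfl⟩
    exact hDQ h
  have hQ := exists_diagAC_section_eq γ b hA.pbw hj hnd hA.orthogonal.symm hDQ
  have hθθ := acInvolute_acInvolute ρ κ (B := B)
  have hθ := hpin.acInvolute_mem κ hA.orthogonal
  have hθQ : ∀ q ∈ Subalgebra.toSubmodule (diagAC ρ κ π γ).range,
      acInvolute ρ κ B q ∈ Subalgebra.toSubmodule (diagAC ρ κ π γ).range := by
    rintro _ ⟨h, rfl⟩
    exact hθ h
  refine
    { map_d := fun i a ha => map_mem_superCentralizer hθθ hθQ
        (superComm_θ hθθ (acInvolute_dirac ρ κ hnd b))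
        (fun a q hq => superComm_mul_right hDQ' a hq)
        (fun a q hq => superComm_mul_left hDQ' a hq) ha
      map_s := fun i a ha => map_mem_superCentralizer hθθ hθQ
        (acHomotopy_acInvolute γ b hA.pbw hj hQ hθ)
        (by rintro a _ ⟨h, rfl⟩; exact acHomotopy_mul γ b hA.pbw hj hQ a h)
        (by rintro a _ ⟨h, rfl⟩
            exact acHomotopy_diagAC_mul γ b hA.pbw hj hQ hpin hA.orthogonal h a) ha
      d_d := fun i a ha => superComm_superComm hθθ (acInvolute_dirac ρ κ hnd b)
        (hP.exists_eq hpin) ha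
      zero := by rw [acFilt, degLT_zero, Submodule.map_bot]
      exists_mem := fun a => ?_
      le_succ := fun n => acFilt_mono γ b hA.pbw n.le_succ
      zero_le := fun n => sup_le ?_ le_rfl
      le := fun n k => le_sup_right
      exists_mem_succ := fun n a ha => exists_mem_acFiltCliff γ b hA.pbw ha
      le_right := fun n k => sup_le ?_ (acFilt_mono γ b hA.pbw n.le_succ)
      s_mem := fun n a ha => acHomotopy_mem γ b hA.pbw ha
      laplace := fun n k a ha => laplace_mem γ b hA.pbw hj hnd hDQ hA.orthogonal.symm ha
      base := fun a ha hda => ?_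
      Q_le := ?_
      d_Q := fun q hq => by rw [superComm_apply, hDQ' q hq, sub_self] }
  · obtain ⟨n, hn⟩ := exists_mem_degLT ((acEquiv γ b hA.pbw j).symm a)
    refine ⟨n, ?_⟩
    have := acEquiv_mem γ b hA.pbw (j := j) hn
    rwa [LinearEquiv.apply_symm_apply] at this
  · rw [Submodule.map_le_iff_le_comap, Submodule.span_le]
    rintro _ ⟨p, hp, c, hc, h, rfl⟩
    rw [show c = 0 from hc, TensorProduct.zero_tmul, TensorProduct.tmul_zero]
    exact zero_mem _
  · refine Submodule.map_mono (Submodule.span_le.2 ?_)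
    rintro _ ⟨p, hp, c, hc, h, rfl⟩
    exact tmul_mem_degLT n.lt_succ_self hp _
  · obtain ⟨h, rfl⟩ := eq_diagAC_of_superComm_mem γ b hA.pbw hj hnd hA.orthogonal.symm hDQ ha hda
    exact AlgHom.mem_range_self _ _
  · rintro _ ⟨h, rfl⟩
    exact diagAC_mem γ b hA.pbw h

omit [DecidableEq ι] in
include b in
-- The PBW isomorphism restricts to `h` on `1 ⊗ h`, and the constant coefficient recovers `h`.
theorem heckeH_injective [CharZero F] (hP : HasPBW ρ κ) : Function.Injective (heckeH ρ κ) := by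
  intro x y hxy
  have h1 : pbwMap ρ κ b (1 ⊗ₜ x) = pbwMap ρ κ b (1 ⊗ₜ y) := by
    rw [pbwMap_tmul, pbwMap_tmul, hxy]
  have h2 := congrArg ((TensorProduct.lid F H).toLinearMap ∘ₗ
    (MvPolynomial.lcoeff F (0 : ι →₀ ℕ)).rTensor H) (pbwMap_injective b hP h1)
  simpa using h2

omit [DecidableEq ι] in
include b in
theorem quotDiagAC_injective [CharZero F] (hP : HasPBW ρ κ) :
    Function.Injective (quotDiagAC ρ κ π γ) := by
  have h1 : Function.Injective ((heckeH ρ κ).toLinearMap.rTensor (Cliff B)) :=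
    Module.Flat.rTensor_preserves_injective_linearMap _ (heckeH_injective (b := b) hP)
  intro x y hxy
  exact Ideal.kerLiftAlg_injective (diag π γ) (h1 hxy)

theorem exists_center_algHom [CharZero F] [Coalgebra.IsCocomm F H] [FiniteDimensional F V]
    (hA : IsHopfHecke ρ κ B) (hpin : IsPinCover ρ B π γ) {D : AC ρ κ B}
    (hD : D = dirac ρ κ B hA.orthogonal.nondegenerate b)
    (hP : Parthasarathy ρ κ π γ D) :
    ∃ ζ : Subalgebra.center F (HeckeAlgebra ρ κ) →ₐ[F] Subalgebra.center F (QuotHopf π γ),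
      (∀ z : Subalgebra.center F (HeckeAlgebra ρ κ), ∃ a : AC ρ κ B, IsDetOdd ρ κ π γ a ∧
        (z : HeckeAlgebra ρ κ) ⊗ₜ[F] (1 : Cliff B) =
          quotDiagAC ρ κ π γ (ζ z) + D * a + a * D) ∧
      (∀ (z : Subalgebra.center F (HeckeAlgebra ρ κ))
        (y : Subalgebra.center F (QuotHopf π γ)) (a : AC ρ κ B), IsDetOdd ρ κ π γ a →
        (z : HeckeAlgebra ρ κ) ⊗ₜ[F] (1 : Cliff B) = quotDiagAC ρ κ π γ y + D * a + a * D →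
        y = ζ z) := by
  subst hD
  obtain ⟨j, hj⟩ := hpin.doubleCover.exists_section
  have hfh := isFilteredHomotopy hA hpin hP hj
  have hnd := hA.orthogonal.nondegenerate
  set θ := acInvolute ρ κ B with hθ
  set Q := Subalgebra.toSubmodule (diagAC ρ κ π γ).range with hQ
  set d := superComm θ (dirac ρ κ B hnd b) with hd
  have hθQ : ∀ q ∈ Q, θ q ∈ Q := by
    rintro _ ⟨h, rfl⟩
    exact hpin.acInvolute_mem κ hA.orthogonal h
  have hdX : ∀ a ∈ superCentralizer θ Q 1,
      d a = dirac ρ κ B hnd b * a + a * dirac ρ κ B hnd b := by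
    intro a ha
    rw [hd, superComm_apply, (mem_superCentralizer_one.1 ha).1, neg_mul, sub_neg_eq_add]
  have hcentral : ∀ z : Subalgebra.center F (HeckeAlgebra ρ κ), ∀ a : AC ρ κ B,
      a * ((z : HeckeAlgebra ρ κ) ⊗ₜ 1) = ((z : HeckeAlgebra ρ κ) ⊗ₜ 1) * a := by
    intro z a
    induction a using TensorProduct.induction_on with
    | zero => rw [zero_mul, mul_zero]
    | add x y hx hy => rw [add_mul, mul_add, hx, hy]
    | tmul x c =>
      rw [Algebra.TensorProduct.tmul_mul_tmul, Algebra.TensorProduct.tmul_mul_tmul, one_mul,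
        mul_one, Subalgebra.mem_center_iff.1 z.2 x]
  have hzX : ∀ z : Subalgebra.center F (HeckeAlgebra ρ κ),
      ((z : HeckeAlgebra ρ κ) ⊗ₜ 1 : AC ρ κ B) ∈ superCentralizer θ Q 0 := fun z =>
    mem_superCentralizer_zero.2 ⟨by rw [hθ, acInvolute_tmul, map_one],
      fun q _ => hcentral z q⟩
  have hdz : ∀ z : Subalgebra.center F (HeckeAlgebra ρ κ),
      d ((z : HeckeAlgebra ρ κ) ⊗ₜ 1) = 0 := fun z => by
    rw [hd, superComm_apply, (mem_superCentralizer_zero.1 (hzX z)).1, hcentral z, sub_self]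
  have hquot : ∀ h, quotDiagAC ρ κ π γ (toQuot π γ h) = diagAC ρ κ π γ h := fun h => rfl
  have hquotQ : ∀ y, quotDiagAC ρ κ π γ y ∈ Q := fun y => by
    obtain ⟨h, rfl⟩ := Ideal.Quotient.mkₐ_surjective F _ y
    exact AlgHom.mem_range_self _ h
  have hinj := quotDiagAC_injective (b := b) (π := π) (γ := γ) hA.pbw
  -- The odd element is taken in the supercentralizer, where `d a = D a + a D`; the translation to
  -- `IsDetOdd` is made only at the end.
  let P : Subalgebra.center F (HeckeAlgebra ρ κ) → Subalgebra.center F (QuotHopf π γ) → Prop :=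
    fun z y => ∃ a ∈ superCentralizer θ Q 1,
      (z : HeckeAlgebra ρ κ) ⊗ₜ[F] (1 : Cliff B) = quotDiagAC ρ κ π γ y + d a
  have hex : ∀ z, ∃ y, P z y := by
    intro z
    obtain ⟨_, ⟨h, rfl⟩, a, ha, haz⟩ := hfh.exists_eq_add (hzX z) (by
      rw [hdz]
      exact zero_mem _)
    rw [zero_add] at ha
    -- As a difference of even elements of the supercentralizer, this one commutes with all of `Q`.
    -- By injectivity of `H' → A ⊗ C` the class of `h` is central in `H'`.
    have hq : diagAC ρ κ π γ h ∈ superCentralizer θ Q 0 := by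
      have h1 := sub_mem (hzX z) (hfh.map_d 1 a ha)
      rw [haz] at h1
      rw [add_sub_cancel_right] at h1
      exact h1
    refine ⟨⟨toQuot π γ h, Subalgebra.mem_center_iff.2 fun y => hinj ?_⟩, a, ha, haz⟩
    rw [map_mul (quotDiagAC ρ κ π γ), map_mul (quotDiagAC ρ κ π γ), hquot,
      (mem_superCentralizer_zero.1 hq).2 _ (hquotQ y)]
  have huniq : ∀ z y y', P z y → P z y' → y = y' := by
    rintro z y y' ⟨a, ha, hza⟩ ⟨a', ha', hza'⟩
    -- The difference of two representations is a coboundary in `Q`, hence zero.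
    have h1 : d (a - a') = quotDiagAC ρ κ π γ (y' - y) := by
      rw [map_sub, map_sub, sub_eq_sub_iff_add_eq_add, add_comm, ← hza, hza']
    have h2 := hfh.d_eq_zero (sub_mem ha ha') (h1 ▸ hquotQ _)
    rw [h1] at h2
    have h3 := hinj (h2.trans (map_zero _).symm)
    exact Subtype.ext (sub_eq_zero.1 h3).symm
  have halg : ∀ r : F, P (algebraMap F _ r) (algebraMap F _ r) := by
    intro r
    refine ⟨0, zero_mem _, ?_⟩
    rw [map_zero, add_zero]
    exact ((quotDiagAC ρ κ π γ).commutes r).symm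
  have hadd : ∀ z z' y y', P z y → P z' y' → P (z + z') (y + y') := by
    rintro z z' y y' ⟨a, ha, hza⟩ ⟨a', ha', hza'⟩
    refine ⟨a + a', add_mem ha ha', ?_⟩
    rw [Subalgebra.coe_add, TensorProduct.add_tmul, hza, hza', Subalgebra.coe_add, map_add, map_add]
    abel
  have hmul : ∀ z z' y y', P z y → P z' y' → P (z * z') (y * y') := by
    rintro z z' y y' ⟨a, ha, hza⟩ ⟨a', ha', hza'⟩
    have hy : quotDiagAC ρ κ π γ y ∈ superCentralizer θ Q 0 := by
      have h1 := sub_mem (hzX z) (hfh.map_d 1 a ha)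
      rw [hza] at h1
      rw [add_sub_cancel_right] at h1
      exact h1
    -- With `y` and `y'` standing for their images, the witness comes from `z z' = (y + d a) z' = y
    -- (y' + d a') + d (a z')` and from linearity of `d` over the even cocycles `y` and `z'`.
    refine ⟨quotDiagAC ρ κ π γ y * a' + a * ((z' : HeckeAlgebra ρ κ) ⊗ₜ 1),
      add_mem (mul_mem_superCentralizer_one' ha' hy) (mul_mem_superCentralizer_one hθQ ha (hzX z')),
      ?_⟩
    have h1 : ((z * z' : Subalgebra.center F (HeckeAlgebra ρ κ)) : HeckeAlgebra ρ κ) ⊗ₜ[F]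
        (1 : Cliff B) = ((z : HeckeAlgebra ρ κ) ⊗ₜ 1) * ((z' : HeckeAlgebra ρ κ) ⊗ₜ 1) := by
      rw [Algebra.TensorProduct.tmul_mul_tmul, mul_one, Subalgebra.coe_mul]
    have h2 : d (quotDiagAC ρ κ π γ y * a') = quotDiagAC ρ κ π γ y * d a' :=
      superComm_even_mul (mem_superCentralizer_zero.1 hy).1 (hfh.d_Q _ (hquotQ _))
    have h3 : d (a * ((z' : HeckeAlgebra ρ κ) ⊗ₜ 1)) = d a * ((z' : HeckeAlgebra ρ κ) ⊗ₜ 1) :=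
      superComm_mul_of_even (mem_superCentralizer_zero.1 (hzX z')).1 (hdz z')
    rw [h1, hza, map_add, h2, h3, Subalgebra.coe_mul, map_mul (quotDiagAC ρ κ π γ), add_mul,
      ← add_assoc]
    nth_rw 1 [hza']
    rw [mul_add]
  obtain ⟨ζ, hζ⟩ := exists_algHom_of_rel P hex huniq halg hadd hmul
  refine ⟨ζ, fun z => ?_, fun z y a ha hza => ?_⟩
  · obtain ⟨a, ha, hza⟩ := hζ z
    exact ⟨a, isDetOdd_of_mem_superCentralizer hpin ha, by rw [hza, hdX a ha, add_assoc]⟩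
  · have ha' := mem_superCentralizer_of_isDetOdd hpin hA.orthogonal ha
    exact huniq z _ _ ⟨a, ha', by rw [hza, hdX a ha', add_assoc]⟩ (hζ z)

end Main

/-! ## The Dirac cohomology -/

section Cohomology

variable {F : Type*} [Field F] {H : Type*} [Ring H] [HopfAlgebra F H]
  {V : Type*} [AddCommGroup V] [Module F V]
  {ρ : H →ₐ[F] Module.End F V} {κ : V [⋀^Fin 2]→ₗ[F] H} {B : LinearMap.BilinForm F V}
  {Ht : Type*} [Ring Ht] [HopfAlgebra F Ht] {π : Ht →ₐc[F] H} {γ : Ht →ₐ[F] Cliff B}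

theorem exists_inducedAction (M S : Type*) [AddCommGroup M] [Module F M]
    [Module (HeckeAlgebra ρ κ) M] [IsScalarTower F (HeckeAlgebra ρ κ) M] [AddCommGroup S]
    [Module F S] [Module (Cliff B) S] [IsScalarTower F (Cliff B) S] {D : AC ρ κ B}
    (hDQ : ∀ h, D * diagAC ρ κ π γ h = acInvolute ρ κ B (diagAC ρ κ π γ h) * D)
    (hθ : ∀ h, acInvolute ρ κ B (diagAC ρ κ π γ h) ∈ (diagAC ρ κ π γ).range) :
    ∃ τ : QuotHopf π γ →ₐ[F] Module.End F (DiracCohomology M S D), IsInducedAction π γ D τ := by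
  set act := actMS ρ κ (B := B) M S with hact
  have hker : ∀ h, ∀ x ∈ LinearMap.ker (act D), act (diagAC ρ κ π γ h) x ∈ LinearMap.ker (act D) := by
    intro h x hx
    rw [LinearMap.mem_ker] at hx ⊢
    rw [← Module.End.mul_apply, ← map_mul act, hDQ, map_mul act, Module.End.mul_apply, hx, map_zero]
  -- The commutation rule is applied to a preimage of `θ(Δ_C(h))`, which gives `Δ_C(h) D = D
  -- θ(Δ_C(h))`.
  have hrange : ∀ h, ∀ x ∈ LinearMap.range (act D),
      act (diagAC ρ κ π γ h) x ∈ LinearMap.range (act D) := by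
    rintro h _ ⟨x, rfl⟩
    obtain ⟨h', hh'⟩ := hθ h
    have hh : diagAC ρ κ π γ h' = acInvolute ρ κ B (diagAC ρ κ π γ h) := hh'
    have h1 := hDQ h'
    rw [hh, acInvolute_acInvolute] at h1
    refine ⟨act (acInvolute ρ κ B (diagAC ρ κ π γ h)) x, ?_⟩
    rw [← Module.End.mul_apply, ← map_mul act, h1, map_mul act, Module.End.mul_apply]
  let r : Ht → Module.End F (LinearMap.ker (act D)) := fun h =>
    (act (diagAC ρ κ π γ h)).restrict (hker h)
  have hr : ∀ h, (LinearMap.range (act D) ⊓ LinearMap.ker (act D)).submoduleOf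
      (LinearMap.ker (act D)) ≤ ((LinearMap.range (act D) ⊓ LinearMap.ker (act D)).submoduleOf
      (LinearMap.ker (act D))).comap (r h) := fun h x hx => ⟨hrange h x hx.1, hker h x hx.2⟩
  let t : Ht → Module.End F (DiracCohomology M S D) := fun h => Submodule.mapQ _ _ (r h) (hr h)
  have htr : ∀ h x, t h (diracClass M S D x) = diracClass M S D (r h x) := fun h x => rfl
  have hext : ∀ f g : Module.End F (DiracCohomology M S D),
      (∀ x, f (diracClass M S D x) = g (diracClass M S D x)) → f = g := by
    intro f g hfg
    refine LinearMap.ext fun u => ?_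
    obtain ⟨x, rfl⟩ := Submodule.mkQ_surjective _ u
    exact hfg x
  let T : Ht →ₐ[F] Module.End F (DiracCohomology M S D) :=
    { toFun := t
      map_one' := hext _ _ fun x => by
        rw [htr, Module.End.one_apply]
        congr 1
        refine Subtype.ext ?_
        change act (diagAC ρ κ π γ 1) x = x
        rw [map_one, map_one, Module.End.one_apply]
      map_mul' := fun h k => hext _ _ fun x => by
        rw [Module.End.mul_apply, htr, htr, htr]
        congr 1
        refine Subtype.ext ?_
        change act (diagAC ρ κ π γ (h * k)) x = act (diagAC ρ κ π γ h) (act (diagAC ρ κ π γ k) x)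
        rw [map_mul (diagAC ρ κ π γ), map_mul act, Module.End.mul_apply]
      map_zero' := hext _ _ fun x => by
        rw [htr, LinearMap.zero_apply, ← map_zero (diracClass M S D)]
        congr 1
        refine Subtype.ext ?_
        change act (diagAC ρ κ π γ 0) x = 0
        rw [map_zero, map_zero, LinearMap.zero_apply]
      map_add' := fun h k => hext _ _ fun x => by
        rw [LinearMap.add_apply, htr, htr, htr, ← map_add (diracClass M S D)]
        congr 1
        refine Subtype.ext ?_
        change act (diagAC ρ κ π γ (h + k)) x = act (diagAC ρ κ π γ h) x + act (diagAC ρ κ π γ k) x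
        rw [map_add, map_add, LinearMap.add_apply]
      commutes' := fun c => hext _ _ fun x => by
        rw [htr, Module.algebraMap_end_apply, ← map_smul (diracClass M S D)]
        congr 1
        refine Subtype.ext ?_
        change act (diagAC ρ κ π γ (algebraMap F Ht c)) x = c • (x : M ⊗[F] S)
        rw [AlgHom.commutes, AlgHom.commutes, Module.algebraMap_end_apply] }
  have hT : ∀ h ∈ RingHom.ker (diag π γ), T h = 0 := by
    intro h hh
    refine hext _ _ fun x => ?_
    change t h _ = _
    rw [htr, LinearMap.zero_apply, ← map_zero (diracClass M S D)]
    congr 1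
    refine Subtype.ext ?_
    change act (diagAC ρ κ π γ h) x = 0
    have : diagAC ρ κ π γ h = 0 := by
      rw [diagAC, AlgHom.comp_apply, (RingHom.mem_ker).1 hh, map_zero]
    rw [this, map_zero, LinearMap.zero_apply]
  exact ⟨Ideal.Quotient.liftₐ _ T hT, fun h x => ⟨r h x, rfl, rfl⟩⟩

/-- For `x` in `ker D` the term `a D x` vanishes, so `c x` and `Δ_C(h) x` differ by `D (a x)`, where
`h` lifts `y`. This element lies in `im D`, and in `ker D` because both vectors do. -/
theorem IsInducedAction.apply_eq_smul {M S : Type*} [AddCommGroup M] [Module F M]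
    [Module (HeckeAlgebra ρ κ) M] [IsScalarTower F (HeckeAlgebra ρ κ) M] [AddCommGroup S]
    [Module F S] [Module (Cliff B) S] [IsScalarTower F (Cliff B) S] {D : AC ρ κ B}
    {τ : QuotHopf π γ →ₐ[F] Module.End F (DiracCohomology M S D)} (hτ : IsInducedAction π γ D τ)
    {z : HeckeAlgebra ρ κ} {y : QuotHopf π γ} {a : AC ρ κ B}
    (hz : z ⊗ₜ[F] (1 : Cliff B) = quotDiagAC ρ κ π γ y + D * a + a * D) {c : F}
    (hc : ∀ m : M, z • m = c • m) (u : DiracCohomology M S D) : τ y u = c • u := by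
  obtain ⟨h, rfl⟩ := Ideal.Quotient.mkₐ_surjective F _ y
  obtain ⟨x, rfl⟩ := Submodule.mkQ_surjective _ u
  obtain ⟨x', hx', hτx⟩ := hτ h x
  refine hτx.trans ?_
  change diracClass M S D x' = c • diracClass M S D x
  have hzx : ∀ w : M ⊗[F] S, actMS ρ κ M S (z ⊗ₜ[F] (1 : Cliff B)) w = c • w := by
    intro w
    induction w with
    | zero => rw [map_zero, smul_zero]
    | add w w' hw hw' => rw [map_add, hw, hw', smul_add]
    | tmul m s =>
      have : actMS ρ κ M S (z ⊗ₜ[F] (1 : Cliff B)) (m ⊗ₜ s) = (z • m) ⊗ₜ ((1 : Cliff B) • s) := rfl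
      rw [this, hc, one_smul, TensorProduct.smul_tmul']
  rw [← map_smul, eq_comm, Submodule.mkQ_apply, Submodule.mkQ_apply, Submodule.Quotient.eq]
  have hx := LinearMap.mem_ker.1 x.2
  refine ⟨⟨actMS ρ κ M S a x, ?_⟩, (c • x - x').2⟩
  have h1 := hzx x
  rw [hz, map_add, map_add, map_mul, map_mul, LinearMap.add_apply, LinearMap.add_apply,
    Module.End.mul_apply, Module.End.mul_apply, hx, map_zero, add_zero] at h1
  have h2 : actMS ρ κ M S (quotDiagAC ρ κ π γ (Ideal.Quotient.mkₐ F _ h)) x = (x' : M ⊗[F] S) :=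
    hx'.symm
  rw [h2] at h1
  change _ = c • (x : M ⊗[F] S) - x'
  rw [← h1, add_sub_cancel_left]

end Cohomology

end BarbaschSahi

end

theorem theorem4p3
    {F : Type*} [Field F] [CharZero F]
    -- the pointed cocommutative Hopf algebra `H` and its module `V`
    {H : Type*} [Ring H] [HopfAlgebra F H] [Coalgebra.IsCocomm F H]
    (hH : BarbaschSahi.IsPointed F H)
    {V : Type*} [AddCommGroup V] [Module F V] [FiniteDimensional F V]
    (ρ : H →ₐ[F] Module.End F V) (B : LinearMap.BilinForm F V) (κ : V [⋀^Fin 2]→ₗ[F] H)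
    -- `A` is a Hopf-Hecke algebra
    (hA : BarbaschSahi.IsHopfHecke ρ κ B)
    -- a pin cover of `(H, V)`
    {Ht : Type*} [Ring Ht] [HopfAlgebra F Ht]
    (π : Ht →ₐc[F] H) (γ : Ht →ₐ[F] BarbaschSahi.Cliff B)
    (hpin : BarbaschSahi.IsPinCover ρ B π γ)
    -- the Dirac element, given by any pair of dual bases
    {ι : Type*} [Fintype ι] [DecidableEq ι] (b : Module.Basis ι F V)
    (D : BarbaschSahi.AC ρ κ B)
    (hD : D = BarbaschSahi.dirac ρ κ B hA.orthogonal.nondegenerate b)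
    -- `A` is a Barbasch-Sahi algebra
    (hP : BarbaschSahi.Parthasarathy ρ κ π γ D) :
    -- the algebra map `ζ : Z(A) → Z(H')`
    ∃ ζ : Subalgebra.center F (BarbaschSahi.HeckeAlgebra ρ κ) →ₐ[F]
        Subalgebra.center F (BarbaschSahi.QuotHopf π γ),
      -- `z ⊗ 1 = Δ_C(ζ(z)) + D a + a D` for some `a` in `(A ⊗ C)_det^odd`
      (∀ z : Subalgebra.center F (BarbaschSahi.HeckeAlgebra ρ κ),
        ∃ a : BarbaschSahi.AC ρ κ B, BarbaschSahi.IsDetOdd ρ κ π γ a ∧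
          (z : BarbaschSahi.HeckeAlgebra ρ κ) ⊗ₜ[F] (1 : BarbaschSahi.Cliff B) =
            BarbaschSahi.quotDiagAC ρ κ π γ (ζ z) + D * a + a * D) ∧
      -- and `ζ(z)` is determined uniquely by this
      (∀ (z : Subalgebra.center F (BarbaschSahi.HeckeAlgebra ρ κ))
        (y : Subalgebra.center F (BarbaschSahi.QuotHopf π γ)) (a : BarbaschSahi.AC ρ κ B),
        BarbaschSahi.IsDetOdd ρ κ π γ a →
        (z : BarbaschSahi.HeckeAlgebra ρ κ) ⊗ₜ[F] (1 : BarbaschSahi.Cliff B) =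
            BarbaschSahi.quotDiagAC ρ κ π γ y + D * a + a * D →
        y = ζ z) ∧
      -- for all `A`-modules `M` with a central character `χ`, and all (spin) modules `S` of `C`
      (∀ (M : Type*) [AddCommGroup M] [Module F M] [Module (BarbaschSahi.HeckeAlgebra ρ κ) M]
        [IsScalarTower F (BarbaschSahi.HeckeAlgebra ρ κ) M]
        (S : Type*) [AddCommGroup S] [Module F S] [Module (BarbaschSahi.Cliff B) S]
        [IsScalarTower F (BarbaschSahi.Cliff B) S]
        (χ : Subalgebra.center F (BarbaschSahi.HeckeAlgebra ρ κ) →ₐ[F] F),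
        (∀ (z : Subalgebra.center F (BarbaschSahi.HeckeAlgebra ρ κ)) (m : M),
          (z : BarbaschSahi.HeckeAlgebra ρ κ) • m = χ z • m) →
        -- the Dirac cohomology is an `H'`-module through `Δ_C`
        ∃ τ : BarbaschSahi.QuotHopf π γ →ₐ[F]
            Module.End F (BarbaschSahi.DiracCohomology M S D),
          BarbaschSahi.IsInducedAction π γ D τ ∧
          -- and `χ = σ ∘ ζ` for each nonzero `H'`-submodule `(U, σ)`
          ∀ (U : Submodule F (BarbaschSahi.DiracCohomology M S D))
            (σ : BarbaschSahi.QuotHopf π γ →ₐ[F] Module.End F U),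
            (∀ (h : BarbaschSahi.QuotHopf π γ) (u : U),
              (σ h u : BarbaschSahi.DiracCohomology M S D) = τ h u) →
            U ≠ ⊥ →
            ∀ z : Subalgebra.center F (BarbaschSahi.HeckeAlgebra ρ κ),
              σ (ζ z) = algebraMap F (Module.End F U) (χ z)) := by
  have := hpin.cocomm
  obtain ⟨ζ, hζ, huniq⟩ := BarbaschSahi.exists_center_algHom hA hpin hD hP
  refine ⟨ζ, hζ, huniq, fun M _ _ _ _ S _ _ _ _ χ hχ => ?_⟩
  obtain ⟨τ, hτ⟩ := BarbaschSahi.exists_inducedAction (π := π) (γ := γ) (D := D) M S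
    (hD ▸ hpin.dirac_mul κ hA.orthogonal.nondegenerate b hA.orthogonal)
    (hpin.acInvolute_mem κ hA.orthogonal)
  -- The scalar action of `ζ z` holds on the whole cohomology, so it restricts to `U`.
  refine ⟨τ, hτ, fun U σ hσ _ z => LinearMap.ext fun u => Subtype.ext ?_⟩
  obtain ⟨a, -, haz⟩ := hζ z
  rw [hσ, hτ.apply_eq_smul haz (hχ z)]
  rfl
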